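/- **Setting.** Let $p=2^m$ and let threads $0,\dots,p-1$ execute *work-stealing with deterministic team-building with one queue per task size*, as follows. Every task $\tau$ has a fixed thread requirement $r_\tau\in\{2^0,2^1,\dots,2^m\}$. Thread $i$ has queues $Q_{i,0},\dots,Q_{i,m}$, where $Q_{i,j}$ holds tasks of requirement $2^j$ (the owner works at the bottom, thieves at the top); a coordinator reference $c_i$; a registration structure $R_i=(r,a,t,N)$ (required, acquired and teamed threads, revocation counter); a slot for an offered task; a countdown $G_i$ of the team members that have not yet started that task; and the value of its coordinator's $N$ at its last registration. Threads $x$ and $y$ *overlap* for size $r$ if $\lfloor x/r\rfloor=\lfloor y/r\rfloor$. The partner of $i$ at level $\ell$ is $i\oplus 2^\ell$. A thread $i$ with $c_i\ne i$ is *teamed* if it overlaps with $c_i$ for size $R_{c_i}.t$; its registration is *active* if the stored counter equals $R_{c_i}.N$. Initially $c_i=i$, $a=t=1$, the queues hold finitely many pairwise distinct tasks, and all threads look for a task. The threads then act in an arbitrary interleaving of atomic steps, in which every thread makes infinitely many steps; a step is one iteration of one of the following loops. - *Getting a task.* A thread first waits until $G_i=0$. - If $c_i\neq i$: if it is teamed,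 it starts the task offered by $c_i$ unless it was the last one it executed (decrementing $G_{c_i}$), and otherwise waits; if it is not teamed and not active, it sets $c_i:=i$; if it is active and not teamed, it deregisters when it has itself a task requiring fewer than $R_{c_i}.r$ threads, and otherwise polls partners with $r=R_{c_i}.r$. - If $c_i=i$: it withdraws its previous offer and determines the requirement $w$ of its next task, namely $w=t$ if the queue for size $t$ is nonempty, else the size of its smallest nonempty queue, else $w=1$. A team with $w<t$ is shrunk to size $w$, and a team with $1<t<w$ is disbanded ($t=1$); in both cases $a:=t$, $N:=N+1$, $r:=w$. If its queues are all empty, it goes on to stealing; if $r=a$, it sets $t:=r$, $G_i:=r-1$, pops the bottom task of that queue, offers it to its team and executes it; otherwise it polls partners with $r$. - *Stealing*, for $\ell=0,1,\dots$ with $2^\ell<p$. Let $x$ be the partner at level $\ell$. If $R_{c_x}.r\ge 2^{\ell+1}$ and $i$ and $c_x$ overlap for size $R_{c_x}.r$, then $i$ registers at $c_x$ ($a:=a+1$ there, $c_i:=c_x$). Otherwise, if there is $j\le\ell$ with $T=\min(\lfloor |Q_{x,j}|/2\rfloor,2^\ell)>0$, it moves $T$ tasks from the top of such a $Q_{x,j}$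 to the bottom of $Q_{i,j}$. In both cases it returns to getting a task. Otherwise it goes on with $\ell+1$. - *Polling partners with $r$*, for $\ell=0,1,\dots$ with $2^\ell<r$. If the partner $x$ has a coordinator $c_x\ne c_i$ with $R_{c_x}.r=r$ and $c_x<c_i$, or with $2^{\ell+1}\le R_{c_x}.r<r$, then $i$ switches to $c_x$. If $c_x\neq c_i$, $R_{c_x}.r<r$ and $R_{c_x}.r<2^{\ell+1}$, it steals from $x$ as above if possible, and returns. Otherwise it goes on with $\ell+1$. - *Switching to $y$.* If $i$ and $y$ do not overlap for size $R_y.r$, or $c_i\ne i$ and $i$ is teamed, it returns. If $c_i\neq i$ it deregisters ($a:=a-1$ at $c_i$ if its registration is active; $c_i:=i$) and tries again. If $c_i=i$ it registers at $y$, and, if it was coordinating a task with $R_i.r>1$, sets $r=a=t=1$, $N:=N+1$ in $R_i$. - *Executing a task.* The thread may spawn new tasks, pushed to the bottom of its own queue of the right size, and eventually ends the execution. Whenever a thread with $c_i=i$ changes its queues, $R_i.r$ is set to $\max(t,w)$, with $w$ as above; whenever $R_i.r$ decreases, $a:=t$ and $N:=N+1$. The computation is *finite* if only finitely many tasks are ever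 created and the execution of a task by a thread ends, provided that all threads of its team start executing it. **Lemma.** Assume that the computation is finite. Suppose that at some time a thread $i$ has in one of its queues a task $\tau$ requiring $r\ge1$ threads. Then $\tau$ will eventually be executed by a team of $r$ consecutive threads: there is $k$ with $0\le k<p/r$ such that at some later time a coordinator in $[kr,(k+1)r-1]$ offers $\tau$ to its team, which has size $r$ and consists exactly of the threads $kr,kr+1,\dots,(k+1)r-1$; each of these threads subsequently starts and finishes executing $\tau$; and no other thread ever executes $\tau$. -/

import Mathlib

/-!
Work-stealing with deterministic team-building, with one queue per task size, for `p = 2 ^ m`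
hardware threads.  The algorithm is modelled as an interleaving transition system; one transition
is one iteration of a loop of the algorithm executed by one thread (every such iteration acts on
shared data through at most one queue operation, compare-and-swap or atomic decrement, together
with the reads that guard it).
-/

namespace TeamBuilding

/-- The ids `0, …, p - 1` of the hardware threads, `p = 2 ^ m`. -/
abbrev Thread (m : ℕ) : Type := Fin (2 ^ m)

/-- Threads `i` and `j` are in the same team of size `r`, i.e. in the same block
`[k r, (k + 1) r - 1]`. -/
def Overlap {m : ℕ} (r : ℕ) (i j : Thread m) : Prop := i.val / r = j.val / r

/-- The partner of thread `i` at level `l`: flip bit `l` of the id. -/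
def partner {m : ℕ} (i : Thread m) (l : ℕ) : Thread m :=
  ⟨(i.val ^^^ 2 ^ l) % 2 ^ m, Nat.mod_lt _ (Nat.two_pow_pos m)⟩

/-- The registration structure of a thread: number `r` of required threads, number `a` of acquired
(registered) threads, number `t` of teamed threads, and the counter `N` that is incremented
whenever registrations are revoked. -/
structure Reg where
  r : ℕ
  a : ℕ
  t : ℕ
  N : ℕ

/-- Program locations of a thread. -/
inductive PC (m : ℕ) (Task : Type*) where
  /-- at the head of the loop of `getTask` -/
  | getTask
  /-- in `stealTasks`, about to look at the partner at level `l` -/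
  | steal (l : ℕ)
  /-- in `pollPartners`, called with requirement `r`, about to look at the partner at level `l` -/
  | poll (r l : ℕ)
  /-- in `switchToCoordinator xc` -/
  | switchTo (xc : Thread m)
  /-- executing the task `τ` -/
  | running (τ : Task)

/-- A global state. -/
structure State (m : ℕ) (Task : Type*) where
  /-- `Q i j` is the queue of thread `i` for tasks requiring `2 ^ j` threads; the head of the list
  is the bottom of the queue (the owner's end), the end of the list is its top (the thieves' end) -/
  Q : Thread m → ℕ → List Task
  /-- the coordinator of a thread -/
  c : Thread m → Thread m
  /-- the registration structure of a thread -/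
  R : Thread m → Reg
  /-- the task that a coordinator offers to its team -/
  task : Thread m → Option Task
  /-- the number of team members that have not yet started the offered task -/
  G : Thread m → ℕ
  /-- the value of the coordinator's counter `N` at the thread's last registration -/
  cN : Thread m → ℕ
  /-- the last task executed by a thread -/
  last : Thread m → Option Task
  pc : Thread m → PC m Task
  /-- all tasks created so far; spawned tasks are new objects -/
  spawned : Set Task

variable {m : ℕ} {Task : Type*}

namespace State

/-- The lowest nonempty queue among `Q_0, …, Q_m` of thread `i`. -/
def minLevel (s : State m Task) (i : Thread m) : Option ℕ :=
  (List.range (m + 1)).find? fun j => !(s.Q i j).isEmpty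

/-- The requirement of the task that thread `i` works on next: a team stays with its queue as long
as this queue is nonempty; otherwise the smallest tasks come first.  It is `1` if there is no
task. -/
def want (s : State m Task) (i : Thread m) : ℕ :=
  if (s.Q i (Nat.log 2 (s.R i).t)).isEmpty then
    match s.minLevel i with
    | none => 1
    | some j => 2 ^ j
  else (s.R i).t

/-- Thread `i` is in the team of its coordinator. -/
def Teamed (s : State m Task) (i : Thread m) : Prop :=
  Overlap (s.R (s.c i)).t (s.c i) i

/-- The registration of thread `i` at its coordinator has not been revoked. -/
def Active (s : State m Task) (i : Thread m) : Prop :=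
  s.cN i = (s.R (s.c i)).N

/-- The team of coordinator `i`. -/
def team (s : State m Task) (i : Thread m) : Set (Thread m) :=
  {j | s.c j = i ∧ Overlap (s.R i).t i j}

def setPC (s : State m Task) (i : Thread m) (l : PC m Task) : State m Task :=
  { s with pc := Function.update s.pc i l }

def setR (s : State m Task) (i : Thread m) (R : Reg) : State m Task :=
  { s with R := Function.update s.R i R }

end State

/-- Change the number of required threads.  If it decreases, all threads outside the current team
have to register again. -/
def Reg.setReq (R : Reg) (r : ℕ) : Reg :=
  if r < R.r then { R with r := r, a := R.t, N := R.N + 1 } else { R with r := r }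

/-- Adapt the registration structure to the requirement `w` of the next task when the previous
task is finished.  A team that is too large is shrunk, a team that is too small is disbanded. -/
def Reg.retarget (R : Reg) (w : ℕ) : Reg :=
  if R.t = 1 ∨ w = R.t then R.setReq w
  else if w < R.t then ⟨w, w, w, R.N + 1⟩
  else ⟨w, 1, 1, R.N + 1⟩

namespace State

/-- Update of the requirement of thread `i` after a change of its own queues, if it is its own
coordinator.  The requirement never drops below the size of the current team. -/
def sync (s : State m Task) (i : Thread m) : State m Task :=
  if s.c i = i then s.setR i ((s.R i).setReq (max (s.R i).t (s.want i))) else s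

/-- `pushBottom` of the new task `τ`, by thread `i`. -/
def spawn (req : Task → ℕ) (s : State m Task) (i : Thread m) (τ : Task) : State m Task :=
  { s with
    Q := Function.update s.Q i
      (Function.update (s.Q i) (Nat.log 2 (req τ)) (τ :: s.Q i (Nat.log 2 (req τ))))
    spawned := insert τ s.spawned }.sync i

/-- The number of tasks that a thread takes from queue `j` of its partner `x` at level `l`. -/
def stealCount (s : State m Task) (x : Thread m) (l j : ℕ) : ℕ :=
  min ((s.Q x j).length / 2) (2 ^ l)

/-- `popappend`: thread `i` takes `T` tasks from the top of queue `j` of thread `x`, one after the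
other, and pushes each of them to the bottom of its own queue `j`. -/
def popappend (s : State m Task) (i x : Thread m) (j T : ℕ) : State m Task :=
  let kept := (s.Q x j).take ((s.Q x j).length - T)
  let taken := (s.Q x j).drop ((s.Q x j).length - T)
  { s with
    Q := Function.update (Function.update s.Q x (Function.update (s.Q x) j kept)) i
      (Function.update (s.Q i) j (taken ++ s.Q i j)) }.sync i

/-- Thread `i` registers at coordinator `xc` (and stops coordinating itself). -/
def register (s : State m Task) (i xc : Thread m) : State m Task :=
  let R' := if 1 < (s.R i).r then Function.update s.R i ⟨1, 1, 1, (s.R i).N + 1⟩ else s.R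
  { s with
    R := Function.update R' xc { s.R xc with a := (s.R xc).a + 1 }
    c := Function.update s.c i xc
    cN := Function.update s.cN i (s.R xc).N
    pc := Function.update s.pc i .getTask }

open Classical in
/-- Thread `i` gives up its coordinator, deregistering if its registration is still active. -/
noncomputable def leave (s : State m Task) (i : Thread m) : State m Task :=
  { s with
    R := if s.Active i then
        Function.update s.R (s.c i) { s.R (s.c i) with a := (s.R (s.c i)).a - 1 }
      else s.R
    c := Function.update s.c i i }

/-- Thread `i`, a coordinator that has finished its previous task, withdraws the offer of that task
and adapts its registration structure to its next task. -/
def prepare (s : State m Task) (i : Thread m) : State m Task :=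
  { s with
    task := Function.update s.task i none
    R := Function.update s.R i ((s.R i).retarget (s.want i)) }

/-- Coordinator `i`, for which enough threads have registered, fixes the team, pops its next task
`τ` (the remaining queue is `rest`), offers it to the team and starts executing it. -/
def launch (s : State m Task) (i : Thread m) (τ : Task) (rest : List Task) : State m Task :=
  { s with
    R := Function.update s.R i { s.R i with t := (s.R i).r }
    G := Function.update s.G i ((s.R i).r - 1)
    task := Function.update s.task i (some τ)
    last := Function.update s.last i (some τ)
    pc := Function.update s.pc i (.running τ)
    Q := Function.update s.Q i (Function.update (s.Q i) (Nat.log 2 (s.R i).r) rest) }.sync i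

/-- Team member `i` starts executing the task `τ` offered by its coordinator. -/
def start (s : State m Task) (i : Thread m) (τ : Task) : State m Task :=
  { s with
    G := Function.update s.G (s.c i) (s.G (s.c i) - 1)
    last := Function.update s.last i (some τ)
    pc := Function.update s.pc i (.running τ) }

/-- The coordinator of the partner `x` of thread `i` at level `l` requires thread `i`. -/
def Requires (s : State m Task) (i : Thread m) (l : ℕ) : Prop :=
  2 ^ (l + 1) ≤ (s.R (s.c (partner i l))).r ∧
    Overlap (s.R (s.c (partner i l))).r (s.c (partner i l)) i

/-- In `pollPartners`, called with requirement `r`, thread `i` finds that the partner at level `l`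
has another coordinator, whose task wins and needs thread `i`: it requires fewer threads, or the
same number and its coordinator has the smaller id. -/
def PartnerWins (s : State m Task) (i : Thread m) (r l : ℕ) : Prop :=
  let xc := s.c (partner i l)
  xc ≠ s.c i ∧
    (((s.R xc).r = r ∧ xc < s.c i) ∨ ((s.R xc).r < r ∧ 2 ^ (l + 1) ≤ (s.R xc).r))

/-- In `pollPartners`, called with requirement `r`, thread `i` finds that the partner at level `l`
works for another coordinator on a smaller task that does not need thread `i`. -/
def PartnerSmaller (s : State m Task) (i : Thread m) (r l : ℕ) : Prop :=
  let xc := s.c (partner i l)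
  xc ≠ s.c i ∧ (s.R xc).r < r ∧ (s.R xc).r < 2 ^ (l + 1)

/-- Thread `i` can take tasks from queue `j` of its partner at level `l`.  Tasks that need both
threads in the same team are not stolen. -/
def Stealable (s : State m Task) (i : Thread m) (l j : ℕ) : Prop :=
  j ≤ l ∧ 0 < s.stealCount (partner i l) l j

end State

open State

/-- `Step req i s s'`: thread `i` performs one transition from `s` to `s'`. -/
inductive Step (req : Task → ℕ) (i : Thread m) : State m Task → State m Task → Prop
  -- `getTask`
  /-- the previously coordinated task has not yet been started by the whole team -/
  | waitStarted {s} (hpc : s.pc i = .getTask) (hG : 0 < s.G i) : Step req i s s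
  /-- the registration has been revoked -/
  | revoked {s} (hpc : s.pc i = .getTask) (hG : s.G i = 0) (hc : s.c i ≠ i)
      (ht : ¬ s.Teamed i) (ha : ¬ s.Active i) :
      Step req i s { s with c := Function.update s.c i i }
  /-- a team member finds a new task ready -/
  | start {s} (τ : Task) (hpc : s.pc i = .getTask) (hG : s.G i = 0) (hc : s.c i ≠ i)
      (ht : s.Teamed i) (hτ : s.task (s.c i) = some τ) (hl : s.last i ≠ some τ) :
      Step req i s (s.start i τ)
  /-- a team member finds no new task -/
  | await {s} (hpc : s.pc i = .getTask) (hG : s.G i = 0) (hc : s.c i ≠ i)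
      (ht : s.Teamed i) (hτ : ∀ τ, s.task (s.c i) = some τ → s.last i = some τ) :
      Step req i s s
  /-- a registered thread has itself a task that is smaller than that of its coordinator -/
  | dropOut {s} (j : ℕ) (hpc : s.pc i = .getTask) (hG : s.G i = 0) (hc : s.c i ≠ i)
      (ht : ¬ s.Teamed i) (ha : s.Active i)
      (hj : s.minLevel i = some j) (hlt : 2 ^ j < (s.R (s.c i)).r) :
      Step req i s (s.leave i)
  /-- a registered thread helps building the team -/
  | help {s} (hpc : s.pc i = .getTask) (hG : s.G i = 0) (hc : s.c i ≠ i)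
      (ht : ¬ s.Teamed i) (ha : s.Active i)
      (hj : ∀ j, s.minLevel i = some j → (s.R (s.c i)).r ≤ 2 ^ j) :
      Step req i s (s.setPC i (.poll (s.R (s.c i)).r 0))
  /-- all local queues are empty -/
  | idle {s} (hpc : s.pc i = .getTask) (hG : s.G i = 0) (hc : s.c i = i)
      (hQ : s.minLevel i = none) :
      Step req i s ((s.prepare i).setPC i (.steal 0))
  /-- `coordinateTask`: enough threads have registered -/
  | launch {s} (τ : Task) (rest : List Task)
      (hpc : s.pc i = .getTask) (hG : s.G i = 0) (hc : s.c i = i) (hQ : s.minLevel i ≠ none)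
      (ha : ((s.prepare i).R i).r = ((s.prepare i).R i).a)
      (hτ : s.Q i (Nat.log 2 ((s.prepare i).R i).r) = τ :: rest) :
      Step req i s ((s.prepare i).launch i τ rest)
  /-- `coordinateTask`: more threads are needed -/
  | coordinate {s} (hpc : s.pc i = .getTask) (hG : s.G i = 0) (hc : s.c i = i)
      (hQ : s.minLevel i ≠ none)
      (ha : ((s.prepare i).R i).r ≠ ((s.prepare i).R i).a) :
      Step req i s ((s.prepare i).setPC i (.poll ((s.prepare i).R i).r 0))
  -- `stealTasks`
  /-- no partner is left -/
  | stealDone {s} (l : ℕ) (hpc : s.pc i = .steal l) (hl : 2 ^ m ≤ 2 ^ l) :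
      Step req i s (s.setPC i .getTask)
  /-- register for the task of the partner's coordinator -/
  | stealRegister {s} (l : ℕ) (hpc : s.pc i = .steal l) (hl : 2 ^ l < 2 ^ m)
      (h : s.Requires i l) :
      Step req i s (s.register i (s.c (partner i l)))
  /-- steal tasks of the partner -/
  | stealTasks {s} (l j : ℕ) (hpc : s.pc i = .steal l) (hl : 2 ^ l < 2 ^ m)
      (h : ¬ s.Requires i l) (hj : s.Stealable i l j) :
      Step req i s
        ((s.popappend i (partner i l) j (s.stealCount (partner i l) l j)).setPC i .getTask)
  /-- nothing to steal, next partner -/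
  | stealNext {s} (l : ℕ) (hpc : s.pc i = .steal l) (hl : 2 ^ l < 2 ^ m)
      (h : ¬ s.Requires i l) (hj : ∀ j, ¬ s.Stealable i l j) :
      Step req i s (s.setPC i (.steal (l + 1)))
  -- `pollPartners`
  /-- no partner is left -/
  | pollDone {s} (r l : ℕ) (hpc : s.pc i = .poll r l) (hl : r ≤ 2 ^ l) :
      Step req i s (s.setPC i .getTask)
  /-- the partner's task wins and needs this thread -/
  | pollSwitch {s} (r l : ℕ) (hpc : s.pc i = .poll r l) (hl : 2 ^ l < r)
      (h : s.PartnerWins i r l) :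
      Step req i s (s.setPC i (.switchTo (s.c (partner i l))))
  /-- the partner's task is smaller and does not need this thread: steal tasks of the partner -/
  | pollSteal {s} (r l j : ℕ) (hpc : s.pc i = .poll r l) (hl : 2 ^ l < r)
      (h : s.PartnerSmaller i r l) (hj : s.Stealable i l j) :
      Step req i s
        ((s.popappend i (partner i l) j (s.stealCount (partner i l) l j)).setPC i .getTask)
  /-- next partner -/
  | pollNext {s} (r l : ℕ) (hpc : s.pc i = .poll r l) (hl : 2 ^ l < r)
      (h : ¬ s.PartnerWins i r l)
      (hj : ∀ j, ¬ (s.PartnerSmaller i r l ∧ s.Stealable i l j)) :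
      Step req i s (s.setPC i (.poll r (l + 1)))
  -- `switchToCoordinator`
  /-- the new coordinator does not require this thread any more -/
  | switchVoid {s} (xc : Thread m) (hpc : s.pc i = .switchTo xc)
      (h : ¬ Overlap (s.R xc).r xc i) :
      Step req i s (s.setPC i .getTask)
  /-- the thread is in the team of its present coordinator and cannot drop out -/
  | switchTeamed {s} (xc : Thread m) (hpc : s.pc i = .switchTo xc)
      (h : Overlap (s.R xc).r xc i) (hc : s.c i ≠ i) (ht : s.Teamed i) :
      Step req i s (s.setPC i .getTask)
  /-- first drop the previous coordinator -/
  | switchLeave {s} (xc : Thread m) (hpc : s.pc i = .switchTo xc)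
      (h : Overlap (s.R xc).r xc i) (hc : s.c i ≠ i) (ht : ¬ s.Teamed i) :
      Step req i s (s.leave i)
  /-- register at the new coordinator -/
  | switchRegister {s} (xc : Thread m) (hpc : s.pc i = .switchTo xc)
      (h : Overlap (s.R xc).r xc i) (hc : s.c i = i) :
      Step req i s (s.register i xc)
  -- execution of a task
  /-- the execution goes on -/
  | runOn {s} (τ : Task) (hpc : s.pc i = .running τ) : Step req i s s
  /-- the executed task spawns a new task -/
  | spawn {s} (τ τ' : Task) (hpc : s.pc i = .running τ) (hnew : τ' ∉ s.spawned) :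
      Step req i s (s.spawn req i τ')
  /-- the execution of the task by this thread ends -/
  | finish {s} (τ : Task) (hpc : s.pc i = .running τ) :
      Step req i s (s.setPC i .getTask)

/-- Initial states: some pairwise different tasks are in the queues, each in a queue for its
requirement, and every thread is its own coordinator and looks for a task. -/
structure IsInitial (req : Task → ℕ) (s : State m Task) : Prop where
  size : ∀ i j τ, τ ∈ s.Q i j → req τ = 2 ^ j
  nodup : ∀ i j, (s.Q i j).Nodup
  disjoint : ∀ i i' j τ, τ ∈ s.Q i j → τ ∈ s.Q i' j → i = i'
  spawned : s.spawned = {τ | ∃ i j, τ ∈ s.Q i j}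
  c : ∀ i, s.c i = i
  reg : ∀ i, (s.R i).a = 1 ∧ (s.R i).t = 1 ∧ (s.R i).N = 0 ∧ (s.R i).r = s.want i
  task : ∀ i, s.task i = none
  G : ∀ i, s.G i = 0
  cN : ∀ i, s.cN i = 0
  last : ∀ i, s.last i = none
  pc : ∀ i, s.pc i = .getTask

/-- An execution of the algorithm: an interleaving of the steps of the threads in which no thread
is suspended forever. -/
structure Execution (m : ℕ) {Task : Type*} (req : Task → ℕ) where
  state : ℕ → State m Task
  /-- the thread that performs the `n`-th step -/
  sched : ℕ → Thread m
  init : IsInitial req (state 0)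
  step : ∀ n, Step req (sched n) (state n) (state (n + 1))
  fair : ∀ i n, ∃ n' ≥ n, sched n' = i

namespace Execution

variable {req : Task → ℕ}

/-- Thread `i` executes the task `τ` at time `n`. -/
def Runs (e : Execution m req) (n : ℕ) (i : Thread m) (τ : Task) : Prop :=
  (e.state n).pc i = .running τ

/-- The computation is finite: only finitely many tasks are created, and the execution of a task
by a thread ends, provided that all other threads of the team start executing the task, too. -/
def FiniteComputation (e : Execution m req) : Prop :=
  {τ | ∃ n, τ ∈ (e.state n).spawned}.Finite ∧
  ∀ n i τ, e.Runs n i τ → (∀ j, Overlap (req τ) i j → ∃ n', e.Runs n' j τ) →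
    ∃ n' ≥ n, ¬ e.Runs n' i τ

/-- From time `n` on, the task `τ` is executed by a team consisting of the threads in the set `B`:
at some time a coordinator offers `τ` to its team, which is `B` and has the size required by `τ`,
then every thread in `B` starts and ends executing `τ`, and no other thread ever does so. -/
def ExecutedByTeam (e : Execution m req) (n : ℕ) (τ : Task) (B : Set (Thread m)) : Prop :=
  (∃ n₀ ≥ n, ∃ i ∈ B, (e.state n₀).task i = some τ ∧ ((e.state n₀).R i).t = req τ ∧
    (e.state n₀).team i = B ∧
    ∀ j ∈ B, ∃ n₁ ≥ n₀, e.Runs n₁ j τ ∧ ∃ n₂ > n₁, ¬ e.Runs n₂ j τ) ∧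
  ∀ n' j, e.Runs n' j τ → j ∈ B

end Execution

end TeamBuilding

/-! The proof has a safety half and a liveness half.

Safety: a launched task is executed exactly as claimed (`executedByTeam_of_launches`). By `RegInv`,
the count `a` of a coordinator is `t` plus the number of threads outside its team whose registration
carries the current counter, and these threads lie in its block of size `r`. If `a = r`, counting
shows that they fill the block, so the team fixed at a launch is the whole block
(`RegInv.c_eq_of_acquired`). `QueueInv` keeps executed tasks out of the queues, so no task is
launched twice. `OfferInv` makes `G` the exact number of threads of the block that have not started
the offered task, so an offer disappears only after everybody has started it. A team member that is
late for an offer is at most busy with an earlier task, which its whole team has started; that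
execution ends by finiteness, so waiting is never circular.

Liveness: every queued task is launched (`exists_launches`). A task leaves the queues only by a
launch, so it suffices that the queues become empty. There are finitely many tasks, hence finitely
many launches, and eventually nothing runs (`eventually_quiet`); then all teams shrink to single
threads. From then on a thief only takes tasks smaller than all of its own and never empties a queue
of its victim, so each theft lowers the sum over all threads of the level of the smallest task, and
thefts end (`eventually_Q_eq`).

After that the sizes `V` of the smallest tasks are fixed and coordinators merely compete for
threads, ranked by `prio`: first by size, then by id. By induction on the rank each coordinator
gives up only finitely often: it does so only to follow a better one, and as long as the better ones
persist it never leads again (`eventually_leads_stable`). Once the set of coordinators is constant,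
the rank of the coordinator a thread is working for can only improve, hence all registrations freeze
(`exists_eventually_frozen`).

Suppose a coordinator remained, and let `x` be the best one. Its block is captured by doubling: if
all threads of the block of size `2 ^ k` around `x` have coordinator `x`, then a thread in the other
half of the block of size `2 ^ (k + 1)` has its partner at level `k` among them, would notice this
and would come over (`coordinator_eq_of_overlap`). So `x` has acquired all the threads it needs and
would launch (`not_frozen_of_mem`), a contradiction. Without coordinators there is no task left. -/

namespace TeamBuilding

variable {m : ℕ} {Task : Type*}

/-! ### Blocks of threads and partners -/

/-- The possible sizes of tasks and teams. -/
def IsSize (m r : ℕ) : Prop := ∃ k ≤ m, r = 2 ^ k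

theorem isSize_one : IsSize m 1 := ⟨0, Nat.zero_le _, rfl⟩

theorem isSize_two_pow {k : ℕ} (hk : k ≤ m) : IsSize m (2 ^ k) := ⟨k, hk, rfl⟩

theorem IsSize.pos {r : ℕ} (h : IsSize m r) : 0 < r := by
  obtain ⟨k, -, rfl⟩ := h
  exact Nat.two_pow_pos k

theorem IsSize.le {r : ℕ} (h : IsSize m r) : r ≤ 2 ^ m := by
  obtain ⟨k, hk, rfl⟩ := h
  exact Nat.pow_le_pow_right (by norm_num) hk

theorem IsSize.dvd {r : ℕ} (h : IsSize m r) : r ∣ 2 ^ m := by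
  obtain ⟨k, hk, rfl⟩ := h
  exact Nat.pow_dvd_pow 2 hk

theorem IsSize.dvd_of_le {r r' : ℕ} (h : IsSize m r) (h' : IsSize m r') (hle : r ≤ r') :
    r ∣ r' := by
  obtain ⟨k, -, rfl⟩ := h
  obtain ⟨k', -, rfl⟩ := h'
  exact Nat.pow_dvd_pow 2 ((Nat.pow_le_pow_iff_right (by norm_num)).1 hle)

theorem IsSize.two_pow_log {r : ℕ} (h : IsSize m r) : 2 ^ Nat.log 2 r = r := by
  obtain ⟨k, -, rfl⟩ := h
  rw [Nat.log_pow (by norm_num)]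

theorem IsSize.log_le {r : ℕ} (h : IsSize m r) : Nat.log 2 r ≤ m := by
  obtain ⟨k, hk, rfl⟩ := h
  rwa [Nat.log_pow (by norm_num)]

theorem IsSize.max {r r' : ℕ} (h : IsSize m r) (h' : IsSize m r') : IsSize m (max r r') := by
  rcases max_choice r r' with e | e <;> rw [e] <;> assumption

theorem Overlap.refl (r : ℕ) (i : Thread m) : Overlap r i i := rfl

theorem Overlap.trans {r : ℕ} {i j k : Thread m} (h : Overlap r i j) (h' : Overlap r j k) :
    Overlap r i k := Eq.trans h h'

theorem overlap_one {i j : Thread m} : Overlap 1 i j ↔ i = j := by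
  simp [Overlap, Fin.ext_iff]

theorem Overlap.mono {r r' : ℕ} {i j : Thread m} (h : Overlap r i j) (hr : r ∣ r') :
    Overlap r' i j := by
  obtain ⟨d, rfl⟩ := hr
  unfold Overlap at *
  rw [← Nat.div_div_eq_div_mul, ← Nat.div_div_eq_div_mul, h]

theorem Overlap.mono_size {r r' : ℕ} {i j : Thread m} (h : Overlap r i j) (hr : IsSize m r)
    (hr' : IsSize m r') (hle : r ≤ r') : Overlap r' i j :=
  h.mono (hr.dvd_of_le hr' hle)

open Classical in
/-- The block of size `r` around `x`. -/
noncomputable def block (r : ℕ) (x : Thread m) : Finset (Thread m) :=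
  Finset.univ.filter fun j => Overlap r x j

@[simp] theorem mem_block {r : ℕ} {x j : Thread m} : j ∈ block r x ↔ Overlap r x j := by
  simp [block]

theorem overlap_iff_mem_Icc {r : ℕ} (hr : 0 < r) (x j : Thread m) :
    Overlap r x j ↔ x.val / r * r ≤ j.val ∧ j.val ≤ (x.val / r + 1) * r - 1 := by
  unfold Overlap
  generalize x.val / r = k
  rw [eq_comm, Nat.div_eq_iff hr]
  have : k * r + r = (k + 1) * r := by ring
  omega

/-- Since `r` divides `2 ^ m`, the last block is not cut off, so the ids of a block form a full
interval. -/
theorem card_block {r : ℕ} (hr : IsSize m r) (x : Thread m) : (block r x).card = r := by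
  have hpos := hr.pos
  obtain ⟨d, hd⟩ := hr.dvd
  have hx : x.val / r < d := by
    rw [Nat.div_lt_iff_lt_mul hpos, mul_comm, ← hd]
    exact x.2
  have hle : (x.val / r + 1) * r ≤ 2 ^ m := by
    calc _ ≤ d * r := Nat.mul_le_mul_right r hx
      _ = 2 ^ m := by rw [hd, mul_comm]
  have key : (block r x).map Fin.valEmbedding
      = Finset.Ico (x.val / r * r) ((x.val / r + 1) * r) := by
    ext y
    simp only [Finset.mem_map, mem_block, overlap_iff_mem_Icc hpos, Fin.valEmbedding_apply,
      Finset.mem_Ico]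
    have : 0 < (x.val / r + 1) * r := Nat.mul_pos (Nat.succ_pos _) hpos
    constructor
    · rintro ⟨j, hj, rfl⟩
      omega
    · intro hy
      exact ⟨⟨y, by omega⟩, by dsimp only; omega, rfl⟩
  rw [← Finset.card_map Fin.valEmbedding, key, Nat.card_Ico]
  have : (x.val / r + 1) * r = x.val / r * r + r := by ring
  omega

theorem partner_val {i : Thread m} {l : ℕ} (hl : l < m) :
    (partner i l).val = i.val ^^^ 2 ^ l :=
  Nat.mod_eq_of_lt (Nat.xor_lt_two_pow i.2 (Nat.pow_lt_pow_right (by norm_num) hl))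

theorem partner_ne {i : Thread m} {l : ℕ} (hl : l < m) : partner i l ≠ i := by
  intro h
  have h' := congrArg Fin.val h
  rw [partner_val hl] at h'
  have := congrArg (fun a => Nat.testBit a l) h'
  simp [Nat.testBit_xor, Nat.testBit_two_pow_self] at this

theorem partner_div {i : Thread m} {l k : ℕ} (hl : l < m) (hk : k ≤ l) :
    (partner i l).val / 2 ^ k = (i.val / 2 ^ k) ^^^ 2 ^ (l - k) := by
  rw [partner_val hl]
  apply Nat.eq_of_testBit_eq
  intro n
  rw [Nat.testBit_xor, Nat.testBit_div_two_pow, Nat.testBit_div_two_pow, Nat.testBit_xor,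
    Nat.testBit_two_pow, Nat.testBit_two_pow]
  congr 2
  simp only [eq_iff_iff]
  omega

theorem overlap_partner {i : Thread m} {l k : ℕ} (hl : l < k) (hk : k ≤ m) :
    Overlap (2 ^ k) (partner i l) i := by
  unfold Overlap
  rw [partner_val (lt_of_lt_of_le hl hk)]
  apply Nat.eq_of_testBit_eq
  intro n
  rw [Nat.testBit_div_two_pow, Nat.testBit_div_two_pow, Nat.testBit_xor, Nat.testBit_two_pow]
  simp only [show ¬ l = n + k by omega, decide_false, Bool.xor_false]

theorem IsSize.overlap_partner {r : ℕ} (hr : IsSize m r) (i : Thread m) {l : ℕ}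
    (hl : 2 ^ l < r) : Overlap r (partner i l) i := by
  obtain ⟨k, hk, rfl⟩ := hr
  exact TeamBuilding.overlap_partner ((Nat.pow_lt_pow_iff_right (by norm_num)).1 hl) hk

/-- A block of size `2 ^ (k + 1)` has two halves, and flipping bit `k` exchanges them. This is the
geometric step of the doubling argument for the best coordinator. -/
theorem overlap_partner_of_not_overlap {x i : Thread m} {k : ℕ} (hk : k < m)
    (h : Overlap (2 ^ (k + 1)) x i) (h' : ¬ Overlap (2 ^ k) x i) :
    Overlap (2 ^ k) x (partner i k) := by
  unfold Overlap at *
  rw [partner_div hk le_rfl]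
  simp only [pow_succ, ← Nat.div_div_eq_div_mul] at h
  generalize x.val / 2 ^ k = a at *
  generalize i.val / 2 ^ k = b at *
  have hb : b ^^^ 2 ^ (k - k) = b ^^^ 1 := by simp
  rw [hb]
  rcases Nat.even_or_odd b with hb | hb
  · rw [Nat.xor_one_of_even hb]
    obtain ⟨c, rfl⟩ := hb
    omega
  · rw [Nat.xor_one_of_odd hb]
    obtain ⟨c, rfl⟩ := hb
    omega

end TeamBuilding

namespace TeamBuilding

variable {m : ℕ} {Task : Type*}

/-! ### Consistency of the registrations -/

open Classical in
/-- The threads with an active registration at `x` that are not in the team of `x`. -/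
noncomputable def helpers (c : Thread m → Thread m) (R : Thread m → Reg) (cN : Thread m → ℕ)
    (x : Thread m) : Finset (Thread m) :=
  Finset.univ.filter fun j => c j = x ∧ ¬ Overlap (R x).t x j ∧ cN j = (R x).N

@[simp] theorem mem_helpers {c : Thread m → Thread m} {R : Thread m → Reg} {cN : Thread m → ℕ}
    {x j : Thread m} :
    j ∈ helpers c R cN x ↔ c j = x ∧ ¬ Overlap (R x).t x j ∧ cN j = (R x).N := by
  simp [helpers]

/-- The registration structures agree with the coordinators and stored counters of the threads. -/
structure RegInv (c : Thread m → Thread m) (R : Thread m → Reg) (cN : Thread m → ℕ) : Prop where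
  size_r : ∀ x, IsSize m (R x).r
  size_t : ∀ x, IsSize m (R x).t
  t_le : ∀ x, (R x).t ≤ (R x).r
  r_eq_one : ∀ x, c x ≠ x → (R x).r = 1
  team : ∀ x j, c x = x → Overlap (R x).t x j → c j = x
  active : ∀ x j, c j = x → j ≠ x → cN j = (R x).N → Overlap (R x).r x j
  acquired : ∀ x, (R x).a = (R x).t + (helpers c R cN x).card
  cN_le : ∀ j, c j ≠ j → cN j ≤ (R (c j)).N

namespace RegInv

variable {c : Thread m → Thread m} {R : Thread m → Reg} {cN : Thread m → ℕ}

theorem t_eq_one (h : RegInv c R cN) {x : Thread m} (hx : (R x).r = 1) : (R x).t = 1 := by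
  have := h.t_le x
  have := (h.size_t x).pos
  omega

theorem c_eq (h : RegInv c R cN) {x : Thread m} (hx : 1 < (R x).r) : c x = x := by
  by_contra hc
  have := h.r_eq_one x hc
  omega

theorem one_lt_of_overlap (h : RegInv c R cN) {x j : Thread m} (hj : j ≠ x)
    (ho : Overlap (R x).r x j) : 1 < (R x).r := by
  have := (h.size_r x).pos
  by_contra hlt
  have e : (R x).r = 1 := by omega
  rw [e, overlap_one] at ho
  exact hj ho.symm

theorem one_lt_of_active (h : RegInv c R cN) {j : Thread m} (hj : c j ≠ j)
    (ha : cN j = (R (c j)).N) : 1 < (R (c j)).r :=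
  h.one_lt_of_overlap hj.symm (h.active _ _ rfl hj.symm ha)

/-- An active registration lies in the block of size `r = t`, so nobody outside the team can hold
one. -/
theorem a_eq_of_r_eq_t (h : RegInv c R cN) {x : Thread m} (hx : (R x).r = (R x).t) :
    (R x).a = (R x).t := by
  rw [h.acquired x, Finset.card_eq_zero.2, add_zero]
  ext j
  simp only [mem_helpers, Finset.notMem_empty, iff_false]
  rintro ⟨hc, ho, ha⟩
  refine ho ?_
  rw [← hx]
  exact h.active x j hc (by rintro rfl; exact ho rfl) ha

/-- The coordinator `x` revokes all registrations, and keeps at most a part of its team. -/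
theorem revoke (h : RegInv c R cN) {x : Thread m} (hx : c x = x) {r t : ℕ} (hr : IsSize m r)
    (ht : IsSize m t) (htr : t ≤ r) (htt : t ≤ (R x).t) :
    RegInv c (Function.update R x ⟨r, t, t, (R x).N + 1⟩) cN := by
  -- Stored counters never exceed the current one, so after the increment none of them matches and
  -- no registration at `x` is active.
  have hin : ∀ j, c j = x → j ≠ x → cN j ≤ (R x).N := by
    intro j hj hjx
    have := h.cN_le j (by rw [hj]; exact hjx.symm)
    rwa [hj] at this
  constructor
  · intro y
    rcases eq_or_ne y x with rfl | hy <;> simp [*, h.size_r]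
  · intro y
    rcases eq_or_ne y x with rfl | hy <;> simp [*, h.size_t]
  · intro y
    rcases eq_or_ne y x with rfl | hy <;> simp [*, h.t_le]
  · intro y hcy
    rcases eq_or_ne y x with rfl | hy
    · exact absurd hx hcy
    · simp [*, h.r_eq_one]
  · intro y j hcy ho
    rcases eq_or_ne y x with rfl | hy
    · simp only [Function.update_self] at ho
      exact h.team _ _ hx (ho.mono_size ht (h.size_t _) htt)
    · rw [Function.update_of_ne hy] at ho
      exact h.team _ _ hcy ho
  · intro y j hcj hjy hN
    rcases eq_or_ne y x with rfl | hy
    · simp only [Function.update_self] at hN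
      have := hin j hcj hjy
      omega
    · rw [Function.update_of_ne hy] at hN ⊢
      exact h.active _ _ hcj hjy hN
  · intro y
    rcases eq_or_ne y x with rfl | hy
    · rw [Finset.card_eq_zero.2]
      · simp
      · ext j
        simp only [mem_helpers, Function.update_self, Finset.notMem_empty, iff_false]
        rintro ⟨hc, ho, ha⟩
        have := hin j hc (by rintro rfl; exact ho rfl)
        omega
    · have e : helpers c (Function.update R x ⟨r, t, t, (R x).N + 1⟩) cN y = helpers c R cN y := by
        ext j; simp [hy]
      rw [e, Function.update_of_ne hy]
      exact h.acquired y
  · intro j hj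
    have := h.cN_le j hj
    rcases eq_or_ne (c j) x with hy | hy
    · rw [hy] at this ⊢
      simp only [Function.update_self]
      omega
    · rwa [Function.update_of_ne hy]

/-- The coordinator `x` raises its requirement. -/
theorem raise (h : RegInv c R cN) {x : Thread m} (hx : c x = x) {r : ℕ} (hr : IsSize m r)
    (hle : (R x).r ≤ r) : RegInv c (Function.update R x { R x with r := r }) cN := by
  have ht := h.t_le x
  have e : ∀ y, helpers c (Function.update R x { R x with r := r }) cN y = helpers c R cN y := by
    intro y
    ext j
    rcases eq_or_ne y x with rfl | hy <;> simp [*]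
  constructor
  · intro y
    rcases eq_or_ne y x with rfl | hy <;> simp [*, h.size_r]
  · intro y
    rcases eq_or_ne y x with rfl | hy <;> simp [*, h.size_t]
  · intro y
    rcases eq_or_ne y x with rfl | hy
    · simp; omega
    · simp [*, h.t_le]
  · intro y hcy
    rcases eq_or_ne y x with rfl | hy
    · exact absurd hx hcy
    · simp [*, h.r_eq_one]
  · intro y j hcy ho
    rcases eq_or_ne y x with rfl | hy
    · simp only [Function.update_self] at ho
      exact h.team _ _ hx ho
    · rw [Function.update_of_ne hy] at ho
      exact h.team _ _ hcy ho
  · intro y j hcj hjy hN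
    rcases eq_or_ne y x with rfl | hy
    · simp only [Function.update_self] at hN ⊢
      exact (h.active _ _ hcj hjy hN).mono_size (h.size_r _) hr hle
    · rw [Function.update_of_ne hy] at hN ⊢
      exact h.active _ _ hcj hjy hN
  · intro y
    rw [e]
    have := h.acquired y
    rcases eq_or_ne y x with rfl | hy <;> simp [*]
  · intro j hj
    have := h.cN_le j hj
    rcases eq_or_ne (c j) x with hy | hy
    · rw [hy] at this ⊢
      simpa using this
    · rwa [Function.update_of_ne hy]

/-- If `x` has acquired all required threads, then they are all registered. -/
theorem c_eq_of_acquired (h : RegInv c R cN) {x : Thread m} (hx : c x = x)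
    (ha : (R x).r = (R x).a) {j : Thread m} (hj : Overlap (R x).r x j) : c j = x := by
  by_cases ho : Overlap (R x).t x j
  · exact h.team x j hx ho
  have hsub : block (R x).t x ⊆ block (R x).r x := by
    intro k
    simp only [mem_block]
    exact fun hk => hk.mono_size (h.size_t x) (h.size_r x) (h.t_le x)
  have hsub' : helpers c R cN x ⊆ block (R x).r x \ block (R x).t x := by
    intro k
    simp only [mem_helpers, Finset.mem_sdiff, mem_block]
    rintro ⟨h1, h2, h3⟩
    exact ⟨h.active x k h1 (by rintro rfl; exact h2 rfl) h3, h2⟩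
  -- Both sides equal `r - t`, as `a = r` and `a` is `t` plus the number of helpers; so the
  -- inclusion `hsub'` is an equality.
  have hcard : (block (R x).r x \ block (R x).t x).card ≤ (helpers c R cN x).card := by
    rw [Finset.card_sdiff_of_subset hsub, card_block (h.size_r x), card_block (h.size_t x), ha,
      h.acquired x]
    omega
  have hmem : j ∈ helpers c R cN x := by
    rw [Finset.eq_of_subset_of_card_le hsub' hcard]
    simp [hj, ho]
  exact (mem_helpers.1 hmem).1

/-- The coordinator `x`, for which all required threads have registered, fixes its team. -/
theorem fixTeam (h : RegInv c R cN) {x : Thread m} (hx : c x = x) (ha : (R x).r = (R x).a) :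
    RegInv c (Function.update R x { R x with t := (R x).r }) cN := by
  constructor
  · intro y
    rcases eq_or_ne y x with rfl | hy <;> simp [*, h.size_r]
    rw [← ha]; exact h.size_r _
  · intro y
    rcases eq_or_ne y x with rfl | hy <;> simp [*, h.size_t]
    rw [← ha]; exact h.size_r _
  · intro y
    rcases eq_or_ne y x with rfl | hy <;> simp [*, h.t_le]
  · intro y hcy
    rcases eq_or_ne y x with rfl | hy
    · exact absurd hx hcy
    · simp [*, h.r_eq_one]
  · intro y j hcy ho
    rcases eq_or_ne y x with rfl | hy
    · simp only [Function.update_self] at ho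
      exact h.c_eq_of_acquired hx ha ho
    · rw [Function.update_of_ne hy] at ho
      exact h.team _ _ hcy ho
  · intro y j hcj hjy hN
    rcases eq_or_ne y x with rfl | hy
    · simp only [Function.update_self] at hN ⊢
      exact h.active _ _ hcj hjy hN
    · rw [Function.update_of_ne hy] at hN ⊢
      exact h.active _ _ hcj hjy hN
  · intro y
    rcases eq_or_ne y x with rfl | hy
    · rw [Finset.card_eq_zero.2]
      · simp [ha]
      · ext j
        simp only [mem_helpers, Function.update_self, Finset.notMem_empty, iff_false]
        rintro ⟨h1, h2, h3⟩
        exact h2 (h.active _ j h1 (by rintro rfl; exact h2 rfl) h3)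
    · have e : helpers c (Function.update R x { R x with t := (R x).r }) cN y
          = helpers c R cN y := by
        ext j; simp [hy]
      rw [e, Function.update_of_ne hy]
      exact h.acquired y
  · intro j hj
    have := h.cN_le j hj
    rcases eq_or_ne (c j) x with hy | hy
    · rw [hy] at this ⊢
      simpa using this
    · rwa [Function.update_of_ne hy]

/-- A thread whose registration is revoked gives up its coordinator. -/
theorem leaveInactive (h : RegInv c R cN) {i : Thread m} (hi : c i ≠ i)
    (ht : ¬ Overlap (R (c i)).t (c i) i) (hN : cN i ≠ (R (c i)).N) :
    RegInv (Function.update c i i) R cN := by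
  have hti := h.t_eq_one (h.r_eq_one i hi)
  refine ⟨h.size_r, h.size_t, h.t_le, ?_, ?_, ?_, ?_, ?_⟩
  · intro x hx
    rcases eq_or_ne x i with rfl | hxi
    · simp at hx
    · rw [Function.update_of_ne hxi] at hx
      exact h.r_eq_one x hx
  · intro x j hx ho
    rcases eq_or_ne x i with rfl | hxi
    · rw [hti, overlap_one] at ho
      simp [← ho]
    · rw [Function.update_of_ne hxi] at hx
      have hj := h.team x j hx ho
      rw [Function.update_of_ne]
      · exact hj
      · rintro rfl
        rw [hj] at ht
        exact ht ho
  · intro x j hj hjx ha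
    rcases eq_or_ne j i with rfl | hji
    · simp at hj
      exact absurd hj hjx
    · rw [Function.update_of_ne hji] at hj
      exact h.active x j hj hjx ha
  · intro x
    rw [h.acquired]
    congr 2
    ext j
    simp only [mem_helpers]
    rcases eq_or_ne j i with rfl | hji
    · simp only [Function.update_self]
      constructor
      · rintro ⟨rfl, -, ha⟩
        exact absurd ha hN
      · rintro ⟨rfl, ho, -⟩
        exact absurd rfl ho
    · rw [Function.update_of_ne hji]
  · intro j hj
    rcases eq_or_ne j i with rfl | hji
    · simp at hj
    · rw [Function.update_of_ne hji] at hj ⊢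
      exact h.cN_le j hj

/-- A thread with an active registration deregisters. -/
theorem leaveActive (h : RegInv c R cN) {i : Thread m} (hi : c i ≠ i)
    (ht : ¬ Overlap (R (c i)).t (c i) i) (hN : cN i = (R (c i)).N) :
    RegInv (Function.update c i i)
      (Function.update R (c i) { R (c i) with a := (R (c i)).a - 1 }) cN := by
  have hti := h.t_eq_one (h.r_eq_one i hi)
  set R' := Function.update R (c i) { R (c i) with a := (R (c i)).a - 1 } with hR'
  have er : ∀ x, (R' x).r = (R x).r := by
    intro x; rcases eq_or_ne x (c i) with rfl | hx <;> simp [*]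
  have et : ∀ x, (R' x).t = (R x).t := by
    intro x; rcases eq_or_ne x (c i) with rfl | hx <;> simp [*]
  have eN : ∀ x, (R' x).N = (R x).N := by
    intro x; rcases eq_or_ne x (c i) with rfl | hx <;> simp [*]
  constructor
  · intro x; rw [er]; exact h.size_r x
  · intro x; rw [et]; exact h.size_t x
  · intro x; rw [er, et]; exact h.t_le x
  · intro x hx
    rw [er]
    rcases eq_or_ne x i with rfl | hxi
    · simp at hx
    · rw [Function.update_of_ne hxi] at hx
      exact h.r_eq_one x hx
  · intro x j hx ho
    rw [et] at ho
    rcases eq_or_ne x i with rfl | hxi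
    · rw [hti, overlap_one] at ho
      simp [← ho]
    · rw [Function.update_of_ne hxi] at hx
      have hj := h.team x j hx ho
      rw [Function.update_of_ne]
      · exact hj
      · rintro rfl
        rw [hj] at ht
        exact ht ho
  · intro x j hj hjx ha
    rw [er]
    rw [eN] at ha
    rcases eq_or_ne j i with rfl | hji
    · simp at hj
      exact absurd hj hjx
    · rw [Function.update_of_ne hji] at hj
      exact h.active x j hj hjx ha
  · intro x
    rw [et]
    rcases eq_or_ne x (c i) with rfl | hx
    · have e : helpers c R cN (c i) = insert i (helpers (Function.update c i i) R' cN (c i)) := by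
        ext j
        simp only [mem_helpers, Finset.mem_insert, et, eN]
        rcases eq_or_ne j i with rfl | hji
        · simp [ht, hN]
        · simp [hji]
      have hn : i ∉ helpers (Function.update c i i) R' cN (c i) := by
        simp [hi.symm]
      have := h.acquired (c i)
      rw [e, Finset.card_insert_of_notMem hn] at this
      have ea : (R' (c i)).a = (R (c i)).a - 1 := by simp [hR']
      omega
    · have e : helpers (Function.update c i i) R' cN x = helpers c R cN x := by
        ext j
        simp only [mem_helpers, et, eN]
        rcases eq_or_ne j i with rfl | hji
        · simp only [Function.update_self, hx.symm, false_and, iff_false]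
          rintro ⟨rfl, ho, -⟩
          exact ho rfl
        · simp [hji]
      rw [e]
      simp only [hR', Function.update_of_ne hx]
      exact h.acquired x
  · intro j hj
    rw [eN]
    rcases eq_or_ne j i with rfl | hji
    · simp at hj
    · rw [Function.update_of_ne hji] at hj ⊢
      exact h.cN_le j hj

/-- A thread registers at another coordinator that requires it. -/
theorem join (h : RegInv c R cN) {i x : Thread m} (hi : c i = i) (hr : (R i).r = 1) (hx : x ≠ i)
    (ho : Overlap (R x).r x i) :
    RegInv (Function.update c i x)
      (Function.update R x { R x with a := (R x).a + 1 })
      (Function.update cN i (R x).N) := by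
  have hcx : c x = x := h.c_eq (h.one_lt_of_overlap hx.symm ho)
  have hti := h.t_eq_one hr
  -- A thread in the team of `x` would already have `x` as its coordinator. Hence the newcomer is a
  -- helper, and adding 1 to `a` is the correct count.
  have hnt : ¬ Overlap (R x).t x i := by
    intro hot
    have := h.team x i hcx hot
    rw [hi] at this
    exact hx this.symm
  set R' := Function.update R x { R x with a := (R x).a + 1 } with hR'
  have er : ∀ y, (R' y).r = (R y).r := by
    intro y; rcases eq_or_ne y x with rfl | hy <;> simp [*]
  have et : ∀ y, (R' y).t = (R y).t := by
    intro y; rcases eq_or_ne y x with rfl | hy <;> simp [*]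
  have eN : ∀ y, (R' y).N = (R y).N := by
    intro y; rcases eq_or_ne y x with rfl | hy <;> simp [*]
  constructor
  · intro y; rw [er]; exact h.size_r y
  · intro y; rw [et]; exact h.size_t y
  · intro y; rw [er, et]; exact h.t_le y
  · intro y hy
    rw [er]
    rcases eq_or_ne y i with rfl | hyi
    · exact hr
    · rw [Function.update_of_ne hyi] at hy
      exact h.r_eq_one y hy
  · intro y j hy hoy
    rw [et] at hoy
    rcases eq_or_ne y i with rfl | hyi
    · simp [hx] at hy
    · rw [Function.update_of_ne hyi] at hy
      have hj := h.team y j hy hoy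
      rw [Function.update_of_ne]
      · exact hj
      · rintro rfl
        exact hyi (hj.symm.trans hi)
  · intro y j hj hjy ha
    rw [er]
    rw [eN] at ha
    rcases eq_or_ne j i with rfl | hji
    · simp only [Function.update_self] at hj
      rwa [← hj]
    · rw [Function.update_of_ne hji] at hj ha
      exact h.active y j hj hjy ha
  · intro y
    rw [et]
    rcases eq_or_ne y x with rfl | hy
    · have e : helpers (Function.update c i y) R' (Function.update cN i (R y).N) y
          = insert i (helpers c R cN y) := by
        ext j
        simp only [mem_helpers, Finset.mem_insert, et, eN]
        rcases eq_or_ne j i with rfl | hji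
        · simp [hnt]
        · simp [hji]
      have hn : i ∉ helpers c R cN y := by
        simp [hi, hx.symm]
      rw [e, Finset.card_insert_of_notMem hn]
      have := h.acquired y
      have ea : (R' y).a = (R y).a + 1 := by simp [hR']
      omega
    · have e : helpers (Function.update c i x) R' (Function.update cN i (R x).N) y
          = helpers c R cN y := by
        ext j
        simp only [mem_helpers, et, eN]
        rcases eq_or_ne j i with rfl | hji
        · simp only [Function.update_self, hy.symm, false_and, false_iff]
          rintro ⟨e, ho, -⟩
          rw [hi] at e
          exact ho (e ▸ rfl)
        · simp [hji]
      rw [e]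
      simp only [hR', Function.update_of_ne hy]
      exact h.acquired y
  · intro j hj
    rw [eN]
    rcases eq_or_ne j i with rfl | hji
    · simp
    · rw [Function.update_of_ne hji] at hj
      simp only [Function.update_of_ne hji]
      exact h.cN_le j hj

/-- The coordinator `x` sets its requirement. -/
theorem setReq (h : RegInv c R cN) {x : Thread m} (hx : c x = x) {r : ℕ} (hr : IsSize m r)
    (hle : (R x).t ≤ r) : RegInv c (Function.update R x ((R x).setReq r)) cN := by
  unfold Reg.setReq
  split_ifs with hlt
  · exact h.revoke hx hr (h.size_t x) hle le_rfl
  · exact h.raise hx hr (not_lt.1 hlt)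

/-- The coordinator `x` turns to its next task. -/
theorem retarget (h : RegInv c R cN) {x : Thread m} (hx : c x = x) {w : ℕ} (hw : IsSize m w) :
    RegInv c (Function.update R x ((R x).retarget w)) cN := by
  have := hw.pos
  unfold Reg.retarget
  split_ifs with h1 h2
  · exact h.setReq hx hw (by omega)
  · exact h.revoke hx hw hw le_rfl h2.le
  · exact h.revoke hx hw isSize_one hw.pos (h.size_t x).pos

end RegInv

end TeamBuilding

namespace TeamBuilding

variable {m : ℕ} {Task : Type*} {req : Task → ℕ} {s s' : State m Task} {i : Thread m}

namespace State

/-! ### Projections of the state transformations -/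

@[simp] theorem sync_Q : (s.sync i).Q = s.Q := by unfold sync; split_ifs <;> rfl
@[simp] theorem sync_c : (s.sync i).c = s.c := by unfold sync; split_ifs <;> rfl
@[simp] theorem sync_task : (s.sync i).task = s.task := by unfold sync; split_ifs <;> rfl
@[simp] theorem sync_G : (s.sync i).G = s.G := by unfold sync; split_ifs <;> rfl
@[simp] theorem sync_cN : (s.sync i).cN = s.cN := by unfold sync; split_ifs <;> rfl
@[simp] theorem sync_last : (s.sync i).last = s.last := by unfold sync; split_ifs <;> rfl
@[simp] theorem sync_pc : (s.sync i).pc = s.pc := by unfold sync; split_ifs <;> rfl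
@[simp] theorem sync_spawned : (s.sync i).spawned = s.spawned := by unfold sync; split_ifs <;> rfl

theorem sync_R_of_eq (h : s.c i = i) :
    (s.sync i).R = Function.update s.R i ((s.R i).setReq (max (s.R i).t (s.want i))) := by
  unfold sync; rw [if_pos h]; rfl

theorem sync_R_of_ne (h : s.c i ≠ i) : (s.sync i).R = s.R := by
  unfold sync; rw [if_neg h]

theorem sync_R_other {x : Thread m} (h : x ≠ i) : (s.sync i).R x = s.R x := by
  by_cases hc : s.c i = i
  · rw [sync_R_of_eq hc, Function.update_of_ne h]
  · rw [sync_R_of_ne hc]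

theorem _root_.TeamBuilding.Reg.setReq_t (R : Reg) (r : ℕ) : (R.setReq r).t = R.t := by
  unfold Reg.setReq; split_ifs <;> rfl

theorem _root_.TeamBuilding.Reg.setReq_r (R : Reg) (r : ℕ) : (R.setReq r).r = r := by
  unfold Reg.setReq; split_ifs <;> rfl

theorem _root_.TeamBuilding.Reg.retarget_r (R : Reg) (w : ℕ) : (R.retarget w).r = w := by
  unfold Reg.retarget; split_ifs <;> simp [Reg.setReq_r]

@[simp] theorem sync_t (x : Thread m) : ((s.sync i).R x).t = (s.R x).t := by
  rcases eq_or_ne x i with rfl | hx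
  · by_cases hc : s.c x = x
    · rw [sync_R_of_eq hc, Function.update_self, Reg.setReq_t]
    · rw [sync_R_of_ne hc]
  · rw [sync_R_other hx]

/-! ### The next task -/

theorem minLevel_eq_none : s.minLevel i = none ↔ ∀ j ≤ m, s.Q i j = [] := by
  simp [minLevel, List.find?_eq_none]

theorem minLevel_eq_some {j : ℕ} :
    s.minLevel i = some j ↔ j ≤ m ∧ s.Q i j ≠ [] ∧ ∀ j' < j, s.Q i j' = [] := by
  simp [minLevel, List.find?_range_eq_some]
  tauto

theorem want_eq_one_of_minLevel_eq_none (h : s.minLevel i = none)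
    (ht : IsSize m (s.R i).t) : s.want i = 1 := by
  unfold want
  rw [minLevel_eq_none.1 h _ ht.log_le, h]
  simp

/-- The preference for the queue of the current team is void for `t = 1`: this is queue 0, which
comes first anyway. -/
theorem want_eq_of_minLevel_eq_some {j : ℕ} (h : s.minLevel i = some j)
    (ht : (s.R i).t = 1) : s.want i = 2 ^ j := by
  unfold want
  rw [ht, h]
  simp only [Nat.log_one_right]
  split_ifs with h0
  · rfl
  · have hj := (minLevel_eq_some.1 h).2.2 0
    rcases Nat.eq_zero_or_pos j with rfl | hpos
    · rfl
    · simp [hj hpos] at h0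

theorem isSize_want (ht : IsSize m (s.R i).t) : IsSize m (s.want i) := by
  unfold want
  split_ifs with h0
  · cases h : s.minLevel i with
    | none => exact isSize_one
    | some j => exact isSize_two_pow (minLevel_eq_some.1 h).1
  · exact ht

/-! ### Registrations -/

/-- The registrations and program locations are consistent. -/
structure CtrlInv (s : State m Task) : Prop where
  reg : RegInv s.c s.R s.cN
  steal : ∀ i l, s.pc i = .steal l → s.c i = i ∧ (s.R i).r = 1
  switch : ∀ i x, s.pc i = .switchTo x → x ≠ i

theorem regInv_sync (h : RegInv s.c s.R s.cN) :
    RegInv (s.sync i).c (s.sync i).R (s.sync i).cN := by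
  rw [sync_c, sync_cN]
  by_cases hc : s.c i = i
  · rw [sync_R_of_eq hc]
    exact h.setReq hc ((h.size_t i).max (isSize_want (h.size_t i))) (le_max_left _ _)
  · rwa [sync_R_of_ne hc]

theorem regInv_leave (h : RegInv s.c s.R s.cN) (hc : s.c i ≠ i) (ht : ¬ s.Teamed i) :
    RegInv (s.leave i).c (s.leave i).R (s.leave i).cN := by
  unfold leave
  dsimp only
  split_ifs with ha
  · exact h.leaveActive hc ht ha
  · exact h.leaveInactive hc ht ha

theorem regInv_prepare (h : RegInv s.c s.R s.cN) (hc : s.c i = i) :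
    RegInv (s.prepare i).c (s.prepare i).R (s.prepare i).cN :=
  h.retarget hc (isSize_want (h.size_t i))

theorem regInv_launch (h : RegInv s.c s.R s.cN) (hc : s.c i = i) (ha : (s.R i).r = (s.R i).a)
    (τ : Task) (rest : List Task) :
    RegInv (s.launch i τ rest).c (s.launch i τ rest).R (s.launch i τ rest).cN :=
  regInv_sync (h.fixTeam hc ha)

/-- A registration is the composition of a revocation down to a team of one, needed only if `i` was
coordinating, with `RegInv.join`. -/
theorem regInv_register (h : RegInv s.c s.R s.cN) (hc : s.c i = i) {x : Thread m} (hx : x ≠ i)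
    (ho : Overlap (s.R x).r x i) :
    RegInv (s.register i x).c (s.register i x).R (s.register i x).cN := by
  unfold register
  dsimp only
  split_ifs with hr
  · have h' := h.revoke hc isSize_one isSize_one le_rfl (h.size_t i).pos
    have := h'.join (i := i) (x := x) hc (by simp) hx (by simpa [hx] using ho)
    simpa [hx] using this
  · have := (h.size_r i).pos
    exact h.join hc (by omega) hx ho

end State

/-! ### Steps preserve the registration invariant and leave the data of other threads alone -/

open State

/-- The clauses of `CtrlInv` on program locations serve the registering steps: they guarantee that a
thread never registers at itself. -/
theorem Step.regInv (h : Step req i s s') (hs : s.CtrlInv) : RegInv s'.c s'.R s'.cN := by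
  cases h with
  | waitStarted => exact hs.reg
  | revoked hpc hG hc ht ha => exact hs.reg.leaveInactive hc ht ha
  | start => exact hs.reg
  | await => exact hs.reg
  | dropOut j hpc hG hc ht ha => exact regInv_leave hs.reg hc ht
  | help => exact hs.reg
  | idle hpc hG hc => exact regInv_prepare hs.reg hc
  | launch τ rest hpc hG hc hQ ha => exact regInv_launch (regInv_prepare hs.reg hc) hc ha τ rest
  | coordinate hpc hG hc => exact regInv_prepare hs.reg hc
  | stealDone => exact hs.reg
  | stealRegister l hpc hl hreq =>
    obtain ⟨hc, hr⟩ := hs.steal _ _ hpc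
    refine regInv_register hs.reg hc ?_ hreq.2
    intro e
    have := hreq.1
    rw [e, hr] at this
    have := Nat.one_lt_two_pow (n := l + 1) (by omega)
    omega
  | stealTasks => exact regInv_sync (s := { s with Q := _ }) hs.reg
  | stealNext => exact hs.reg
  | pollDone => exact hs.reg
  | pollSwitch => exact hs.reg
  | pollSteal => exact regInv_sync (s := { s with Q := _ }) hs.reg
  | pollNext => exact hs.reg
  | switchVoid => exact hs.reg
  | switchTeamed => exact hs.reg
  | switchLeave x hpc ho hc ht => exact regInv_leave hs.reg hc ht
  | switchRegister x hpc ho hc => exact regInv_register hs.reg hc (hs.switch _ _ hpc) ho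
  | runOn => exact hs.reg
  | spawn => exact regInv_sync (s := { s with Q := _, spawned := _ }) hs.reg
  | finish => exact hs.reg

/-! ### Threads other than the acting one -/

theorem Step.pc_other (h : Step req i s s') {k : Thread m} (hk : k ≠ i) : s'.pc k = s.pc k := by
  cases h <;> simp [setPC, State.start, leave, prepare, State.launch, register, popappend,
    State.spawn, hk]

theorem Step.c_other (h : Step req i s s') {k : Thread m} (hk : k ≠ i) : s'.c k = s.c k := by
  cases h <;> simp [setPC, State.start, leave, prepare, State.launch, register, popappend,
    State.spawn, hk]

theorem Step.cN_other (h : Step req i s s') {k : Thread m} (hk : k ≠ i) : s'.cN k = s.cN k := by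
  cases h <;> simp [setPC, State.start, leave, prepare, State.launch, register, popappend,
    State.spawn, hk]

theorem Step.last_other (h : Step req i s s') {k : Thread m} (hk : k ≠ i) :
    s'.last k = s.last k := by
  cases h <;> simp [setPC, State.start, leave, prepare, State.launch, register, popappend,
    State.spawn, hk]

theorem Step.task_other (h : Step req i s s') {k : Thread m} (hk : k ≠ i) :
    s'.task k = s.task k := by
  cases h <;> simp [setPC, State.start, leave, prepare, State.launch, register, popappend,
    State.spawn, hk]

theorem leave_R (x : Thread m) : ((s.leave i).R x).r = (s.R x).r ∧ ((s.leave i).R x).t = (s.R x).t ∧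
    ((s.leave i).R x).N = (s.R x).N := by
  unfold leave
  dsimp only
  split_ifs
  · rcases eq_or_ne x (s.c i) with rfl | hx <;> simp [*]
  · simp

theorem register_R_other {x k : Thread m} (hk : k ≠ i) :
    ((s.register i x).R k).r = (s.R k).r ∧ ((s.register i x).R k).t = (s.R k).t ∧
    ((s.register i x).R k).N = (s.R k).N := by
  unfold register
  dsimp only
  rcases eq_or_ne k x with rfl | hx
  · simp
  · split_ifs <;> simp [*]

/-- The only field of a foreign registration structure that a step can write is `a`. -/
theorem Step.R_other (h : Step req i s s') {k : Thread m} (hk : k ≠ i) :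
    (s'.R k).r = (s.R k).r ∧ (s'.R k).t = (s.R k).t ∧ (s'.R k).N = (s.R k).N := by
  cases h with
  | dropOut => exact leave_R k
  | switchLeave => exact leave_R k
  | stealRegister => exact register_R_other hk
  | switchRegister => exact register_R_other hk
  | _ => simp [setPC, State.start, prepare, State.launch, popappend, State.spawn, hk,
      sync_R_other hk]

theorem Step.ctrlInv (h : Step req i s s') (hs : s.CtrlInv) : s'.CtrlInv := by
  refine ⟨h.regInv hs, ?_, ?_⟩
  · intro k l hk
    rcases eq_or_ne k i with rfl | hki
    · cases h with
      | idle hpc hG hc hQ =>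
        refine ⟨hc, ?_⟩
        simp only [setPC, prepare, Function.update_self, Reg.retarget_r]
        exact want_eq_one_of_minLevel_eq_none hQ (hs.reg.size_t k)
      | stealNext l' hpc => exact hs.steal _ _ hpc
      | _ => simp_all [setPC, State.start, leave, prepare, State.launch, register, popappend,
          State.spawn]
    · rw [h.c_other hki, (h.R_other hki).1]
      rw [h.pc_other hki] at hk
      exact hs.steal _ _ hk
  · intro k x hk
    rcases eq_or_ne k i with rfl | hki
    · cases h with
      | pollSwitch r l hpc hl hw =>
        simp only [setPC, Function.update_self, PC.switchTo.injEq] at hk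
        subst hk
        intro e
        obtain ⟨hne, hw⟩ := hw
        rw [e] at hne hw
        -- A thread that requires more than one thread is its own coordinator, whereas the winning
        -- coordinator differs from `s.c k`.
        have : 1 < (s.R k).r := by
          have := Nat.two_pow_pos l
          have := Nat.one_lt_two_pow (n := l + 1) (by omega)
          omega
        exact hne (hs.reg.c_eq this).symm
      | switchLeave x' hpc =>
        exact hs.switch _ _ hk
      | _ =>
        first
        | exact hs.switch _ _ hk
        | simp_all [setPC, State.start, prepare, State.launch, register, popappend,
            State.spawn]
    · rw [h.pc_other hki] at hk
      exact hs.switch _ _ hk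

theorem IsInitial.ctrlInv (h : IsInitial req s) : s.CtrlInv := by
  refine ⟨⟨?_, ?_, ?_, ?_, ?_, ?_, ?_, ?_⟩, ?_, ?_⟩
  · intro x
    rw [(h.reg x).2.2.2]
    exact isSize_want (by rw [(h.reg x).2.1]; exact isSize_one)
  · intro x
    rw [(h.reg x).2.1]; exact isSize_one
  · intro x
    rw [(h.reg x).2.1, (h.reg x).2.2.2]
    exact (isSize_want (by rw [(h.reg x).2.1]; exact isSize_one)).pos
  · intro x hx
    exact absurd (h.c x) hx
  · intro x j _ ho
    rw [(h.reg x).2.1, overlap_one] at ho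
    rw [← ho, h.c]
  · intro x j hj hjx
    rw [h.c] at hj
    exact absurd hj hjx
  · intro x
    rw [(h.reg x).1, (h.reg x).2.1, Finset.card_eq_zero.2]
    ext j
    simp only [mem_helpers, h.c, (h.reg x).2.1, overlap_one, Finset.notMem_empty, iff_false]
    tauto
  · intro j hj
    exact absurd (h.c j) hj
  · intro i l hi
    simp [h.pc] at hi
  · intro i x hi
    simp [h.pc] at hi

end TeamBuilding

namespace TeamBuilding

variable {m : ℕ} {Task : Type*} {req : Task → ℕ} {s s' : State m Task} {i : Thread m}

open State

/-! ### Queues -/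

/-- Every task is in at most one queue, which is one for its size, and the tasks executed so far
are in no queue. -/
structure State.QueueInv (req : Task → ℕ) (s : State m Task) : Prop where
  size : ∀ i j τ, τ ∈ s.Q i j → req τ = 2 ^ j
  nodup : ∀ i j, (s.Q i j).Nodup
  disjoint : ∀ i i' j τ, τ ∈ s.Q i j → τ ∈ s.Q i' j → i = i'
  spawned : ∀ i j τ, τ ∈ s.Q i j → τ ∈ s.spawned
  last : ∀ i τ, s.last i = some τ → τ ∈ s.spawned ∧ ∀ i j, τ ∉ s.Q i j

/-- In the step from `s` to `s'`, the coordinator `i` launches the task `τ`. -/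
def Launches (i : Thread m) (τ : Task) (s s' : State m Task) : Prop :=
  ∃ rest, s.pc i = .getTask ∧ s.G i = 0 ∧ s.c i = i ∧ s.minLevel i ≠ none ∧
    ((s.prepare i).R i).r = ((s.prepare i).R i).a ∧
    s.Q i (Nat.log 2 ((s.prepare i).R i).r) = τ :: rest ∧
    s' = (s.prepare i).launch i τ rest

/-- In the step from `s` to `s'`, the thread `i` moves tasks from queue `j` of its partner `x` at
level `l` to its own. -/
def Moves (i : Thread m) (s s' : State m Task) (x : Thread m) (l j : ℕ) : Prop :=
  x ≠ i ∧ 0 < s.stealCount x l j ∧ j ≤ l ∧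
    ((s.pc i = .steal l ∧ l < m) ∨ ∃ r, s.pc i = .poll r l ∧ 2 ^ l < r) ∧
    s' = (s.popappend i x j (s.stealCount x l j)).setPC i .getTask

/-- The possible effects of a step on the queues. -/
theorem Step.queue_cases (h : Step req i s s') :
    (s'.Q = s.Q ∧ s'.spawned = s.spawned) ∨ (∃ τ, Launches i τ s s') ∨
    (∃ x l j, Moves i s s' x l j) ∨
    (∃ τ, τ ∉ s.spawned ∧ s' = s.spawn req i τ) := by
  cases h with
  | launch τ rest h1 h2 h3 h4 h5 h6 =>
    exact Or.inr (Or.inl ⟨τ, rest, h1, h2, h3, h4, h5, h6, rfl⟩)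
  | stealTasks l j hpc hl h hj =>
    have hl' := (Nat.pow_lt_pow_iff_right (by norm_num)).1 hl
    exact Or.inr (Or.inr (Or.inl
      ⟨_, l, j, partner_ne hl', hj.2, hj.1, Or.inl ⟨hpc, hl'⟩, rfl⟩))
  | pollSteal r l j hpc hl h hj =>
    refine Or.inr (Or.inr (Or.inl ⟨_, l, j, ?_, hj.2, hj.1, Or.inr ⟨r, hpc, hl⟩, rfl⟩))
    -- At a location `poll r l` no bound `l < m` is at hand, so `partner_ne` does not apply; instead
    -- the two coordinators are known to differ.
    intro e
    apply h.1
    rw [e]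
  | spawn τ τ' hpc hnew => exact Or.inr (Or.inr (Or.inr ⟨τ', hnew, rfl⟩))
  | _ => exact Or.inl ⟨rfl, rfl⟩

theorem Moves.Q_source {x : Thread m} {l j : ℕ} (h : Moves i s s' x l j) :
    s'.Q x j = (s.Q x j).take ((s.Q x j).length - s.stealCount x l j) := by
  obtain ⟨hx, -, -, -, rfl⟩ := h
  simp [setPC, popappend, hx]

theorem Moves.Q_target {x : Thread m} {l j : ℕ} (h : Moves i s s' x l j) :
    s'.Q i j = (s.Q x j).drop ((s.Q x j).length - s.stealCount x l j) ++ s.Q i j := by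
  obtain ⟨hx, -, -, -, rfl⟩ := h
  simp [setPC, popappend]

theorem Moves.Q_other {x k : Thread m} {l j j' : ℕ} (h : Moves i s s' x l j)
    (hk : j' ≠ j ∨ k ≠ x ∧ k ≠ i) : s'.Q k j' = s.Q k j' := by
  obtain ⟨hx, -, -, -, rfl⟩ := h
  simp only [setPC, popappend, sync_Q]
  rcases eq_or_ne k i with rfl | hki
  · rcases hk with hj | hk
    · simp [hj]
    · exact absurd rfl hk.2
  rcases eq_or_ne k x with rfl | hkx
  · rcases hk with hj | hk
    · simp [hj, hki]
    · exact absurd rfl hk.1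
  · simp [hki, hkx]

theorem Moves.spawned {x : Thread m} {l j : ℕ} (h : Moves i s s' x l j) :
    s'.spawned = s.spawned := by
  obtain ⟨-, -, -, -, rfl⟩ := h
  simp [setPC, popappend]

theorem Moves.last {x : Thread m} {l j : ℕ} (h : Moves i s s' x l j) : s'.last = s.last := by
  obtain ⟨-, -, -, -, rfl⟩ := h
  simp [setPC, popappend]

theorem Moves.mem_of_mem {x k : Thread m} {l j j' : ℕ} {τ : Task} (h : Moves i s s' x l j)
    (hτ : τ ∈ s'.Q k j') : τ ∈ s.Q k j' ∨
      k = i ∧ j' = j ∧ τ ∈ (s.Q x j).drop ((s.Q x j).length - s.stealCount x l j) := by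
  by_cases hk : j' ≠ j ∨ k ≠ x ∧ k ≠ i
  · rw [h.Q_other hk] at hτ
    exact Or.inl hτ
  · push Not at hk
    obtain ⟨rfl, hk⟩ := hk
    rcases eq_or_ne k x with rfl | hkx
    · rw [h.Q_source] at hτ
      exact Or.inl (List.mem_of_mem_take hτ)
    · obtain rfl := hk hkx
      rw [h.Q_target, List.mem_append] at hτ
      tauto

theorem Moves.mem_of_mem_old {x k : Thread m} {l j j' : ℕ} {τ : Task} (h : Moves i s s' x l j)
    (hτ : τ ∈ s.Q k j') : ∃ k', τ ∈ s'.Q k' j' := by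
  by_cases hk : j' ≠ j ∨ k ≠ x ∧ k ≠ i
  · exact ⟨k, by rwa [h.Q_other hk]⟩
  · push Not at hk
    obtain ⟨rfl, hk⟩ := hk
    rcases eq_or_ne k x with rfl | hkx
    · rw [← List.take_append_drop ((s.Q k j').length - s.stealCount k l j') (s.Q k j'),
        List.mem_append] at hτ
      rcases hτ with hτ | hτ
      · exact ⟨k, by rwa [h.Q_source]⟩
      · exact ⟨i, by rw [h.Q_target, List.mem_append]; exact Or.inl hτ⟩
    · obtain rfl := hk hkx
      exact ⟨k, by rw [h.Q_target, List.mem_append]; exact Or.inr hτ⟩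

theorem Moves.queueInv {x : Thread m} {l j : ℕ} (h : Moves i s s' x l j) (hs : s.QueueInv req) :
    s'.QueueInv req := by
  have hsub : ∀ k j' τ, τ ∈ s'.Q k j' → ∃ k', τ ∈ s.Q k' j' := by
    intro k j' τ hτ
    rcases h.mem_of_mem hτ with hτ | ⟨-, rfl, hτ⟩
    · exact ⟨k, hτ⟩
    · exact ⟨x, List.mem_of_mem_drop hτ⟩
  -- Distinctness of the source queue is split into distinctness of the kept part, of the taken
  -- part, and their disjointness.
  have hnd := hs.nodup x j
  rw [← List.take_append_drop ((s.Q x j).length - s.stealCount x l j) (s.Q x j),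
    List.nodup_append'] at hnd
  have hne := h.1
  have hone : ∀ k τ, τ ∈ s'.Q k j → τ ∈ s.Q k j → (k = x → τ ∈ (s.Q x j).take
      ((s.Q x j).length - s.stealCount x l j)) := by
    rintro k τ hτ - rfl
    rwa [h.Q_source] at hτ
  refine ⟨?_, ?_, ?_, ?_, ?_⟩
  · intro k j' τ hτ
    obtain ⟨k', hk'⟩ := hsub k j' τ hτ
    exact hs.size _ _ _ hk'
  · intro k j'
    by_cases hk : j' ≠ j ∨ k ≠ x ∧ k ≠ i
    · rw [h.Q_other hk]
      exact hs.nodup _ _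
    · push Not at hk
      obtain ⟨rfl, hk⟩ := hk
      rcases eq_or_ne k x with rfl | hkx
      · rw [h.Q_source]
        exact hnd.1
      · obtain rfl := hk hkx
        rw [h.Q_target, List.nodup_append']
        refine ⟨hnd.2.1, hs.nodup _ _, ?_⟩
        intro τ h1 h2
        exact hkx (hs.disjoint _ _ _ _ h2 (List.mem_of_mem_drop h1))
  · intro k k' j' τ h1 h2
    rcases h.mem_of_mem h1 with h1' | ⟨e1, f1, h1'⟩ <;>
      rcases h.mem_of_mem h2 with h2' | ⟨e2, f2, h2'⟩
    · exact hs.disjoint _ _ _ _ h1' h2'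
    · subst e2 f2
      have e := hs.disjoint _ _ _ _ h1' (List.mem_of_mem_drop h2')
      exact absurd h2' (hnd.2.2 (hone _ _ h1 h1' e))
    · subst e1 f1
      have e := hs.disjoint _ _ _ _ h2' (List.mem_of_mem_drop h1')
      exact absurd h1' (hnd.2.2 (hone _ _ h2 h2' e))
    · exact e1.trans e2.symm
  · intro k j' τ hτ
    obtain ⟨k', hk'⟩ := hsub k j' τ hτ
    rw [h.spawned]
    exact hs.spawned _ _ _ hk'
  · intro k τ hk
    rw [h.last] at hk
    rw [h.spawned]
    refine ⟨(hs.last _ _ hk).1, fun k' j' hτ => ?_⟩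
    obtain ⟨k'', hk''⟩ := hsub k' j' τ hτ
    exact (hs.last _ _ hk).2 _ _ hk''

theorem spawn_Q {τ : Task} : (s.spawn req i τ).Q = Function.update s.Q i
    (Function.update (s.Q i) (Nat.log 2 (req τ)) (τ :: s.Q i (Nat.log 2 (req τ)))) := by
  simp [State.spawn]

theorem spawn_spawned {τ : Task} : (s.spawn req i τ).spawned = insert τ s.spawned := by
  simp [State.spawn]

theorem mem_spawn_Q {τ τ' : Task} {k : Thread m} {j : ℕ} :
    τ' ∈ (s.spawn req i τ).Q k j ↔ τ' ∈ s.Q k j ∨ k = i ∧ j = Nat.log 2 (req τ) ∧ τ' = τ := by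
  rw [spawn_Q]
  rcases eq_or_ne k i with rfl | hk
  · rcases eq_or_ne j (Nat.log 2 (req τ)) with rfl | hj
    · simp [or_comm]
    · simp [hj]
  · simp [hk]

theorem spawn_queueInv (hreq : ∀ τ, IsSize m (req τ)) {τ : Task} (hτ : τ ∉ s.spawned)
    (hs : s.QueueInv req) : (s.spawn req i τ).QueueInv req := by
  have hnot : ∀ k j, τ ∉ s.Q k j := fun k j h => hτ (hs.spawned _ _ _ h)
  refine ⟨?_, ?_, ?_, ?_, ?_⟩
  · intro k j τ' h
    rw [mem_spawn_Q] at h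
    rcases h with h | ⟨-, rfl, rfl⟩
    · exact hs.size _ _ _ h
    · exact (hreq _).two_pow_log.symm
  · intro k j
    rw [spawn_Q]
    rcases eq_or_ne k i with rfl | hk
    · rcases eq_or_ne j (Nat.log 2 (req τ)) with rfl | hj
      · simp [hnot, hs.nodup]
      · simp [hj, hs.nodup]
    · simp [hk, hs.nodup]
  · intro k k' j τ' h h'
    rw [mem_spawn_Q] at h h'
    rcases h with h | ⟨e1, -, e2⟩ <;> rcases h' with h' | ⟨e1', -, e2'⟩
    · exact hs.disjoint _ _ _ _ h h'
    · exact absurd (e2' ▸ h) (hnot _ _)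
    · exact absurd (e2 ▸ h') (hnot _ _)
    · exact e1.trans e1'.symm
  · intro k j τ' h
    rw [mem_spawn_Q] at h
    rw [spawn_spawned]
    rcases h with h | ⟨rfl, rfl, rfl⟩
    · exact Or.inr (hs.spawned _ _ _ h)
    · exact Or.inl rfl
  · intro k τ' hk
    have hk : s.last k = some τ' := by simpa [State.spawn] using hk
    obtain ⟨h1, h2⟩ := hs.last _ _ hk
    refine ⟨?_, ?_⟩
    · rw [spawn_spawned]
      exact Or.inr h1
    · intro k' j h
      rw [mem_spawn_Q] at h
      rcases h with h | ⟨rfl, rfl, rfl⟩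
      · exact h2 _ _ h
      · exact hτ h1

theorem Launches.Q_eq {τ : Task} (h : Launches i τ s s') : ∃ j rest, s.Q i j = τ :: rest ∧
    s'.Q = Function.update s.Q i (Function.update (s.Q i) j rest) ∧ s'.spawned = s.spawned ∧
    s'.last = Function.update s.last i (some τ) := by
  obtain ⟨rest, -, -, -, -, -, h6, rfl⟩ := h
  exact ⟨_, rest, h6, by simp [State.launch, prepare], by simp [State.launch, prepare],
    by simp [State.launch, prepare]⟩

theorem Launches.mem_of_mem {τ τ' : Task} (h : Launches i τ s s') {k : Thread m} {j : ℕ}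
    (hτ : τ' ∈ s'.Q k j) : τ' ∈ s.Q k j := by
  obtain ⟨j', rest, hQ, hQ', -⟩ := h.Q_eq
  rw [hQ'] at hτ
  rcases eq_or_ne k i with rfl | hk
  · rcases eq_or_ne j j' with rfl | hj
    · rw [hQ]
      simp at hτ
      exact List.mem_cons_of_mem _ hτ
    · simpa [hj] using hτ
  · simpa [hk] using hτ

/-- The size of `τ` determines the level and `disjoint` the thread, so only the queue just popped
could still contain `τ`; there `nodup` forbids it. -/
theorem Launches.not_mem {τ : Task} (h : Launches i τ s s') (hs : s.QueueInv req) (k : Thread m)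
    (j : ℕ) : τ ∉ s'.Q k j := by
  intro hτ
  have hmem := h.mem_of_mem hτ
  obtain ⟨j', rest, hQ, hQ', -⟩ := h.Q_eq
  have hmem' : τ ∈ s.Q i j' := by simp [hQ]
  have hj : j = j' := by
    have := (hs.size _ _ _ hmem).symm.trans (hs.size _ _ _ hmem')
    exact Nat.pow_right_injective le_rfl this
  subst hj
  obtain rfl := hs.disjoint _ _ _ _ hmem hmem'
  have := hs.nodup k j
  rw [hQ, List.nodup_cons] at this
  simp [hQ'] at hτ
  exact this.1 hτ

theorem Launches.queueInv {τ : Task} (h : Launches i τ s s') (hs : s.QueueInv req) :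
    s'.QueueInv req := by
  have hnot := h.not_mem hs
  have hsub : ∀ {k j τ'}, τ' ∈ s'.Q k j → τ' ∈ s.Q k j := fun hτ => h.mem_of_mem hτ
  obtain ⟨j', rest, hQ, hQ', hsp, hl⟩ := h.Q_eq
  refine ⟨?_, ?_, ?_, ?_, ?_⟩
  · exact fun k j τ' hτ => hs.size _ _ _ (hsub hτ)
  · intro k j
    rw [hQ']
    rcases eq_or_ne k i with rfl | hk
    · rcases eq_or_ne j j' with rfl | hj
      · have := hs.nodup k j
        rw [hQ, List.nodup_cons] at this
        simpa using this.2
      · simp [hj, hs.nodup]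
    · simp [hk, hs.nodup]
  · exact fun k k' j τ' h1 h2 => hs.disjoint _ _ _ _ (hsub h1) (hsub h2)
  · intro k j τ' hτ
    rw [hsp]
    exact hs.spawned _ _ _ (hsub hτ)
  · intro k τ' hk
    rw [hsp]
    rcases eq_or_ne k i with rfl | hki
    · simp only [hl, Function.update_self, Option.some.injEq] at hk
      subst hk
      exact ⟨hs.spawned k j' _ (by simp [hQ]), hnot⟩
    · rw [hl, Function.update_of_ne hki] at hk
      exact ⟨(hs.last _ _ hk).1, fun k' j hτ => (hs.last _ _ hk).2 _ _ (hsub hτ)⟩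

/-! ### Offered tasks -/

open Classical in
/-- The threads in the block of size `r` around `i` that have not yet started `τ`. -/
noncomputable def unstarted (last : Thread m → Option Task) (r : ℕ) (i : Thread m) (τ : Task) :
    Finset (Thread m) :=
  (block r i).filter fun j => last j ≠ some τ

@[simp] theorem mem_unstarted {last : Thread m → Option Task} {r : ℕ} {i j : Thread m} {τ : Task} :
    j ∈ unstarted last r i τ ↔ Overlap r i j ∧ last j ≠ some τ := by
  simp [unstarted]

/-- A task is offered by a coordinator to its team, and the coordinator counts the threads that
have not yet started it. -/
structure State.OfferInv (req : Task → ℕ) (s : State m Task) : Prop where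
  loc : ∀ i τ, s.task i = some τ → s.pc i = .getTask ∨ ∃ τ', s.pc i = .running τ'
  own : ∀ i τ, s.task i = some τ → s.c i = i
  size : ∀ i τ, s.task i = some τ → (s.R i).t = req τ
  last : ∀ i τ, s.task i = some τ → s.last i = some τ
  count : ∀ i τ, s.task i = some τ → s.G i = (unstarted s.last (req τ) i τ).card
  none : ∀ i, s.task i = none → s.G i = 0
  running : ∀ i τ, s.pc i = .running τ → s.last i = some τ

/-- The combined invariant. -/
structure State.Inv (req : Task → ℕ) (s : State m Task) : Prop where
  ctrl : s.CtrlInv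
  queue : s.QueueInv req
  offer : s.OfferInv req

theorem Step.queueInv (hreq : ∀ τ, IsSize m (req τ)) (h : Step req i s s') (hs : s.Inv req) :
    s'.QueueInv req := by
  -- A new value of `last` is here an offered task, which is already the `last` task of its
  -- coordinator and therefore in no queue.
  have same : s'.Q = s.Q → s'.spawned = s.spawned →
      (∀ k τ, s'.last k = some τ → s.last k = some τ ∨ ∃ x, s.task x = some τ) →
      s'.QueueInv req := by
    intro e1 e2 e3
    refine ⟨?_, ?_, ?_, ?_, ?_⟩ <;> simp only [e1, e2]
    · exact hs.queue.size
    · exact hs.queue.nodup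
    · exact hs.queue.disjoint
    · exact hs.queue.spawned
    · intro k τ hk
      rcases e3 k τ hk with h | ⟨x, hx⟩
      · exact hs.queue.last _ _ h
      · exact hs.queue.last x τ (hs.offer.last _ _ hx)
  rcases h.queue_cases with ⟨h1, h2⟩ | ⟨τ, hτ⟩ | ⟨x, l, j, hm⟩ | ⟨τ, hτ, rfl⟩
  · refine same h1 h2 ?_
    intro k τ hk
    rcases eq_or_ne k i with rfl | hki
    · cases h with
      | start τ' hpc hG hc ht hτ hl =>
        simp only [State.start, Function.update_self, Option.some.injEq] at hk
        subst hk
        exact Or.inr ⟨_, hτ⟩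
      -- Impossible with unchanged queues: a list would equal its own tail.
      | launch τ rest h1' h2' h3 h4 h5 h6 =>
        have := congrFun (congrFun h1 k) (Nat.log 2 ((s.prepare k).R k).r)
        simp [State.launch, prepare] at this h6
        rw [h6] at this
        simp at this
      | _ =>
        left
        simpa [setPC, leave, prepare, register, popappend, State.spawn] using hk
    · rw [h.last_other hki] at hk
      exact Or.inl hk
  · exact hτ.queueInv hs.queue
  · exact hm.queueInv hs.queue
  · exact spawn_queueInv hreq hτ hs.queue

end TeamBuilding

/-! ### Preservation of the invariant on offered tasks -/

namespace TeamBuilding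

variable {m : ℕ} {Task : Type*} {req : Task → ℕ} {s s' : State m Task} {i : Thread m}

open State

/-- A thread in the block of an offered task has the offering thread as its coordinator. -/
theorem State.Inv.c_eq_of_overlap (hs : s.Inv req) {x j : Thread m} {τ : Task}
    (hx : s.task x = some τ) (ho : Overlap (req τ) x j) : s.c j = x := by
  rw [← hs.offer.size _ _ hx] at ho
  exact hs.ctrl.reg.team _ _ (hs.offer.own _ _ hx) ho

theorem Launches.req_eq {τ : Task} (h : Launches i τ s s') (hs : s.Inv req) :
    req τ = ((s.prepare i).R i).r := by
  obtain ⟨rest, h1, h2, h3, h4, h5, h6, rfl⟩ := h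
  rw [hs.queue.size i _ τ (by rw [h6]; exact List.mem_cons_self)]
  exact ((regInv_prepare hs.ctrl.reg h3).size_r i).two_pow_log

theorem Launches.not_last {τ : Task} (h : Launches i τ s s') (hs : s.Inv req) (j : Thread m) :
    s.last j ≠ some τ := by
  intro hl
  obtain ⟨j', rest, hQ, -⟩ := h.Q_eq
  exact (hs.queue.last _ _ hl).2 i j' (by simp [hQ])

theorem Launches.offerInv {τ : Task} (h : Launches i τ s s') (hs : s.Inv req) :
    s'.OfferInv req := by
  have hreq := h.req_eq hs
  have hnl := h.not_last hs
  obtain ⟨rest, h1, h2, h3, h4, h5, h6, rfl⟩ := h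
  have hsize : IsSize m (req τ) := hreq ▸ (regInv_prepare hs.ctrl.reg h3).size_r i
  have hR : ∀ k, k ≠ i → (((s.prepare i).launch i τ rest).R k).t = (s.R k).t := by
    intro k hk
    simp [State.launch, prepare, hk]
  have hRi : (((s.prepare i).launch i τ rest).R i).t = req τ := by
    simp only [State.launch, sync_t, Function.update_self, hreq]
  have hG : ((s.prepare i).launch i τ rest).G = Function.update s.G i (req τ - 1) := by
    simp [State.launch, prepare, hreq]
  have htask : ((s.prepare i).launch i τ rest).task = Function.update s.task i (some τ) := by
    simp [State.launch, prepare]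
  have hlast : ((s.prepare i).launch i τ rest).last = Function.update s.last i (some τ) := by
    simp [State.launch, prepare]
  have hpc : ((s.prepare i).launch i τ rest).pc = Function.update s.pc i (.running τ) := by
    simp [State.launch, prepare]
  have hc : ((s.prepare i).launch i τ rest).c = s.c := by
    simp [State.launch, prepare]
  generalize (s.prepare i).launch i τ rest = s' at *
  refine ⟨?_, ?_, ?_, ?_, ?_, ?_, ?_⟩
  · intro k τ' hk
    rw [hpc]
    rcases eq_or_ne k i with rfl | hki
    · exact Or.inr ⟨τ, by simp⟩
    · rw [htask, Function.update_of_ne hki] at hk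
      rw [Function.update_of_ne hki]
      exact hs.offer.loc _ _ hk
  · intro k τ' hk
    rw [hc]
    rcases eq_or_ne k i with rfl | hki
    · exact h3
    · rw [htask, Function.update_of_ne hki] at hk
      exact hs.offer.own _ _ hk
  · intro k τ' hk
    rcases eq_or_ne k i with rfl | hki
    · simp only [htask, Function.update_self, Option.some.injEq] at hk
      rw [← hk, hRi]
    · rw [htask, Function.update_of_ne hki] at hk
      rw [hR k hki]
      exact hs.offer.size _ _ hk
  · intro k τ' hk
    rw [hlast]
    rcases eq_or_ne k i with rfl | hki
    · simpa [htask] using hk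
    · rw [htask, Function.update_of_ne hki] at hk
      rw [Function.update_of_ne hki]
      exact hs.offer.last _ _ hk
  · intro k τ' hk
    rw [hlast, hG]
    rcases eq_or_ne k i with rfl | hki
    · simp only [htask, Function.update_self, Option.some.injEq] at hk
      subst hk
      -- Nobody has executed `τ` before, so everyone in the block but the coordinator is still to
      -- start: this is the value `r - 1` of the counter.
      have e : unstarted (Function.update s.last k (some τ)) (req τ) k τ
          = (block (req τ) k).erase k := by
        ext j
        rcases eq_or_ne j k with rfl | hj
        · simp
        · simp [hj, hnl]
      rw [e, Finset.card_erase_of_mem (by simp [Overlap.refl]), card_block hsize]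
      simp
    · rw [htask, Function.update_of_ne hki] at hk
      rw [Function.update_of_ne hki, hs.offer.count _ _ hk]
      congr 1
      ext j
      rcases eq_or_ne j i with rfl | hj
      -- The launching thread is its own coordinator, hence outside the blocks of all other offers,
      -- whose counts ignore its new `last` task.
      · have : ¬ Overlap (req τ') k j := by
          intro ho
          have := hs.c_eq_of_overlap hk ho
          rw [h3] at this
          exact hki this.symm
        simp [this]
      · simp [hj]
  · intro k hk
    rw [hG]
    rcases eq_or_ne k i with rfl | hki
    · simp [htask] at hk
    · rw [htask, Function.update_of_ne hki] at hk
      rw [Function.update_of_ne hki]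
      exact hs.offer.none _ hk
  · intro k τ' hk
    rw [hlast]
    rcases eq_or_ne k i with rfl | hki
    · simpa [hpc] using hk
    · rw [hpc, Function.update_of_ne hki] at hk
      rw [Function.update_of_ne hki]
      exact hs.offer.running _ _ hk

theorem start_offerInv {τ : Task} (hs : s.Inv req)
    (hc : s.c i ≠ i) (ht : s.Teamed i) (hτ : s.task (s.c i) = some τ) (hl : s.last i ≠ some τ) :
    (s.start i τ).OfferInv req := by
  have hnone : s.task i = none := by
    cases h : s.task i with
    | none => rfl
    | some τ' => exact absurd (hs.offer.own _ _ h) hc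
  refine ⟨?_, hs.offer.own, hs.offer.size, ?_, ?_, ?_, ?_⟩
  · intro k τ' hk
    simp only [State.start] at hk ⊢
    rcases eq_or_ne k i with rfl | hki
    · simp
    · rw [Function.update_of_ne hki]
      exact hs.offer.loc _ _ hk
  · intro k τ' hk
    simp only [State.start] at hk ⊢
    rcases eq_or_ne k i with rfl | hki
    · simp [hnone] at hk
    · rw [Function.update_of_ne hki]
      exact hs.offer.last _ _ hk
  · intro k τ' hk
    simp only [State.start] at hk ⊢
    rcases eq_or_ne k (s.c i) with rfl | hki
    · rw [hτ, Option.some.injEq] at hk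
      subst hk
      rw [Function.update_self, hs.offer.count _ _ hτ]
      -- The starting thread is counted by its coordinator, and by no other one since it can lie in
      -- the block of only one offer.
      have hmem : i ∈ unstarted s.last (req τ) (s.c i) τ := by
        rw [mem_unstarted]
        refine ⟨?_, hl⟩
        rw [← hs.offer.size _ _ hτ]
        exact ht
      rw [← Finset.card_erase_of_mem hmem]
      congr 1
      ext j
      rcases eq_or_ne j i with rfl | hj
      · simp
      · simp [hj]
    · rw [Function.update_of_ne hki, hs.offer.count _ _ hk]
      congr 1
      ext j
      rcases eq_or_ne j i with rfl | hj
      · have : ¬ Overlap (req τ') k j := fun ho => hki (hs.c_eq_of_overlap hk ho).symm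
        simp [this]
      · simp [hj]
  · intro k hk
    simp only [State.start] at hk ⊢
    rcases eq_or_ne k (s.c i) with rfl | hki
    · simp [hτ] at hk
    · rw [Function.update_of_ne hki]
      exact hs.offer.none _ hk
  · intro k τ' hk
    simp only [State.start] at hk ⊢
    rcases eq_or_ne k i with rfl | hki
    · simpa using hk
    · rw [Function.update_of_ne hki] at hk ⊢
      exact hs.offer.running _ _ hk

theorem State.Inv.task_eq_none (hs : s.Inv req) {k : Thread m} (hc : s.c k ≠ k) :
    s.task k = none := by
  cases h : s.task k with
  | none => rfl
  | some τ => exact absurd (hs.offer.own _ _ h) hc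

theorem State.Inv.G_eq_zero (hs : s.Inv req) {k : Thread m} (hc : s.c k ≠ k) : s.G k = 0 :=
  hs.offer.none k (hs.task_eq_none hc)

theorem State.Inv.task_eq_none_of_pc (hs : s.Inv req) {k : Thread m} (hg : s.pc k ≠ .getTask)
    (hr : ∀ τ, s.pc k ≠ .running τ) : s.task k = none := by
  cases h : s.task k with
  | none => rfl
  | some τ =>
    rcases hs.offer.loc _ _ h with h | ⟨τ', h⟩
    · exact absurd h hg
    · exact absurd h (hr _)

/-- A step by which nothing is launched or started. -/
theorem offerInv_of_quiet (hs : s.Inv req) (h : Step req i s s') (hG : s'.G = s.G)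
    (hlast : s'.last = s.last) (hrun : ∀ τ, s'.pc i = .running τ → s.pc i = .running τ)
    (htask : s'.task i = none ∧ s.G i = 0 ∨ s'.task i = s.task i ∧ s'.c i = s.c i ∧
      (s'.R i).t = (s.R i).t ∧ (s'.pc i = .getTask ∨ ∃ τ, s'.pc i = .running τ)) :
    s'.OfferInv req := by
  refine ⟨?_, ?_, ?_, ?_, ?_, ?_, ?_⟩
  · intro k τ' hk
    rcases eq_or_ne k i with rfl | hki
    · rcases htask with ⟨h1, -⟩ | ⟨-, -, -, h1⟩
      · simp [h1] at hk
      · exact h1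
    · rw [h.task_other hki] at hk
      rw [h.pc_other hki]
      exact hs.offer.loc _ _ hk
  · intro k τ' hk
    rcases eq_or_ne k i with rfl | hki
    · rcases htask with ⟨h1, -⟩ | ⟨h1, h2, -⟩
      · simp [h1] at hk
      · rw [h2]; exact hs.offer.own _ _ (h1 ▸ hk)
    · rw [h.task_other hki] at hk
      rw [h.c_other hki]
      exact hs.offer.own _ _ hk
  · intro k τ' hk
    rcases eq_or_ne k i with rfl | hki
    · rcases htask with ⟨h1, -⟩ | ⟨h1, -, h2, -⟩
      · simp [h1] at hk
      · rw [h2]; exact hs.offer.size _ _ (h1 ▸ hk)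
    · rw [h.task_other hki] at hk
      rw [(h.R_other hki).2.1]
      exact hs.offer.size _ _ hk
  · intro k τ' hk
    rw [hlast]
    rcases eq_or_ne k i with rfl | hki
    · rcases htask with ⟨h1, -⟩ | ⟨h1, -⟩
      · simp [h1] at hk
      · exact hs.offer.last _ _ (h1 ▸ hk)
    · rw [h.task_other hki] at hk
      exact hs.offer.last _ _ hk
  · intro k τ' hk
    rw [hlast, hG]
    rcases eq_or_ne k i with rfl | hki
    · rcases htask with ⟨h1, -⟩ | ⟨h1, -⟩
      · simp [h1] at hk
      · exact hs.offer.count _ _ (h1 ▸ hk)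
    · rw [h.task_other hki] at hk
      exact hs.offer.count _ _ hk
  · intro k hk
    rw [hG]
    rcases eq_or_ne k i with rfl | hki
    · rcases htask with ⟨-, h1⟩ | ⟨h1, -⟩
      · exact h1
      · exact hs.offer.none _ (h1 ▸ hk)
    · rw [h.task_other hki] at hk
      exact hs.offer.none _ hk
  · intro k τ' hk
    rw [hlast]
    rcases eq_or_ne k i with rfl | hki
    · exact hs.offer.running _ _ (hrun _ hk)
    · rw [h.pc_other hki] at hk
      exact hs.offer.running _ _ hk

theorem Step.offerInv (h : Step req i s s') (hs : s.Inv req) : s'.OfferInv req := by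
  have hstep := h
  -- A thread that steals, polls or switches offers nothing, so these steps cannot disturb a count.
  have hn : s.pc i ≠ .getTask → (∀ τ, s.pc i ≠ .running τ) → s.task i = none ∧ s.G i = 0 :=
    fun h1 h2 => ⟨hs.task_eq_none_of_pc h1 h2, hs.offer.none _ (hs.task_eq_none_of_pc h1 h2)⟩
  cases h with
  | waitStarted => exact hs.offer
  | await => exact hs.offer
  | runOn => exact hs.offer
  | start τ hpc hG hc ht hτ hl => exact start_offerInv hs hc ht hτ hl
  | launch τ rest h1 h2 h3 h4 h5 h6 => exact Launches.offerInv ⟨rest, h1, h2, h3, h4, h5, h6, rfl⟩ hs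
  | revoked hpc hG hc ht ha =>
    exact offerInv_of_quiet hs hstep rfl rfl (fun _ h => h) (Or.inl ⟨hs.task_eq_none hc, hG⟩)
  | dropOut j hpc hG hc ht ha =>
    exact offerInv_of_quiet hs hstep rfl rfl (fun _ h => h) (Or.inl ⟨hs.task_eq_none hc, hG⟩)
  | help hpc hG hc =>
    exact offerInv_of_quiet hs hstep rfl rfl (by simp [setPC]) (Or.inl ⟨hs.task_eq_none hc, hG⟩)
  | idle hpc hG hc =>
    exact offerInv_of_quiet hs hstep rfl rfl (by simp [setPC])
      (Or.inl ⟨by simp [setPC, prepare], hG⟩)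
  | coordinate hpc hG hc =>
    exact offerInv_of_quiet hs hstep rfl rfl (by simp [setPC])
      (Or.inl ⟨by simp [setPC, prepare], hG⟩)
  | spawn τ τ' hpc hnew =>
    refine offerInv_of_quiet hs hstep (by simp [State.spawn]) (by simp [State.spawn])
      (by simp [State.spawn]) (Or.inr ?_)
    simp [State.spawn, hpc]
  | finish τ hpc =>
    refine offerInv_of_quiet hs hstep rfl rfl (by simp [setPC]) (Or.inr ?_)
    simp [setPC]
  | _ =>
    refine offerInv_of_quiet hs hstep (by simp [setPC, popappend, register, leave])
      (by simp [setPC, popappend, register, leave])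
      (by simp [setPC, popappend, register, leave]) (Or.inl ?_)
    have := hn (by simp [*]) (by simp [*])
    simpa [setPC, popappend, register, leave] using this

theorem Step.inv (hreq : ∀ τ, IsSize m (req τ)) (h : Step req i s s') (hs : s.Inv req) :
    s'.Inv req :=
  ⟨h.ctrlInv hs.ctrl, h.queueInv hreq hs, h.offerInv hs⟩

theorem IsInitial.inv (h : IsInitial req s) : s.Inv req := by
  refine ⟨h.ctrlInv, ⟨h.size, h.nodup, h.disjoint, ?_, ?_⟩, ?_⟩
  · intro i j τ hτ
    rw [h.spawned]
    exact ⟨i, j, hτ⟩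
  · intro i τ hi
    simp [h.last] at hi
  · constructor <;> simp [h.task, h.G, h.pc]

theorem Execution.inv (e : Execution m req) (hreq : ∀ τ, IsSize m (req τ)) (n : ℕ) :
    (e.state n).Inv req := by
  induction n with
  | zero => exact e.init.inv
  | succ n ih => exact (e.step n).inv hreq ih

end TeamBuilding

namespace TeamBuilding

variable {m : ℕ} {Task : Type*} {req : Task → ℕ} {s s' : State m Task} {i : Thread m}

open State

/-! ### How tasks come to be executed -/

theorem Step.pc_running_cases (h : Step req i s s') {τ : Task} (hk : s'.pc i = .running τ) :
    (s.pc i = .running τ ∧ s'.c i = s.c i) ∨ Launches i τ s s' ∨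
      (s.task (s.c i) = some τ ∧ s.Teamed i ∧ s.last i ≠ some τ ∧ s' = s.start i τ) := by
  cases h with
  | launch τ' rest h1 h2 h3 h4 h5 h6 =>
    simp only [State.launch, sync_pc, Function.update_self, PC.running.injEq] at hk
    subst hk
    exact Or.inr (Or.inl ⟨rest, h1, h2, h3, h4, h5, h6, rfl⟩)
  | start τ' hpc hG hc ht hτ hl =>
    simp only [State.start, Function.update_self, PC.running.injEq] at hk
    subst hk
    exact Or.inr (Or.inr ⟨hτ, ht, hl, rfl⟩)
  | runOn => exact Or.inl ⟨hk, rfl⟩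
  | spawn => exact Or.inl (by simpa [State.spawn] using hk)
  | _ => simp_all [setPC, leave, prepare, register, popappend]

theorem Step.task_cases (h : Step req i s s') {τ : Task} (hk : s'.task i = some τ) :
    s.task i = some τ ∨ Launches i τ s s' := by
  cases h with
  | launch τ' rest h1 h2 h3 h4 h5 h6 =>
    simp only [State.launch, sync_task, Function.update_self, Option.some.injEq] at hk
    subst hk
    exact Or.inr ⟨rest, h1, h2, h3, h4, h5, h6, rfl⟩
  | idle => simp [setPC, prepare] at hk
  | coordinate => simp [setPC, prepare] at hk
  | _ =>
    left
    simpa [setPC, State.start, leave, register, popappend, State.spawn] using hk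

/-- Only a coordinator at `getTask` alters its offer, and it first waits for its counter to reach
zero. -/
theorem Step.task_eq_or_G_eq_zero (h : Step req i s s') {x : Thread m} :
    s'.task x = s.task x ∨ s.G x = 0 := by
  rcases eq_or_ne x i with rfl | hx
  · cases h with
    | idle hpc hG => exact Or.inr hG
    | launch τ rest hpc hG => exact Or.inr hG
    | coordinate hpc hG => exact Or.inr hG
    | _ => exact Or.inl (by simp [setPC, State.start, leave, register, popappend, State.spawn])
  · exact Or.inl (h.task_other hx)

theorem Step.last_cases (h : Step req i s s') {k : Thread m} {τ : Task}
    (hk : s'.last k = some τ) : s.last k = some τ ∨ s'.pc k = .running τ := by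
  rcases eq_or_ne k i with rfl | hki
  · cases h with
    | launch => right; simpa [State.launch] using hk
    | start => right; simpa [State.start] using hk
    | _ => left; simpa [setPC, leave, prepare, register, popappend, State.spawn] using hk
  · rw [h.last_other hki] at hk
    exact Or.inl hk

theorem Launches.c_eq {τ : Task} (h : Launches i τ s s') : s'.c i = i := by
  obtain ⟨rest, h1, h2, h3, h4, h5, h6, rfl⟩ := h
  simpa [State.launch, prepare] using h3

theorem Launches.task_eq {τ : Task} (h : Launches i τ s s') : s'.task i = some τ := by
  obtain ⟨rest, h1, h2, h3, h4, h5, h6, rfl⟩ := h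
  simp [State.launch]

/-- The task `τ` has been taken from its queue. -/
def State.Removed (s : State m Task) (τ : Task) : Prop :=
  τ ∈ s.spawned ∧ ∀ k j, τ ∉ s.Q k j

/-- Thefts only move tasks between queues, and a spawned task is new; so nothing returns to the
queues. -/
theorem Step.removed (h : Step req i s s') {τ : Task} (hs : s.Removed τ) : s'.Removed τ := by
  rcases h.queue_cases with ⟨h1, h2⟩ | ⟨τ', hτ⟩ | ⟨x, l, j, hm⟩ | ⟨τ', hτ, rfl⟩
  · unfold Removed
    rwa [h1, h2]
  · refine ⟨?_, fun k j hk => hs.2 k j (hτ.mem_of_mem hk)⟩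
    obtain ⟨j, rest, -, -, h3, -⟩ := hτ.Q_eq
    rw [h3]
    exact hs.1
  · refine ⟨by rw [hm.spawned]; exact hs.1, fun k j' hk => ?_⟩
    rcases hm.mem_of_mem hk with hk | ⟨-, -, hk⟩
    · exact hs.2 _ _ hk
    · exact hs.2 _ _ (List.mem_of_mem_drop hk)
  · refine ⟨by rw [spawn_spawned]; exact Or.inr hs.1, fun k j hk => ?_⟩
    rw [mem_spawn_Q] at hk
    rcases hk with hk | ⟨-, -, rfl⟩
    · exact hs.2 _ _ hk
    · exact hτ hs.1

/-- A task leaves the queues only by being launched. -/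
theorem Step.mem_or_launches (h : Step req i s s') {τ : Task} {k : Thread m} {j : ℕ}
    (hτ : τ ∈ s.Q k j) : (∃ k', τ ∈ s'.Q k' j) ∨ Launches i τ s s' := by
  rcases h.queue_cases with ⟨h1, h2⟩ | ⟨τ', h'⟩ | ⟨x, l, j, hm⟩ | ⟨τ', h', rfl⟩
  · exact Or.inl ⟨k, by rwa [h1]⟩
  · obtain ⟨j', rest, hQ, hQ', -⟩ := h'.Q_eq
    by_cases hkj : k = i ∧ j = j'
    · obtain ⟨rfl, rfl⟩ := hkj
      rw [hQ, List.mem_cons] at hτ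
      rcases hτ with rfl | hτ
      · exact Or.inr h'
      · exact Or.inl ⟨k, by simpa [hQ'] using hτ⟩
    · refine Or.inl ⟨k, ?_⟩
      rw [hQ']
      rcases eq_or_ne k i with rfl | hk
      · have hj : j ≠ j' := fun e => hkj ⟨rfl, e⟩
        simpa [hj] using hτ
      · simpa [hk] using hτ
  · exact Or.inl (hm.mem_of_mem_old hτ)
  · exact Or.inl ⟨k, mem_spawn_Q.2 (Or.inl hτ)⟩

theorem Launches.not_removed {τ : Task} (h : Launches i τ s s') : ¬ s.Removed τ := by
  obtain ⟨j', rest, hQ, -⟩ := h.Q_eq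
  exact fun hr => hr.2 i j' (by simp [hQ])

theorem Launches.removed {τ : Task} (h : Launches i τ s s') (hs : s.QueueInv req) :
    s'.Removed τ := by
  refine ⟨?_, h.not_mem hs⟩
  obtain ⟨j', rest, hQ, -, h3, -⟩ := h.Q_eq
  rw [h3]
  exact hs.spawned i j' _ (by simp [hQ])

/-- Only the threads in the block of size `req τ` around `x` work on `τ`. -/
def State.Exclusive (req : Task → ℕ) (s : State m Task) (x : Thread m) (τ : Task) : Prop :=
  (∀ y, s.task y = some τ → y = x) ∧ ∀ j, s.pc j = .running τ → Overlap (req τ) x j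

/-- A removed task cannot be launched again, so `x` remains its only possible source, and only
members of the team of `x` can start it. -/
theorem Step.exclusive (h : Step req i s s') (hs : s.Inv req) {x : Thread m} {τ : Task}
    (hr : s.Removed τ) (he : s.Exclusive req x τ) : s'.Exclusive req x τ := by
  constructor
  · intro y hy
    rcases eq_or_ne y i with rfl | hyi
    · rcases h.task_cases hy with hy | hy
      · exact he.1 _ hy
      · exact absurd hr hy.not_removed
    · rw [h.task_other hyi] at hy
      exact he.1 _ hy
  · intro j hj
    rcases eq_or_ne j i with rfl | hji
    · rcases h.pc_running_cases hj with ⟨hj, -⟩ | hj | ⟨hτ, ht, -⟩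
      · exact he.2 _ hj
      · exact absurd hr hj.not_removed
      · rw [← he.1 _ hτ, ← hs.offer.size _ _ hτ]
        exact ht
    · rw [h.pc_other hji] at hj
      exact he.2 _ hj

theorem Launches.exclusive {τ : Task} (h : Launches i τ s s') (hs : s.Inv req)
    (hstep : Step req i s s') : s'.Exclusive req i τ := by
  have hr := h.not_removed
  constructor
  · intro y hy
    by_contra hyi
    rw [hstep.task_other hyi] at hy
    exact hr (hs.queue.last _ _ (hs.offer.last _ _ hy))
  · intro j hj
    rcases eq_or_ne j i with rfl | hji
    · exact Overlap.refl _ _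
    · rw [hstep.pc_other hji] at hj
      exact absurd (hs.queue.last _ _ (hs.offer.running _ _ hj)) hr

/-! ### Progress of a single thread -/

open Classical in
/-- A bound for the number of steps of thread `i` until it is back in `getTask`. -/
noncomputable def State.rank (s : State m Task) (i : Thread m) : ℕ :=
  match s.pc i with
  | .getTask => 0
  | .running _ => 0
  | .switchTo _ => if s.c i = i then 1 else 2
  | .poll r l => 3 + (r - l)
  | .steal l => 3 + (m - l)

/-- A switch consists of at most two steps, deregistering and registering, so the offset 3 puts
polling above it. The term `r - l` falls because `2 ^ l < r` forces `l < r`. -/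
theorem Step.rank_lt (h : Step req i s s') (hg : s.pc i ≠ .getTask)
    (hr : ∀ τ, s.pc i ≠ .running τ) : s'.rank i < s.rank i := by
  cases h with
  | stealNext l hpc hl =>
    have := (Nat.pow_lt_pow_iff_right (a := 2) (by norm_num)).1 hl
    simp only [rank, setPC, hpc, Function.update_self]
    omega
  | pollNext r l hpc hl =>
    have := Nat.lt_two_pow_self (n := l)
    simp only [rank, setPC, hpc, Function.update_self]
    omega
  | pollSwitch r l hpc hl =>
    by_cases hc : s.c i = i <;> simp [rank, setPC, hpc, hc] <;> omega
  | switchLeave x hpc ho hc =>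
    simp [rank, leave, hpc, hc]
  | switchVoid x hpc =>
    simp only [rank, setPC, hpc, Function.update_self]
    split_ifs <;> omega
  | switchTeamed x hpc =>
    simp only [rank, setPC, hpc, Function.update_self]
    split_ifs <;> omega
  | switchRegister x hpc ho hc =>
    simp [rank, register, hpc, hc]
  | _ =>
    first
    | exact absurd ‹_› hg
    | exact absurd ‹_› (hr _)
    | simp [rank, setPC, popappend, register, *]

namespace Execution

variable (e : Execution m req)

/-- The next step of thread `j`. -/
theorem exists_next (n : ℕ) (j : Thread m) :
    ∃ n' ≥ n, e.sched n' = j ∧ ∀ k, n ≤ k → k < n' → e.sched k ≠ j := by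
  classical
  have h := e.fair j n
  refine ⟨Nat.find h, (Nat.find_spec h).1, (Nat.find_spec h).2, fun k hk hlt hs => ?_⟩
  exact Nat.find_min h hlt ⟨hk, hs⟩

/-- What only thread `j` can change stays the same until its next step. -/
theorem eq_until_next {α : Sort*} (f : State m Task → α) {j : Thread m}
    (hf : ∀ i s s', Step req i s s' → j ≠ i → f s' = f s) {n n' : ℕ}
    (h : ∀ k, n ≤ k → k < n' → e.sched k ≠ j) {k : ℕ} (hk : n ≤ k) (hk' : k ≤ n') :
    f (e.state k) = f (e.state n) := by
  induction k, hk using Nat.le_induction with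
  | base => rfl
  | succ k hk ih =>
    rw [← ih (by omega)]
    exact hf _ _ _ (e.step k) (h k hk (by omega)).symm

theorem exists_next_pc (n : ℕ) (j : Thread m) :
    ∃ n' ≥ n, e.sched n' = j ∧ (e.state n').pc j = (e.state n).pc j ∧
      (e.state n').c j = (e.state n).c j := by
  obtain ⟨n', hn, hs, h⟩ := e.exists_next n j
  exact ⟨n', hn, hs, e.eq_until_next (fun s => s.pc j) (fun _ _ _ h hj => h.pc_other hj) h hn le_rfl,
    e.eq_until_next (fun s => s.c j) (fun _ _ _ h hj => h.c_other hj) h hn le_rfl⟩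

/-- The rank falls with each own step and is untouched by the steps of others; fairness supplies the
own steps. -/
theorem exists_getTask_or_running (n : ℕ) (j : Thread m) :
    ∃ n' ≥ n, (e.state n').pc j = .getTask ∨ ∃ τ, (e.state n').pc j = .running τ := by
  induction hr : (e.state n).rank j using Nat.strong_induction_on generalizing n with
  | _ r ih =>
    by_cases hg : (e.state n).pc j = .getTask ∨ ∃ τ, (e.state n).pc j = .running τ
    · exact ⟨n, le_rfl, hg⟩
    · push Not at hg
      obtain ⟨n', hn, hs, hpc, hc⟩ := e.exists_next_pc n j
      have hrank : (e.state n').rank j = (e.state n).rank j := by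
        simp only [rank, hpc, hc]
      have hlt := (hs ▸ e.step n').rank_lt (by rw [hpc]; exact hg.1) (by rw [hpc]; exact hg.2)
      obtain ⟨n'', hn'', h⟩ := ih _ (by omega) (n' + 1) rfl
      exact ⟨n'', by omega, h⟩

/-! ### Launched tasks are executed by the whole team -/

theorem removed_mono {τ : Task} {n n' : ℕ} (hn : n ≤ n') (h : (e.state n).Removed τ) :
    (e.state n').Removed τ := by
  induction n', hn using Nat.le_induction with
  | base => exact h
  | succ k hk ih => exact (e.step k).removed ih

theorem exists_runs_of_last {n : ℕ} {k : Thread m} {τ : Task}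
    (h : (e.state n).last k = some τ) : ∃ n', e.Runs n' k τ := by
  induction n with
  | zero => simp [e.init.last] at h
  | succ n ih =>
    rcases (e.step n).last_cases h with h | h
    · exact ih h
    · exact ⟨_, h⟩

/-- At the first moment when `τ` is no longer running, the step just taken can only be `finish`. -/
theorem exists_getTask_of_runs {n : ℕ} {j : Thread m} {τ : Task} (h : e.Runs n j τ)
    (hex : ∃ n' ≥ n, ¬ e.Runs n' j τ) : ∃ n' ≥ n, (e.state n').pc j = .getTask := by
  classical
  obtain ⟨hge, hnr⟩ := Nat.find_spec hex
  have hlt : n < Nat.find hex := by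
    rcases hge.lt_or_eq with h' | h'
    · exact h'
    · rw [← h'] at hnr
      exact absurd h hnr
  obtain ⟨q, hq⟩ : ∃ q, Nat.find hex = q + 1 := ⟨Nat.find hex - 1, by omega⟩
  have hrun : e.Runs q j τ := by
    have := Nat.find_min hex (m := q) (by omega)
    push Not at this
    exact this (by omega)
  refine ⟨Nat.find hex, by omega, ?_⟩
  rw [hq] at hnr ⊢
  have hsj : e.sched q = j := by
    by_contra hsj
    apply hnr
    unfold Runs at hrun ⊢
    rwa [(e.step q).pc_other (Ne.symm hsj)]
  have hst := e.step q
  rw [hsj] at hst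
  unfold Runs at hrun hnr
  generalize e.state (q + 1) = s' at *
  generalize e.state q = s at *
  cases hst <;> simp_all [setPC, State.spawn]

theorem all_started_of_G_eq_zero (hreq : ∀ τ, IsSize m (req τ)) {n : ℕ} {x j : Thread m} {τ : Task}
    (hx : (e.state n).task x = some τ) (hG : (e.state n).G x = 0) (ho : Overlap (req τ) x j) :
    (e.state n).last j = some τ := by
  have := (e.inv hreq n).offer.count _ _ hx
  rw [hG] at this
  have he := Finset.card_eq_zero.1 this.symm
  by_contra hj
  have : j ∈ unstarted (e.state n).last (req τ) x τ := by simp [ho, hj]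
  simp [he] at this

/-- While a thread executes a task, its coordinator still offers this task, unless the whole team
has started it. -/
theorem offered_or_all_started (hreq : ∀ τ, IsSize m (req τ)) {n : ℕ} {j : Thread m} {τ : Task} (h : e.Runs n j τ) :
    ((e.state n).task ((e.state n).c j) = some τ ∧ Overlap (req τ) ((e.state n).c j) j) ∨
      ∀ k, Overlap (req τ) j k → ∃ n', e.Runs n' k τ := by
  induction n with
  | zero => simp [Runs, e.init.pc] at h
  | succ n ih =>
    have key : e.Runs n j τ → (e.state (n + 1)).c j = (e.state n).c j →
        ((e.state (n + 1)).task ((e.state (n + 1)).c j) = some τ ∧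
          Overlap (req τ) ((e.state (n + 1)).c j) j) ∨
        ∀ k, Overlap (req τ) j k → ∃ n', e.Runs n' k τ := by
      intro hr hc
      rw [hc]
      rcases ih hr with ⟨h1, h2⟩ | h1
      · rcases (e.step n).task_eq_or_G_eq_zero (x := (e.state n).c j) with h3 | h3
        · exact Or.inl ⟨h3.trans h1, h2⟩
        · refine Or.inr fun k hk => ?_
          exact e.exists_runs_of_last (e.all_started_of_G_eq_zero hreq h1 h3 (h2.trans hk))
      · exact Or.inr h1
    rcases eq_or_ne j (e.sched n) with hj | hj
    · subst hj
      rcases (e.step n).pc_running_cases h with ⟨h1, h2⟩ | h1 | ⟨h1, h2, -, h3⟩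
      · exact key h1 h2
      · rw [h1.c_eq]
        exact Or.inl ⟨h1.task_eq, Overlap.refl _ _⟩
      · left
        rw [h3]
        refine ⟨h1, ?_⟩
        rw [← (e.inv hreq n).offer.size _ _ h1]
        exact h2
    · refine key ?_ ((e.step n).c_other hj)
      unfold Runs at h ⊢
      rwa [(e.step n).pc_other hj] at h

/-- A thread of the team that has not yet started an offered task will do so. -/
theorem exists_runs_of_unstarted (hreq : ∀ τ, IsSize m (req τ)) (hfin : e.FiniteComputation) {n : ℕ} {x j : Thread m} {τ : Task}
    (hx : (e.state n).task x = some τ) (ho : Overlap (req τ) x j)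
    (hj : (e.state n).last j ≠ some τ) : ∃ n' ≥ n, e.Runs n' j τ := by
  by_contra hno
  push Not at hno
  have hlast : ∀ k ≥ n, (e.state k).last j ≠ some τ := by
    intro k hk
    induction k, hk using Nat.le_induction with
    | base => exact hj
    | succ k hk ih =>
      intro h
      rcases (e.step k).last_cases h with h | h
      · exact ih h
      · exact hno (k + 1) (by omega) h
  -- The offer stays: changing it needs a zero counter, and then `j` would have started `τ`.
  have htask : ∀ k ≥ n, (e.state k).task x = some τ := by
    intro k hk
    induction k, hk using Nat.le_induction with
    | base => exact hx
    | succ k hk ih =>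
      rcases (e.step k).task_eq_or_G_eq_zero (x := x) with h | h
      · exact h.trans ih
      · exact absurd (e.all_started_of_G_eq_zero hreq ih h ho) (hlast k hk)
  have hcj : ∀ k ≥ n, (e.state k).c j = x := fun k hk =>
    (e.inv hreq k).c_eq_of_overlap (htask k hk) ho
  have hjx : x ≠ j := by
    rintro rfl
    exact hj ((e.inv hreq n).offer.last _ _ hx)
  -- The thread may still execute some other task `τ'`. Its coordinator now offers `τ`, so by
  -- `offered_or_all_started` the whole team has started `τ'`, and finiteness ends that execution.
  have hget : ∃ k ≥ n, (e.state k).pc j = .getTask := by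
    obtain ⟨k, hk, h | ⟨τ', h⟩⟩ := e.exists_getTask_or_running n j
    · exact ⟨k, hk, h⟩
    · have hall : ∀ k, Overlap (req τ') j k → ∃ n', e.Runs n' k τ' := by
        rcases e.offered_or_all_started hreq h with ⟨h1, -⟩ | h1
        · rw [hcj k hk, htask k hk] at h1
          simp only [Option.some.injEq] at h1
          subst h1
          exact absurd h (hno k hk)
        · exact h1
      obtain ⟨k', hk', h'⟩ := e.exists_getTask_of_runs h (hfin.2 k j τ' h hall)
      exact ⟨k', by omega, h'⟩
  obtain ⟨k, hk, hpc⟩ := hget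
  obtain ⟨k', hk', hs, hpc', -⟩ := e.exists_next_pc k j
  rw [hpc] at hpc'
  have hst := e.step k'
  rw [hs] at hst
  have hc := hcj k' (by omega)
  have ht := htask k' (by omega)
  have hl := hlast k' (by omega)
  have hnr := hno (k' + 1) (by omega)
  have hinv := e.inv hreq k'
  have hG := hinv.G_eq_zero (k := j) (by rw [hc]; exact hjx)
  have hteam : (e.state k').Teamed j := by
    unfold Teamed
    rw [hc, hinv.offer.size _ _ ht]
    exact ho
  unfold Runs at hnr
  generalize e.state (k' + 1) = s' at *
  generalize e.state k' = s at *
  -- A teamed thread at `getTask` with a zero counter and a fresh offer can do nothing but start it.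
  cases hst <;> simp_all [State.start]

/-- Every thread of the team starts an offered task. -/
theorem exists_runs_of_offered (hreq : ∀ τ, IsSize m (req τ)) (hfin : e.FiniteComputation) {n : ℕ} {x j : Thread m} {τ : Task}
    (hx : (e.state n).task x = some τ) (ho : Overlap (req τ) x j) : ∃ n', e.Runs n' j τ := by
  by_cases hj : (e.state n).last j = some τ
  · exact e.exists_runs_of_last hj
  · obtain ⟨k, -, h⟩ := e.exists_runs_of_unstarted hreq hfin hx ho hj
    exact ⟨k, h⟩

/-- Every execution of a task ends. -/
theorem exists_not_runs (hreq : ∀ τ, IsSize m (req τ)) (hfin : e.FiniteComputation) {n : ℕ} {j : Thread m} {τ : Task}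
    (h : e.Runs n j τ) : ∃ n' > n, ¬ e.Runs n' j τ := by
  have hall : ∀ k, Overlap (req τ) j k → ∃ n', e.Runs n' k τ := by
    rcases e.offered_or_all_started hreq h with ⟨h1, h2⟩ | h1
    · exact fun k hk => e.exists_runs_of_offered hreq hfin h1 (h2.trans hk)
    · exact h1
  obtain ⟨n', hn', hr⟩ := hfin.2 n j τ h hall
  refine ⟨n', lt_of_le_of_ne hn' ?_, hr⟩
  rintro rfl
  exact hr h

/-- The launch separates two phases: before it `τ` sits in a queue and cannot run, and after it `τ`
is exclusive to the block of `x`. -/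
theorem executedByTeam_of_launches (hreq : ∀ τ, IsSize m (req τ)) (hfin : e.FiniteComputation) {n n₀ : ℕ} (hn : n ≤ n₀)
    {τ : Task} {x : Thread m} (h : Launches x τ (e.state n₀) (e.state (n₀ + 1)))
    (hx : e.sched n₀ = x) : e.ExecutedByTeam n τ {j | Overlap (req τ) x j} := by
  have hinv := e.inv hreq (n₀ + 1)
  have hbefore : ∀ k ≤ n₀, ∀ j, ¬ e.Runs k j τ := by
    intro k hk j hr
    have := (e.inv hreq k).queue.last _ _ ((e.inv hreq k).offer.running _ _ hr)
    exact h.not_removed (e.removed_mono hk this)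
  have hafter : ∀ k ≥ n₀ + 1, (e.state k).Removed τ ∧ (e.state k).Exclusive req x τ := by
    intro k hk
    induction k, hk using Nat.le_induction with
    | base =>
      have hst := e.step n₀
      rw [hx] at hst
      exact ⟨h.removed (e.inv hreq n₀).queue, h.exclusive (e.inv hreq n₀) hst⟩
    | succ k hk ih =>
      exact ⟨(e.step k).removed ih.1, (e.step k).exclusive (e.inv hreq k) ih.1 ih.2⟩
  refine ⟨⟨n₀ + 1, by omega, x, Overlap.refl _ _, h.task_eq, hinv.offer.size _ _ h.task_eq, ?_, ?_⟩,
    ?_⟩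
  · ext j
    simp only [State.team, Set.mem_ofPred_eq, hinv.offer.size _ _ h.task_eq]
    exact ⟨fun hj => hj.2, fun hj => ⟨hinv.c_eq_of_overlap h.task_eq hj, hj⟩⟩
  · intro j hj
    -- This time comes without a lower bound; `hbefore` provides it.
    obtain ⟨n₁, hn₁⟩ := e.exists_runs_of_offered hreq hfin h.task_eq hj
    refine ⟨n₁, ?_, hn₁, e.exists_not_runs hreq hfin hn₁⟩
    by_contra hlt
    exact hbefore n₁ (by omega) j hn₁
  · intro n' j hj
    rcases Nat.lt_or_ge n₀ n' with hlt | hge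
    · exact (hafter n' hlt).2.2 j hj
    · exact absurd hj (hbefore n' hge j)

end Execution

end TeamBuilding

namespace TeamBuilding

open State Filter

/-! ### Eventually constant sequences -/

theorem eventually_eq_of_eventually_le {f : ℕ → ℕ} (h : ∀ᶠ n in atTop, f (n + 1) ≤ f n) :
    ∀ᶠ n in atTop, f (n + 1) = f n := by
  obtain ⟨N, hN⟩ := eventually_atTop.1 h
  induction hv : f N using Nat.strong_induction_on generalizing N with
  | _ v ih =>
    by_cases hlt : ∃ n ≥ N, f (n + 1) < f n
    · obtain ⟨n, hn, hlt⟩ := hlt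
      have hle : f n ≤ f N := by
        clear hlt
        induction n, hn using Nat.le_induction with
        | base => exact le_rfl
        | succ k hk ihk => exact (hN k hk).trans ihk
      exact ih (f (n + 1)) (by omega) (n + 1) (fun b hb => hN b (by omega)) rfl
    · push Not at hlt
      exact eventually_atTop.2 ⟨N, fun n hn => le_antisymm (hN n hn) (hlt n hn)⟩

theorem eventually_eq_of_subset_succ {α : Type*} {A : ℕ → Set α} (h : ∀ n, A n ⊆ A (n + 1))
    {F : Set α} (hF : F.Finite) (hA : ∀ n, A n ⊆ F) : ∀ᶠ n in atTop, A (n + 1) = A n := by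
  have hle : ∀ n, (F \ A (n + 1)).ncard ≤ (F \ A n).ncard := fun n =>
    Set.ncard_le_ncard (Set.sdiff_subset_sdiff_right (h n)) hF.sdiff
  filter_upwards [eventually_eq_of_eventually_le (f := fun n => (F \ A n).ncard)
    (Eventually.of_forall hle)] with n hn
  have := Set.eq_of_subset_of_ncard_le (Set.sdiff_subset_sdiff_right (h n)) hn.ge
    (hF.sdiff)
  refine Set.Subset.antisymm (fun x hx => ?_) (h n)
  by_contra hx'
  have hmem : x ∈ F \ A n := ⟨hA _ hx, hx'⟩
  rw [← this] at hmem
  exact hmem.2 hx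

/-- The limit arguments use this form: a property that is eventually preserved need only recur once,
late enough. -/
theorem eventually_of_stable {P : ℕ → Prop} (h : ∀ᶠ n in atTop, P n → P (n + 1))
    (hf : ∃ᶠ n in atTop, P n) : ∀ᶠ n in atTop, P n := by
  obtain ⟨N, hN⟩ := eventually_atTop.1 h
  obtain ⟨n, hn, hP⟩ := frequently_atTop.1 hf N
  refine eventually_atTop.2 ⟨n, fun k hk => ?_⟩
  induction k, hk using Nat.le_induction with
  | base => exact hP
  | succ k hk ih => exact hN k (by omega) ih

theorem eventually_or_eventually_not_of_stable {P : ℕ → Prop}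
    (h : ∀ᶠ n in atTop, P n → P (n + 1)) : (∀ᶠ n in atTop, P n) ∨ ∀ᶠ n in atTop, ¬ P n := by
  by_cases hf : ∃ᶠ n in atTop, P n
  · exact Or.inl (eventually_of_stable h hf)
  · exact Or.inr (not_frequently.1 hf)

theorem exists_eventually_eq {α : Type*} {f : ℕ → α} (h : ∀ᶠ n in atTop, f (n + 1) = f n) :
    ∃ a, ∀ᶠ n in atTop, f n = a := by
  obtain ⟨N, hN⟩ := eventually_atTop.1 h
  refine ⟨f N, eventually_atTop.2 ⟨N, fun k hk => ?_⟩⟩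
  induction k, hk using Nat.le_induction with
  | base => rfl
  | succ k hk ih => rw [hN k hk, ih]

theorem eventually_succ {P : ℕ → Prop} (h : ∀ᶠ n in atTop, P n) : ∀ᶠ n in atTop, P (n + 1) :=
  (tendsto_add_atTop_nat 1).eventually h

/-! ### The end of all executions -/

variable {m : ℕ} {Task : Type*} {req : Task → ℕ} {s s' : State m Task} {i : Thread m}

theorem Step.spawned_subset (h : Step req i s s') : s.spawned ⊆ s'.spawned := by
  rcases h.queue_cases with ⟨h1, h2⟩ | ⟨τ', hτ⟩ | ⟨x, l, j, hm⟩ | ⟨τ', hτ, rfl⟩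
  · rw [h2]
  · obtain ⟨j, rest, -, -, h3, -⟩ := hτ.Q_eq
    rw [h3]
  · rw [hm.spawned]
  · rw [spawn_spawned]
    exact Set.subset_insert _ _

/-- Only starts touch the counters apart from launches. The counter is positive then because the
starting thread itself is still counted. -/
theorem Step.G_cases (h : Step req i s s') (hs : s.Inv req) (hl : ∀ τ, ¬ Launches i τ s s') :
    s'.G = s.G ∨ ∃ x, 0 < s.G x ∧ s'.G = Function.update s.G x (s.G x - 1) := by
  cases h with
  | start τ hpc hG hc ht hτ hlast =>
    refine Or.inr ⟨s.c i, ?_, rfl⟩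
    rw [hs.offer.count _ _ hτ, Finset.card_pos]
    refine ⟨i, ?_⟩
    rw [mem_unstarted]
    refine ⟨?_, hlast⟩
    rw [← hs.offer.size _ _ hτ]
    exact ht
  | launch τ rest h1 h2 h3 h4 h5 h6 => exact absurd ⟨rest, h1, h2, h3, h4, h5, h6, rfl⟩ (hl τ)
  | _ => exact Or.inl (by simp [setPC, leave, prepare, register, popappend, State.spawn])

theorem sum_update_pred_lt {G : Thread m → ℕ} {x : Thread m} (hx : 0 < G x) :
    ∑ y, Function.update G x (G x - 1) y < ∑ y, G y := by
  apply Finset.sum_lt_sum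
  · intro y _
    rcases eq_or_ne y x with rfl | hy <;> simp [*]
  · exact ⟨x, Finset.mem_univ _, by simp; omega⟩

namespace Execution

variable (e : Execution m req)

/-- Nothing is launched or spawned in step `n`, and no thread executes a task or is about to. -/
structure Quiet (n : ℕ) : Prop where
  not_launches : ∀ τ, ¬ Launches (e.sched n) τ (e.state n) (e.state (n + 1))
  spawned : (e.state (n + 1)).spawned = (e.state n).spawned
  not_runs : ∀ j τ, ¬ e.Runs n j τ
  G_eq : ∀ j, (e.state n).G j = 0

theorem eventually_quiet (hreq : ∀ τ, IsSize m (req τ)) (hfin : e.FiniteComputation) : ∀ᶠ n in atTop, e.Quiet n := by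
  have hsp : ∀ᶠ n in atTop, (e.state (n + 1)).spawned = (e.state n).spawned :=
    eventually_eq_of_subset_succ (fun n => (e.step n).spawned_subset) hfin.1
      (fun n τ hτ => ⟨n, hτ⟩)
  -- Removed tasks form an increasing sequence of subsets of a finite set, and each launch enlarges
  -- it strictly.
  have hrem : ∀ᶠ n in atTop, {τ | (e.state (n + 1)).Removed τ} = {τ | (e.state n).Removed τ} :=
    eventually_eq_of_subset_succ (A := fun n => {τ | (e.state n).Removed τ})
      (fun n τ hτ => (e.step n).removed hτ) hfin.1 (fun n τ hτ => ⟨n, hτ.1⟩)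
  have hnl : ∀ᶠ n in atTop, ∀ τ, ¬ Launches (e.sched n) τ (e.state n) (e.state (n + 1)) := by
    filter_upwards [hrem] with n hn τ hτ
    have : τ ∈ {τ | (e.state (n + 1)).Removed τ} := hτ.removed (e.inv hreq n).queue
    rw [hn] at this
    exact hτ.not_removed this
  -- Without launches each start lowers this sum, so starts end as well.
  have hG : ∀ᶠ n in atTop, ∑ x, (e.state (n + 1)).G x = ∑ x, (e.state n).G x := by
    apply eventually_eq_of_eventually_le (f := fun n => ∑ x, (e.state n).G x)
    filter_upwards [hnl] with n hn
    rcases (e.step n).G_cases (e.inv hreq n) hn with h | ⟨x, hx, h⟩ <;> rw [h]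
    exact (sum_update_pred_lt hx).le
  have hGG : ∀ᶠ n in atTop, (e.state (n + 1)).G = (e.state n).G := by
    filter_upwards [hnl, hG] with n hn hn'
    rcases (e.step n).G_cases (e.inv hreq n) hn with h | ⟨x, hx, h⟩
    · exact h
    · rw [h] at hn'
      exact absurd hn' (sum_update_pred_lt hx).ne
  have hrun : ∀ᶠ n in atTop, ∀ j, ∀ τ, ¬ e.Runs n j τ := by
    rw [eventually_all]
    intro j
    apply eventually_of_stable
    · filter_upwards [hnl, hGG] with n hn hGn hno τ hr
      rcases eq_or_ne j (e.sched n) with rfl | hj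
      · rcases (e.step n).pc_running_cases hr with ⟨h, -⟩ | h | ⟨h1, h2, hl, h3⟩
        · exact hno _ h
        · exact hn _ h
        · have hpos : 0 < (e.state n).G ((e.state n).c (e.sched n)) := by
            rw [(e.inv hreq n).offer.count _ _ h1, Finset.card_pos]
            refine ⟨e.sched n, ?_⟩
            rw [mem_unstarted]
            refine ⟨?_, hl⟩
            rw [← (e.inv hreq n).offer.size _ _ h1]
            exact h2
          rw [h3] at hGn
          have := congrFun hGn ((e.state n).c (e.sched n))
          simp only [State.start, Function.update_self] at this
          omega
      · unfold Runs at hr hno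
        rw [(e.step n).pc_other hj] at hr
        exact hno _ hr
    · rw [frequently_atTop]
      intro n
      by_cases h : ∃ τ, e.Runs n j τ
      · obtain ⟨τ, h⟩ := h
        obtain ⟨n', hn', hr⟩ := e.exists_not_runs hreq hfin h
        obtain ⟨n'', hn'', h''⟩ := e.exists_getTask_of_runs h ⟨n', hn'.le, hr⟩
        refine ⟨n'', hn'', fun τ' h' => ?_⟩
        unfold Runs at h'
        simp [h''] at h'
      · exact ⟨n, le_rfl, not_exists.1 h⟩
  obtain ⟨N, hN⟩ := eventually_atTop.1 hrun
  filter_upwards [hsp, hnl, hrun, eventually_ge_atTop N] with n h1 h2 h3 hn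
  refine ⟨h2, h1, h3, fun x => ?_⟩
  cases ht : (e.state n).task x with
  | none => exact (e.inv hreq n).offer.none _ ht
  | some τ =>
    -- A nonzero counter means an unstarted thread, which would run the task after time `N`.
    by_contra hne
    rw [(e.inv hreq n).offer.count _ _ ht, Finset.card_eq_zero] at hne
    obtain ⟨j, hj⟩ := Finset.nonempty_of_ne_empty hne
    rw [mem_unstarted] at hj
    obtain ⟨n', hn', hr⟩ := e.exists_runs_of_unstarted hreq hfin ht hj.1 hj.2
    exact hN n' (by omega) j τ hr

/-- In the quiet phase every thread comes back to `getTask` again and again. -/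
theorem frequently_getTask (hq : ∀ᶠ n in atTop, e.Quiet n) (j : Thread m) :
    ∃ᶠ n in atTop, e.sched n = j ∧ (e.state n).pc j = .getTask := by
  obtain ⟨N, hN⟩ := eventually_atTop.1 hq
  rw [frequently_atTop]
  intro n
  obtain ⟨k, hk, h | ⟨τ, h⟩⟩ := e.exists_getTask_or_running (max n N) j
  · obtain ⟨k', hk', hs, hpc, -⟩ := e.exists_next_pc k j
    exact ⟨k', by omega, hs, hpc.trans h⟩
  · exact absurd h ((hN k (by omega)).not_runs j τ)

/-- Information that a thread gathered before the quiet phase may be stale. A stable property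
therefore only has to be established by a pass through `getTask`, where that information is
refreshed. -/
theorem eventually_of_getTask (hq : ∀ᶠ n in atTop, e.Quiet n) (j : Thread m) {P : ℕ → Prop}
    (hs : ∀ᶠ n in atTop, P n → P (n + 1))
    (hg : ∀ᶠ n in atTop, e.sched n = j → (e.state n).pc j = .getTask → P (n + 1)) :
    ∀ᶠ n in atTop, P n := by
  refine eventually_of_stable hs ?_
  have := (e.frequently_getTask hq j).and_eventually hg
  rw [frequently_atTop] at this ⊢
  intro n
  obtain ⟨k, hk, ⟨h1, h2⟩, h3⟩ := this n
  exact ⟨k + 1, by omega, h3 h1 h2⟩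

end Execution

/-! ### Dissolution of the teams -/

theorem _root_.TeamBuilding.Reg.retarget_of_t_eq_one {R : Reg} (h : R.t = 1) (w : ℕ) :
    R.retarget w = R.setReq w := by
  simp [Reg.retarget, h]

/-- A team that is kept or shrunk has `r = t`, hence `a = r`, and the coordinator would launch. If
it needs more threads, its old team was trivial or has been disbanded. -/
theorem coordinate_t (hs : s.Inv req) (hc : s.c i = i)
    (ha : ((s.prepare i).R i).r ≠ ((s.prepare i).R i).a) : ((s.prepare i).R i).t = 1 := by
  have hreg := regInv_prepare hs.ctrl.reg hc
  have h1 : ((s.prepare i).R i).r ≠ ((s.prepare i).R i).t := by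
    intro h
    exact ha (h.trans (hreg.a_eq_of_r_eq_t h).symm)
  simp only [prepare, Function.update_self, Reg.retarget] at h1 ⊢
  split_ifs at h1 ⊢ with h2 h3
  · rw [Reg.setReq_r, Reg.setReq_t] at h1
    rw [Reg.setReq_t]
    tauto
  · simp at h1
  · rfl

theorem idle_R (hs : s.Inv req) (hQ : s.minLevel i = none) :
    ((s.prepare i).R i).t = 1 ∧ ((s.prepare i).R i).r = 1 := by
  have hpos := (hs.ctrl.reg.size_t i).pos
  simp only [prepare, Function.update_self, Reg.retarget_r,
    want_eq_one_of_minLevel_eq_none hQ (hs.ctrl.reg.size_t i), and_true]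
  unfold Reg.retarget
  split_ifs with h
  · rw [Reg.setReq_t]; omega
  · rfl
  · rfl

theorem Step.t_stable (h : Step req i s s') (hs : s.Inv req) (hl : ∀ τ, ¬ Launches i τ s s')
    {j : Thread m} (hj : (s.R j).t = 1) : (s'.R j).t = 1 := by
  rcases eq_or_ne j i with rfl | hji
  · cases h with
    | idle hpc hG hc hQ => exact (idle_R hs hQ).1
    | coordinate hpc hG hc hQ ha => exact coordinate_t hs hc ha
    | launch τ rest h1 h2 h3 h4 h5 h6 => exact absurd ⟨rest, h1, h2, h3, h4, h5, h6, rfl⟩ (hl τ)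
    | dropOut => rw [(leave_R j).2.1, hj]
    | switchLeave => rw [(leave_R j).2.1, hj]
    | stealRegister l =>
      simp only [register]
      rcases eq_or_ne j (s.c (partner j l)) with e | e
      · rw [← e, Function.update_self, hj]
      · rw [Function.update_of_ne e]
        split_ifs <;> simp [hj]
    | switchRegister x =>
      simp only [register]
      rcases eq_or_ne j x with e | e
      · rw [← e, Function.update_self, hj]
      · rw [Function.update_of_ne e]
        split_ifs <;> simp [hj]
    | _ => simpa [setPC, State.start, popappend, State.spawn] using hj
  · rw [(h.R_other hji).2.1, hj]

theorem Step.t_getTask (h : Step req i s s') (hs : s.Inv req) (hl : ∀ τ, ¬ Launches i τ s s')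
    (hpc : s.pc i = .getTask) (hG : s.G i = 0) : (s'.R i).t = 1 := by
  by_cases hc : s.c i = i
  · cases h with
    | idle _ _ _ hQ => exact (idle_R hs hQ).1
    | coordinate _ _ _ _ ha => exact coordinate_t hs hc ha
    | launch τ rest h1 h2 h3 h4 h5 h6 => exact absurd ⟨rest, h1, h2, h3, h4, h5, h6, rfl⟩ (hl τ)
    | _ => simp_all
  · exact h.t_stable hs hl (hs.ctrl.reg.t_eq_one (hs.ctrl.reg.r_eq_one _ hc))

theorem Execution.eventually_t_eq_one (e : Execution m req) (hreq : ∀ τ, IsSize m (req τ))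
    (hq : ∀ᶠ n in atTop, e.Quiet n) : ∀ᶠ n in atTop, ∀ j, ((e.state n).R j).t = 1 := by
  rw [eventually_all]
  intro j
  apply e.eventually_of_getTask hq j
  · filter_upwards [hq] with n hn ht
    exact (e.step n).t_stable (e.inv hreq n) hn.not_launches ht
  · filter_upwards [hq] with n hn hs hpc
    subst hs
    exact (e.step n).t_getTask (e.inv hreq n) hn.not_launches hpc (hn.G_eq _)

end TeamBuilding

namespace TeamBuilding

open State Filter

variable {m : ℕ} {Task : Type*} {req : Task → ℕ} {s s' : State m Task} {i : Thread m}

/-! ### The end of all thefts -/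

/-- The level of the smallest task of thread `i`, and `m + 1` if it has no task. -/
def State.lev (s : State m Task) (i : Thread m) : ℕ := (s.minLevel i).getD (m + 1)

theorem lev_eq_of_empty_iff {k : Thread m} (h : ∀ j, s'.Q k j = [] ↔ s.Q k j = []) :
    s'.lev k = s.lev k := by
  unfold lev
  cases h1 : s.minLevel k with
  | none =>
    rw [minLevel_eq_none] at h1
    rw [minLevel_eq_none.2 (fun j hj => (h j).2 (h1 j hj))]
  | some j =>
    rw [minLevel_eq_some] at h1
    rw [minLevel_eq_some.2 ⟨h1.1, fun e => h1.2.1 ((h j).1 e), fun j' hj' => (h j').2 (h1.2.2 j' hj')⟩]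

theorem lev_le_of_ne_nil {j : ℕ} (hj : j ≤ m) (h : s.Q i j ≠ []) : s.lev i ≤ j := by
  unfold lev
  cases h1 : s.minLevel i with
  | none => exact absurd (minLevel_eq_none.1 h1 j hj) h
  | some j' =>
    rw [minLevel_eq_some] at h1
    by_contra hlt
    exact h (h1.2.2 j (by simpa using hlt))

theorem lev_le (s : State m Task) (i : Thread m) : s.lev i ≤ m + 1 := by
  unfold lev
  cases h1 : s.minLevel i with
  | none => exact le_rfl
  | some j' => exact (minLevel_eq_some.1 h1).1.trans (Nat.le_succ m)

/-- At most half of a queue is taken, so a theft never empties it. -/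
theorem Moves.empty_source {x : Thread m} {l j : ℕ} (h : Moves i s s' x l j) (j' : ℕ) :
    s'.Q x j' = [] ↔ s.Q x j' = [] := by
  rcases eq_or_ne j' j with rfl | hj
  · have hp : s.stealCount x l j' ≤ (s.Q x j').length / 2 := min_le_left _ _
    have := h.2.1
    rw [h.Q_source, ← List.length_eq_zero_iff, ← List.length_eq_zero_iff, List.length_take]
    omega
  · rw [h.Q_other (Or.inl hj)]

theorem Moves.lev_other {x k : Thread m} {l j : ℕ} (h : Moves i s s' x l j) (hk : k ≠ i) :
    s'.lev k = s.lev k := by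
  apply lev_eq_of_empty_iff
  intro j'
  rcases eq_or_ne k x with rfl | hkx
  · exact h.empty_source j'
  · rw [h.Q_other (Or.inr ⟨hkx, hk⟩)]

theorem Moves.lev_le_self {x : Thread m} {l j : ℕ} (h : Moves i s s' x l j) (hj : j ≤ m) :
    s'.lev i ≤ j := by
  apply lev_le_of_ne_nil hj
  rw [h.Q_target]
  have hp : s.stealCount x l j ≤ (s.Q x j).length / 2 := min_le_left _ _
  have := h.2.1
  intro e
  have e' := congrArg List.length e
  simp at e'
  omega

theorem not_moves_of_Q_eq (hQ : s'.Q = s.Q) {x : Thread m} {l j : ℕ} : ¬ Moves i s s' x l j := by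
  intro hm
  have h1 := hm.Q_target
  rw [hQ] at h1
  have h2 := congrArg List.length h1
  have := hm.2.1
  have hp : s.stealCount x l j ≤ (s.Q x j).length / 2 := min_le_left _ _
  simp at h2
  omega

/-- Threads other than the acting one keep the level of their smallest task. -/
theorem Step.lev_other (h : Step req i s s') {k : Thread m} (hk : k ≠ i) :
    s'.lev k = s.lev k := by
  rcases h.queue_cases with ⟨h1, h2⟩ | ⟨τ', hτ⟩ | ⟨x, l, j, hm⟩ | ⟨τ', hτ, rfl⟩
  · exact lev_eq_of_empty_iff (by simp [h1])
  · obtain ⟨j, rest, -, h1, -⟩ := hτ.Q_eq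
    exact lev_eq_of_empty_iff (by simp [h1, hk])
  · exact hm.lev_other hk
  · exact lev_eq_of_empty_iff (by simp [spawn_Q, hk])

/-- A thread that looks for tasks or helpers has no task smaller than the one in question. -/
def State.Seeks (s : State m Task) (i : Thread m) : Prop :=
  (∀ l, s.pc i = .steal l → s.lev i = m + 1) ∧ ∀ r l, s.pc i = .poll r l → r ≤ 2 ^ s.lev i

theorem want_eq (ht : (s.R i).t = 1) (hQ : s.minLevel i ≠ none) :
    s.want i = 2 ^ s.lev i := by
  cases h : s.minLevel i with
  | none => exact absurd h hQ
  | some j =>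
    rw [want_eq_of_minLevel_eq_some h ht]
    simp [lev, h]

/-- With `t = 1` the requirement used for polling is the size of the smallest own task. A step by
which the thread changes its own queues never leads to a location at which it steals or polls. -/
theorem Step.seeks (h : Step req i s s') (hs : s.Inv req) {j : Thread m}
    (ht : (s.R j).t = 1) (hj : s.Seeks j) : s'.Seeks j := by
  rcases eq_or_ne j i with rfl | hji
  · cases h with
    | help hpc hG hc hT ha hm =>
      refine ⟨by simp [setPC], ?_⟩
      intro r l hr
      simp only [setPC, Function.update_self, PC.poll.injEq] at hr
      change r ≤ 2 ^ s.lev j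
      rw [← hr.1]
      unfold lev
      cases h1 : s.minLevel j with
      | none =>
        refine (hs.ctrl.reg.size_r _).le.trans ?_
        exact Nat.pow_le_pow_right (by norm_num) (by simp)
      | some j' => exact hm j' h1
    | idle hpc hG hc hQ =>
      refine ⟨?_, by simp [setPC]⟩
      intro l _
      change s.lev j = m + 1
      simp [lev, hQ]
    | coordinate hpc hG hc hQ ha =>
      refine ⟨by simp [setPC], ?_⟩
      intro r l hr
      simp only [setPC, Function.update_self, PC.poll.injEq] at hr
      change r ≤ 2 ^ s.lev j
      rw [← hr.1]
      simp only [prepare, Function.update_self, Reg.retarget_r]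
      exact (want_eq ht hQ).le
    | stealNext l hpc =>
      refine ⟨?_, by simp [setPC]⟩
      intro _ _
      exact hj.1 l hpc
    | pollNext r l hpc =>
      refine ⟨by simp [setPC], ?_⟩
      intro r' l' hr
      simp only [setPC, Function.update_self, PC.poll.injEq] at hr
      rw [← hr.1]
      exact hj.2 r l hpc
    | _ =>
      refine ⟨fun l hl => ?_, fun r l hl => ?_⟩ <;>
      simp_all [setPC, State.start, leave, register, popappend, State.spawn, State.launch]
  · unfold Seeks
    rw [h.pc_other hji, h.lev_other hji]
    exact hj

/-- Stolen tasks have level `j ≤ l`, and a thread looking at level `l` has no task of level `l` or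
below. -/
theorem Moves.lev_lt_self {x : Thread m} {l j : ℕ} (h : Moves i s s' x l j) (hs : s.Seeks i) :
    s'.lev i < s.lev i := by
  have hlt : j < s.lev i := by
    rcases h.2.2.2.1 with ⟨hpc, hl⟩ | ⟨r, hpc, hl⟩
    · have := hs.1 l hpc
      have := h.2.2.1
      omega
    · have := hl.trans_le (hs.2 r l hpc)
      have := (Nat.pow_lt_pow_iff_right (a := 2) (by norm_num)).1 this
      have := h.2.2.1
      omega
  have := lev_le s i
  have := h.lev_le_self (by omega)
  omega

namespace Execution

variable (e : Execution m req)

/-- The sum of all `lev` is a potential: a theft lowers the level of the thief and keeps the levels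
of all others. -/
theorem eventually_Q_eq (hreq : ∀ τ, IsSize m (req τ)) (hq : ∀ᶠ n in atTop, e.Quiet n) :
    ∀ᶠ n in atTop, (e.state (n + 1)).Q = (e.state n).Q := by
  have ht := e.eventually_t_eq_one hreq hq
  have hseek : ∀ᶠ n in atTop, ∀ j, (e.state n).Seeks j := by
    rw [eventually_all]
    intro j
    apply e.eventually_of_getTask hq j
    · filter_upwards [ht] with n hn hs
      exact (e.step n).seeks (e.inv hreq n) (hn j) hs
    · filter_upwards [ht] with n hn _ hpc
      refine (e.step n).seeks (e.inv hreq n) (hn j) ⟨?_, ?_⟩ <;> simp [hpc]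
  have hcases : ∀ᶠ n in atTop, (e.state (n + 1)).Q = (e.state n).Q ∨
      ∃ x l j, Moves (e.sched n) (e.state n) (e.state (n + 1)) x l j := by
    filter_upwards [hq] with n hn
    rcases (e.step n).queue_cases with h | ⟨τ, h⟩ | h | ⟨τ, h1, h2⟩
    · exact Or.inl h.1
    · exact absurd h (hn.not_launches τ)
    · exact Or.inr h
    · have := hn.spawned
      rw [h2, spawn_spawned] at this
      exact absurd (this ▸ Set.mem_insert τ _) h1
  have hmove : ∀ᶠ n in atTop, ∀ x l j, Moves (e.sched n) (e.state n) (e.state (n + 1)) x l j →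
      ∑ k, (e.state (n + 1)).lev k < ∑ k, (e.state n).lev k := by
    filter_upwards [hseek] with n hn x l j h
    have hlt := h.lev_lt_self (hn _)
    apply Finset.sum_lt_sum
    · intro k _
      rcases eq_or_ne k (e.sched n) with rfl | hk
      · exact hlt.le
      · exact (h.lev_other hk).le
    · exact ⟨_, Finset.mem_univ _, hlt⟩
  have hconst := eventually_eq_of_eventually_le (f := fun n => ∑ k, (e.state n).lev k) (by
    filter_upwards [hcases, hmove] with n h1 h2
    rcases h1 with h1 | ⟨x, l, j, h1⟩
    · exact (Finset.sum_congr rfl fun k _ => lev_eq_of_empty_iff (by simp [h1])).le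
    · exact (h2 x l j h1).le)
  filter_upwards [hcases, hmove, hconst] with n h1 h2 h3
  rcases h1 with h1 | ⟨x, l, j, h1⟩
  · exact h1
  · exact absurd h3 (h2 x l j h1).ne

end Execution

/-! ### Steps that build teams -/

/-- The registration data of thread `i` itself stay the same. -/
def SameReg (i : Thread m) (s s' : State m Task) : Prop :=
  (s'.R i).r = (s.R i).r ∧ (s'.R i).N = (s.R i).N ∧ s'.cN i = s.cN i

/-- The steps of thread `i` when no task is launched, executed or stolen any more. Here `V k` is the
size of the smallest task of thread `k`, and `2 ^ (m + 1)` if there is none. -/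
inductive BuildStep (V : Thread m → ℕ) (i : Thread m) (s s' : State m Task) : Prop
  | revoked (hpc : s.pc i = .getTask) (hc : s.c i ≠ i) (ha : ¬ s.Active i)
      (hpc' : s'.pc i = .getTask) (hc' : s'.c i = i) (hR : SameReg i s s')
  | dropOut (hpc : s.pc i = .getTask) (hc : s.c i ≠ i) (ha : s.Active i)
      (hV : V i < V (s.c i)) (hV' : V i ≤ 2 ^ m)
      (hpc' : s'.pc i = .getTask) (hc' : s'.c i = i) (hR : SameReg i s s')
  | help (hpc : s.pc i = .getTask) (hc : s.c i ≠ i) (ha : s.Active i)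
      (hV : V (s.c i) ≤ V i)
      (hpc' : s'.pc i = .poll (V (s.c i)) 0) (hc' : s'.c i = s.c i) (hR : SameReg i s s')
  | idle (hpc : s.pc i = .getTask) (hc : s.c i = i) (hV : 2 ^ m < V i)
      (hpc' : s'.pc i = .steal 0) (hc' : s'.c i = i) (hR : SameReg i s s')
  | coordinate (hpc : s.pc i = .getTask) (hc : s.c i = i) (hV : V i ≤ 2 ^ m)
      (ha : (s.R i).r = V i → V i ≠ (s.R i).a) (h1 : 1 < V i)
      (hpc' : s'.pc i = .poll (V i) 0) (hc' : s'.c i = i)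
      (hr' : (s'.R i).r = V i) (hN' : (s'.R i).N = (s.R i).N) (hcN : s'.cN i = s.cN i)
  | stealDone (l : ℕ) (hpc : s.pc i = .steal l) (hl : m ≤ l)
      (hpc' : s'.pc i = .getTask) (hc' : s'.c i = s.c i) (hR : SameReg i s s')
  | stealRegister (l : ℕ) (hpc : s.pc i = .steal l) (hl : l < m) (h : s.Requires i l)
      (hpc' : s'.pc i = .getTask) (hc' : s'.c i = s.c (partner i l)) (hr' : (s'.R i).r = 1)
      (ha' : s'.Active i)
  | stealNext (l : ℕ) (hpc : s.pc i = .steal l) (hl : l < m) (h : ¬ s.Requires i l)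
      (hpc' : s'.pc i = .steal (l + 1)) (hc' : s'.c i = s.c i) (hR : SameReg i s s')
  | pollDone (r l : ℕ) (hpc : s.pc i = .poll r l) (hl : r ≤ 2 ^ l)
      (hpc' : s'.pc i = .getTask) (hc' : s'.c i = s.c i) (hR : SameReg i s s')
  | pollSwitch (r l : ℕ) (hpc : s.pc i = .poll r l) (hl : 2 ^ l < r) (h : s.PartnerWins i r l)
      (hpc' : s'.pc i = .switchTo (s.c (partner i l))) (hc' : s'.c i = s.c i)
      (hR : SameReg i s s')
  | pollNext (r l : ℕ) (hpc : s.pc i = .poll r l) (hl : 2 ^ l < r) (h : ¬ s.PartnerWins i r l)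
      (hpc' : s'.pc i = .poll r (l + 1)) (hc' : s'.c i = s.c i) (hR : SameReg i s s')
  | switchVoid (x : Thread m) (hpc : s.pc i = .switchTo x) (h : ¬ Overlap (s.R x).r x i)
      (hpc' : s'.pc i = .getTask) (hc' : s'.c i = s.c i) (hR : SameReg i s s')
  | switchLeave (x : Thread m) (hpc : s.pc i = .switchTo x) (h : Overlap (s.R x).r x i)
      (hc : s.c i ≠ i) (hpc' : s'.pc i = .switchTo x) (hc' : s'.c i = i) (hR : SameReg i s s')
  | switchRegister (x : Thread m) (hpc : s.pc i = .switchTo x) (h : Overlap (s.R x).r x i)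
      (hc : s.c i = i) (hpc' : s'.pc i = .getTask) (hc' : s'.c i = x) (hr' : (s'.R i).r = 1)
      (ha' : s'.Active i)

theorem register_spec (hs : s.Inv req) {x : Thread m} (hx : x ≠ i) :
    (s.register i x).pc i = .getTask ∧ (s.register i x).c i = x ∧
      ((s.register i x).R i).r = 1 ∧ (s.register i x).Active i := by
  refine ⟨by simp [register], by simp [register], ?_, ?_⟩
  · have := (hs.ctrl.reg.size_r i).pos
    simp only [register, Function.update_of_ne hx.symm]
    split_ifs with h
    · simp
    · omega
  · simp [Active, register]

theorem Requires.coordinator_ne (hs : s.Inv req) {l : ℕ} (hpc : s.pc i = .steal l)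
    (h : s.Requires i l) : s.c (partner i l) ≠ i := by
  intro e
  have := h.1
  rw [e, (hs.ctrl.steal _ _ hpc).2] at this
  have := Nat.one_lt_two_pow (n := l + 1) (by omega)
  omega

theorem Step.buildStep (h : Step req i s s') (hs : s.Inv req)
    (hnl : ∀ τ, ¬ Launches i τ s s') (hQ : s'.Q = s.Q)
    (hrun : ∀ τ, s.pc i ≠ .running τ) (hG : s.G i = 0) (ht : ∀ k, (s.R k).t = 1)
    {V : Thread m → ℕ} (hV : ∀ k, V k = 2 ^ s.lev k)
    (hr : ∀ k, (s.R k).r = 1 ∨ (s.R k).r = V k) :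
    BuildStep V i s s' := by
  have hnt : s.c i ≠ i → ¬ s.Teamed i := by
    intro hc hT
    unfold Teamed at hT
    rw [ht, overlap_one] at hT
    exact hc hT
  have hact : s.c i ≠ i → s.Active i → (s.R (s.c i)).r = V (s.c i) := by
    intro hc ha
    have := hs.ctrl.reg.one_lt_of_active hc ha
    rcases hr (s.c i) with h | h
    · omega
    · exact h
  have hnone : s.minLevel i = none → V i = 2 ^ (m + 1) := by
    intro h
    simp [hV, lev, h]
  have hsome : ∀ j, s.minLevel i = some j → V i = 2 ^ j ∧ j ≤ m := by
    intro j h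
    exact ⟨by simp [hV, lev, h], (minLevel_eq_some.1 h).1⟩
  have hmove := fun x l j => not_moves_of_Q_eq (i := i) (x := x) (l := l) (j := j) hQ
  have hlog : ∀ {l : ℕ}, 2 ^ l < 2 ^ m → l < m := fun h =>
    (Nat.pow_lt_pow_iff_right (a := 2) (by norm_num)).1 h
  -- With singleton teams, raising the requirement revokes nothing: `a` and `N` are kept. The bound
  -- holds below because `r` is `1` or already final.
  have hprep : ∀ {w : ℕ}, (s.R i).r ≤ w → (s.R i).retarget w = { s.R i with r := w } := by
    intro w hw
    rw [Reg.retarget_of_t_eq_one (ht i), Reg.setReq, if_neg (by omega)]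
  cases h with
  | waitStarted hpc hG' => omega
  | revoked hpc hG hc hT ha =>
    exact .revoked hpc hc ha hpc (by simp) ⟨rfl, rfl, rfl⟩
  | start τ hpc hG hc hT => exact absurd hT (hnt hc)
  | await hpc hG hc hT => exact absurd hT (hnt hc)
  | dropOut j hpc hG hc hT ha hj hlt =>
    obtain ⟨h1, h2⟩ := hsome j hj
    refine .dropOut hpc hc ha ?_ ?_ hpc (by simp [leave]) ⟨(leave_R i).1, (leave_R i).2.2, rfl⟩
    · rw [← hact hc ha, h1]
      exact hlt
    · rw [h1]
      exact Nat.pow_le_pow_right (by norm_num) h2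
  | help hpc hG hc hT ha hj =>
    have hr' := hact hc ha
    refine .help hpc hc ha ?_ (by simp [setPC, hr']) rfl ⟨rfl, rfl, rfl⟩
    cases h1 : s.minLevel i with
    | none =>
      rw [hnone h1, ← hr']
      exact (hs.ctrl.reg.size_r _).le.trans (Nat.pow_le_pow_right (by norm_num) (by omega))
    | some j =>
      rw [(hsome j h1).1, ← hr']
      exact hj j h1
  | idle hpc hG hc hQ' =>
    have hV' := hnone hQ'
    have hlt : 2 ^ m < 2 ^ (m + 1) := Nat.pow_lt_pow_right (by norm_num) (by omega)
    -- The value `2 ^ (m + 1)`, which stands for having no task, exceeds every size, so `r` cannot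
    -- equal `V i`.
    have h1 : (s.R i).r = 1 := by
      have := (hs.ctrl.reg.size_r i).le
      rcases hr i with h | h
      · exact h
      · omega
    have hw := want_eq_one_of_minLevel_eq_none hQ' (hs.ctrl.reg.size_t i)
    refine .idle hpc hc (by omega) (by simp [setPC]) hc ⟨?_, ?_, rfl⟩ <;>
      simp [setPC, prepare, hw, hprep h1.le, h1]
  | launch τ rest h1 h2 h3 h4 h5 h6 => exact absurd ⟨rest, h1, h2, h3, h4, h5, h6, rfl⟩ (hnl τ)
  | coordinate hpc hG hc hQ' ha =>
    have hw : s.want i = V i := by rw [want_eq (ht i) hQ', hV]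
    have hle : (s.R i).r ≤ V i := by
      rcases hr i with h | h
      · rw [h, hV]
        exact Nat.two_pow_pos _
      · exact h.le
    have hRi : (s.prepare i).R i = { s.R i with r := V i } := by
      simp [prepare, hw, hprep hle]
    -- A task for a single thread would give `r = a = 1`, and the guard of this step fails.
    have h1 : 1 < V i := by
      have hpos : 0 < V i := by rw [hV]; exact Nat.two_pow_pos _
      by_contra hlt
      have h1 : V i = 1 := by omega
      have h2 : (s.R i).r = 1 := by
        have := (hs.ctrl.reg.size_r i).pos
        omega
      have h3 := hs.ctrl.reg.a_eq_of_r_eq_t (x := i) (by rw [h2, ht])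
      apply ha
      rw [hRi]
      dsimp only
      rw [h1, h3, ht]
    refine .coordinate hpc hc ?_ ?_ h1 (by simp [setPC, hRi]) hc ?_ ?_ rfl
    · cases h2 : s.minLevel i with
      | none => exact absurd h2 hQ'
      | some j =>
        rw [(hsome j h2).1]
        exact Nat.pow_le_pow_right (by norm_num) (hsome j h2).2
    · intro _ h
      apply ha
      rw [hRi]
      exact h
    · change ((s.prepare i).R i).r = V i
      rw [hRi]
    · change ((s.prepare i).R i).N = _
      rw [hRi]
  | stealDone l hpc hl =>
    exact .stealDone l hpc ((Nat.pow_le_pow_iff_right (by norm_num)).1 hl) (by simp [setPC]) rfl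
      ⟨rfl, rfl, rfl⟩
  | stealRegister l hpc hl h =>
    obtain ⟨h1, h2, h3, h4⟩ := register_spec hs (Requires.coordinator_ne hs hpc h)
    exact .stealRegister l hpc (hlog hl) h h1 h2 h3 h4
  | stealTasks l j hpc hl h hj =>
    exact absurd ⟨partner_ne (hlog hl), hj.2, hj.1, Or.inl ⟨hpc, hlog hl⟩, rfl⟩
      (hmove (partner i l) l j)
  | stealNext l hpc hl h hj =>
    exact .stealNext l hpc (hlog hl) h (by simp [setPC]) rfl ⟨rfl, rfl, rfl⟩
  | pollDone r l hpc hl => exact .pollDone r l hpc hl (by simp [setPC]) rfl ⟨rfl, rfl, rfl⟩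
  | pollSwitch r l hpc hl h =>
    exact .pollSwitch r l hpc hl h (by simp [setPC]) rfl ⟨rfl, rfl, rfl⟩
  | pollSteal r l j hpc hl h hj =>
    refine absurd ⟨?_, hj.2, hj.1, Or.inr ⟨r, hpc, hl⟩, rfl⟩ (hmove (partner i l) l j)
    intro e
    apply h.1
    rw [e]
  | pollNext r l hpc hl h hj =>
    exact .pollNext r l hpc hl h (by simp [setPC]) rfl ⟨rfl, rfl, rfl⟩
  | switchVoid x hpc h => exact .switchVoid x hpc h (by simp [setPC]) rfl ⟨rfl, rfl, rfl⟩
  | switchTeamed x hpc h hc hT => exact absurd hT (hnt hc)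
  | switchLeave x hpc h hc hT =>
    exact .switchLeave x hpc h hc hpc (by simp [leave]) ⟨(leave_R i).1, (leave_R i).2.2, rfl⟩
  | switchRegister x hpc h hc =>
    obtain ⟨h1, h2, h3, h4⟩ := register_spec hs (hs.ctrl.switch _ _ hpc)
    exact .switchRegister x hpc h hc h1 h2 h3 h4
  | runOn τ hpc => exact absurd hpc (hrun τ)
  | spawn τ τ' hpc => exact absurd hpc (hrun τ)
  | finish τ hpc => exact absurd hpc (hrun τ)

/-- Requirements take only the value `1` and the size of the smallest task. -/
theorem Step.requirement (h : Step req i s s') (hs : s.Inv req)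
    (hnl : ∀ τ, ¬ Launches i τ s s') (hQ : s'.Q = s.Q)
    (hrun : ∀ τ, s.pc i ≠ .running τ) (hG : s.G i = 0) (ht : ∀ k, (s.R k).t = 1) :
    s.pc i = .getTask ∨ (s.R i).r = 1 ∨ (s.R i).r = 2 ^ s.lev i →
    (s'.R i).r = 1 ∨ (s'.R i).r = 2 ^ s.lev i := by
  intro hor
  have hone : s.c i ≠ i → (s.R i).r = 1 := hs.ctrl.reg.r_eq_one i
  have hmove := fun x l j => not_moves_of_Q_eq (i := i) (x := x) (l := l) (j := j) hQ
  cases h with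
  | waitStarted hpc hG' => omega
  | revoked hpc hG hc hT ha => exact Or.inl (hone hc)
  | start τ hpc hG hc => exact Or.inl (hone hc)
  | await hpc hG hc => exact Or.inl (hone hc)
  | dropOut j hpc hG hc =>
    rw [(leave_R i).1]
    exact Or.inl (hone hc)
  | help hpc hG hc => exact Or.inl (hone hc)
  | idle hpc hG hc hQ' => exact Or.inl (idle_R hs hQ').2
  | launch τ rest h1 h2 h3 h4 h5 h6 => exact absurd ⟨rest, h1, h2, h3, h4, h5, h6, rfl⟩ (hnl τ)
  | coordinate hpc hG hc hQ' ha =>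
    right
    simp only [setPC, prepare, Function.update_self, Reg.retarget_r]
    exact want_eq (ht i) hQ'
  | stealRegister l hpc hl h =>
    exact Or.inl (register_spec hs (Requires.coordinator_ne hs hpc h)).2.2.1
  | stealTasks l j hpc hl h hj =>
    have hl' := (Nat.pow_lt_pow_iff_right (a := 2) (by norm_num)).1 hl
    exact absurd ⟨partner_ne hl', hj.2, hj.1, Or.inl ⟨hpc, hl'⟩, rfl⟩ (hmove (partner i l) l j)
  | pollSteal r l j hpc hl h hj =>
    refine absurd ⟨?_, hj.2, hj.1, Or.inr ⟨r, hpc, hl⟩, rfl⟩ (hmove (partner i l) l j)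
    intro e
    apply h.1
    rw [e]
  | switchLeave x hpc h hc =>
    rw [(leave_R i).1]
    exact Or.inl (hone hc)
  | switchRegister x hpc h hc =>
    exact Or.inl (register_spec hs (hs.ctrl.switch _ _ hpc)).2.2.1
  | runOn τ hpc => exact absurd hpc (hrun τ)
  | spawn τ τ' hpc => exact absurd hpc (hrun τ)
  | finish τ hpc => exact absurd hpc (hrun τ)
  | _ =>
    simp only [*, reduceCtorEq, false_or] at hor
    exact hor

namespace Execution

/-- At time `n`, the threads only build teams; `V` are the sizes of their smallest tasks. -/
structure Building (e : Execution m req) (V : Thread m → ℕ) (n : ℕ) : Prop where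
  lev : ∀ k, V k = 2 ^ (e.state n).lev k
  requirement : ∀ k, ((e.state n).R k).r = 1 ∨ ((e.state n).R k).r = V k
  t_eq : ∀ k, ((e.state n).R k).t = 1
  step : BuildStep V (e.sched n) (e.state n) (e.state (n + 1))

/-- The levels are constant once the queues are. The requirement of a thread becomes `1` or `V k` at
its next pass through `getTask` and stays so. -/
theorem exists_eventually_building (e : Execution m req) (hreq : ∀ τ, IsSize m (req τ))
    (hq : ∀ᶠ n in atTop, e.Quiet n) : ∃ V, ∀ᶠ n in atTop, e.Building V n := by
  have ht := e.eventually_t_eq_one hreq hq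
  have hQ := e.eventually_Q_eq hreq hq
  obtain ⟨V, hV⟩ : ∃ V : Thread m → ℕ, ∀ᶠ n in atTop, V = fun k => 2 ^ (e.state n).lev k := by
    have : ∀ᶠ n in atTop,
        (fun k => 2 ^ (e.state (n + 1)).lev k) = fun k => 2 ^ (e.state n).lev k := by
      filter_upwards [hQ] with n hn
      funext k
      rw [lev_eq_of_empty_iff (s := e.state n) (by simp [hn])]
    obtain ⟨V, hV⟩ := exists_eventually_eq (f := fun n k => 2 ^ (e.state n).lev k) this
    exact ⟨V, hV.mono fun _ h => h.symm⟩
  have hr : ∀ᶠ n in atTop, ∀ k, ((e.state n).R k).r = 1 ∨ ((e.state n).R k).r = V k := by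
    rw [eventually_all]
    intro k
    have key : ∀ᶠ n in atTop, (e.sched n = k → (e.state n).pc k = .getTask ∨
        ((e.state n).R k).r = 1 ∨ ((e.state n).R k).r = V k →
        ((e.state (n + 1)).R k).r = 1 ∨ ((e.state (n + 1)).R k).r = V k) := by
      filter_upwards [hq, ht, hQ, hV] with n h1 h2 h3 h4 hs
      subst hs
      rw [h4]
      exact (e.step n).requirement (e.inv hreq n) h1.not_launches h3 (h1.not_runs _)
        (h1.G_eq _) h2
    apply e.eventually_of_getTask hq k
    · filter_upwards [key] with n hn hk
      by_cases hs : e.sched n = k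
      · exact hn hs (Or.inr hk)
      · rw [((e.step n).R_other (Ne.symm hs)).1]
        exact hk
    · filter_upwards [key] with n hn hs hpc
      exact hn hs (Or.inl hpc)
  refine ⟨V, ?_⟩
  filter_upwards [hq, ht, hQ, hV, hr] with n h1 h2 h3 h4 h5
  have h4' := congrFun h4
  exact ⟨h4', h5, h2, (e.step n).buildStep (e.inv hreq n) h1.not_launches h3
    (h1.not_runs _) (h1.G_eq _) h2 h4' h5⟩

end Execution

end TeamBuilding

namespace TeamBuilding

open State Filter

variable {m : ℕ} {Task : Type*} {req : Task → ℕ} {s s' : State m Task} {i : Thread m}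
  {V : Thread m → ℕ}

/-! ### Competition of coordinators -/

/-- The rank of a coordinator in the competition for threads: smaller tasks win, and among tasks of
the same size the smaller id. -/
def prio (V : Thread m → ℕ) (x : Thread m) : ℕ := V x * 2 ^ m + x.val

theorem prio_lt {x y : Thread m} : prio V x < prio V y ↔ V x < V y ∨ V x = V y ∧ x < y := by
  unfold prio
  have hx := x.2
  have hy := y.2
  rw [Fin.lt_def]
  rcases lt_trichotomy (V x) (V y) with h | h | h
  · have : (V x + 1) * 2 ^ m ≤ V y * 2 ^ m := Nat.mul_le_mul_right _ h
    have e : (V x + 1) * 2 ^ m = V x * 2 ^ m + 2 ^ m := by ring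
    omega
  · rw [h]
    omega
  · have : (V y + 1) * 2 ^ m ≤ V x * 2 ^ m := Nat.mul_le_mul_right _ h
    have e : (V y + 1) * 2 ^ m = V y * 2 ^ m + 2 ^ m := by ring
    omega

theorem prio_injective : Function.Injective (prio V) := by
  intro x y h
  have h1 : ¬ prio V x < prio V y := by omega
  have h2 : ¬ prio V y < prio V x := by omega
  rw [prio_lt] at h1 h2
  push Not at h1 h2
  have hV := le_antisymm h2.1 h1.1
  exact le_antisymm (h2.2 hV.symm) (h1.2 hV)

/-- Thread `y` tries to build a team. -/
def State.Leads (s : State m Task) (y : Thread m) : Prop := 1 < (s.R y).r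

/-- The program location and the coordinator of thread `j` fit the sizes `V` of the tasks. -/
structure State.Steady (V : Thread m → ℕ) (s : State m Task) (j : Thread m) : Prop where
  le : V (s.c j) ≤ V j
  poll : ∀ r l, s.pc j = .poll r l → r = V (s.c j)
  steal : ∀ l, s.pc j = .steal l → 2 ^ m < V j
  switch : ∀ z, s.pc j = .switchTo z → Overlap (V z) z j ∧ V z ≤ V j ∧
    (prio V z < prio V (s.c j) ∨ s.c j = j ∧ (s.R j).r = 1)

/-- A registered thread is in the block required by its coordinator. -/
def State.Located (V : Thread m → ℕ) (s : State m Task) (j : Thread m) : Prop :=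
  s.c j ≠ j → Overlap (V (s.c j)) (s.c j) j

theorem SameReg.active (h : SameReg i s s') (hst : Step req i s s') (hc : s'.c i = s.c i) :
    s'.Active i ↔ s.Active i := by
  unfold Active
  rw [hc, h.2.2]
  rcases eq_or_ne (s.c i) i with e | e
  · rw [e, h.2.1]
  · rw [(hst.R_other e).2.2]

namespace Execution

variable {e : Execution m req} {n : ℕ}

theorem Building.r_eq (hb : e.Building V n) {y : Thread m} (hy : (e.state n).Leads y) :
    ((e.state n).R y).r = V y := by
  unfold Leads at hy
  rcases hb.requirement y with h | h
  · omega
  · exact h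

theorem Building.isSize (hb : e.Building V n) (hi : (e.state n).Inv req) {y : Thread m} (hy : (e.state n).Leads y) : IsSize m (V y) := by
  rw [← hb.r_eq hy]
  exact hi.ctrl.reg.size_r y

/-- What a thread learns when its partner's coordinator wins. -/
theorem Building.partnerWins (hb : e.Building V n) (hi : (e.state n).Inv req) {j : Thread m} {r l : ℕ} (hloc : ∀ j, (e.state n).Located V j)
    (hl : 2 ^ l < r) (hr : r = V ((e.state n).c j)) (h : (e.state n).PartnerWins j r l) :
    let z := (e.state n).c (partner j l)
    (e.state n).Leads z ∧ Overlap (V z) z j ∧ prio V z < prio V ((e.state n).c j) := by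
  intro z
  obtain ⟨hne, h⟩ := h
  change ((((e.state n).R z).r = r ∧ z < (e.state n).c j) ∨
    (((e.state n).R z).r < r ∧ 2 ^ (l + 1) ≤ ((e.state n).R z).r)) at h
  have hpos := Nat.two_pow_pos l
  have hlz : 2 ^ l < ((e.state n).R z).r := by
    have : 2 ^ l < 2 ^ (l + 1) := Nat.pow_lt_pow_right (by norm_num) (by omega)
    omega
  have hz : (e.state n).Leads z := by
    unfold Leads
    omega
  refine ⟨hz, ?_, ?_⟩
  · rw [hb.r_eq hz] at hlz
    -- The partner is in the block of `z`, being `z` itself or registered there; since `2 ^ l < V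
    -- z`, thread `j` lies in the same block as its partner.
    have h1 : Overlap (V z) z (partner j l) := by
      by_cases hp : (e.state n).c (partner j l) = partner j l
      · change Overlap (V z) ((e.state n).c (partner j l)) (partner j l)
        rw [hp]
        exact Overlap.refl _ _
      · exact hloc _ hp
    exact h1.trans ((hb.isSize hi hz).overlap_partner j hlz)
  · rw [hb.r_eq hz, hr] at h
    rw [prio_lt]
    tauto

theorem Building.located (hb : e.Building V n) (hi : (e.state n).Inv req) (hloc : (e.state n).Located V i) :
    (e.state (n + 1)).Located V i := by
  have hst := e.step n
  rcases eq_or_ne i (e.sched n) with rfl | hne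
  · have hx : ∀ x, x ≠ e.sched n → Overlap ((e.state n).R x).r x (e.sched n) →
        Overlap (V x) x (e.sched n) := by
      intro x hx ho
      rwa [hb.r_eq (hi.ctrl.reg.one_lt_of_overlap hx.symm ho)] at ho
    unfold Located at *
    cases hb.step with
    | stealRegister l hpc hl h hpc' hc' =>
      intro _
      rw [hc']
      exact hx _ (Requires.coordinator_ne hi hpc h) h.2
    | switchRegister x hpc h hc hpc' hc' =>
      intro _
      rw [hc']
      exact hx _ (hi.ctrl.switch _ _ hpc) h
    | revoked _ _ _ _ hc' => simp [hc']
    | dropOut _ _ _ _ _ _ hc' => simp [hc']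
    | idle _ _ _ _ hc' => simp [hc']
    | coordinate _ _ _ _ _ _ hc' => simp [hc']
    | switchLeave _ _ _ _ _ hc' => simp [hc']
    | _ => simp_all
  · unfold Located at *
    rwa [hst.c_other hne]

/-- An active registration is located by `RegInv.active`, and an inactive one is dropped at
`getTask`. -/
theorem Building.located_getTask (hb : e.Building V n) (hi : (e.state n).Inv req) (hs : e.sched n = i) (hpc : (e.state n).pc i = .getTask) :
    (e.state (n + 1)).Located V i := by
  by_cases hc : (e.state n).c i = i
  · exact hb.located hi fun h => absurd hc h
  by_cases ha : (e.state n).Active i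
  · refine hb.located hi fun _ => ?_
    have ho := hi.ctrl.reg.active _ _ rfl (Ne.symm hc) ha
    rwa [hb.r_eq (hi.ctrl.reg.one_lt_of_active hc ha)] at ho
  · subst hs
    cases hb.step with
    | revoked _ _ _ _ hc' => exact fun h => absurd hc' h
    | _ => simp_all

/-- The second alternative in the clause `switch` covers the moment between deregistering and
registering, when the former coordinator is no longer recorded. -/
theorem Building.steady (hb : e.Building V n) (hi : (e.state n).Inv req) (hloc : ∀ j, (e.state n).Located V j)
    (hs : (e.state n).Steady V i ∨ e.sched n = i ∧ (e.state n).pc i = .getTask) :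
    (e.state (n + 1)).Steady V i := by
  have hst := e.step n
  rcases eq_or_ne i (e.sched n) with rfl | hne
  · have hs' : (e.state n).pc (e.sched n) ≠ .getTask → (e.state n).Steady V (e.sched n) := by
      tauto
    cases hb.step with
    | revoked _ _ _ hpc' hc' => constructor <;> simp [hpc', hc']
    | dropOut _ _ _ _ _ hpc' hc' => constructor <;> simp [hpc', hc']
    | help hpc hc ha hV hpc' hc' => constructor <;> simp [hpc', hc', hV]
    | idle hpc hc hV hpc' hc' => constructor <;> simp [hpc', hc', hV]
    | coordinate hpc hc hV ha h1 hpc' hc' => constructor <;> simp [hpc', hc']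
    | stealDone l hpc hl hpc' hc' =>
      have := (hs' (by simp [hpc])).le
      constructor <;> simp [hpc', hc', this]
    | stealRegister l hpc hl h hpc' hc' =>
      have h1 := (hs' (by simp [hpc])).steal l hpc
      have h2 : (e.state n).Leads ((e.state n).c (partner (e.sched n) l)) :=
        hi.ctrl.reg.one_lt_of_overlap (Requires.coordinator_ne hi hpc h).symm h.2
      have h3 := (hb.isSize hi h2).le
      refine ⟨?_, ?_, ?_, ?_⟩
      · rw [hc']; omega
      all_goals simp [hpc']
    | stealNext l hpc hl h hpc' hc' =>
      have h1 := (hs' (by simp [hpc])).steal l hpc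
      have := (hs' (by simp [hpc])).le
      constructor <;> simp [hpc', hc', this, h1]
    | pollDone r l hpc hl hpc' hc' =>
      have := (hs' (by simp [hpc])).le
      constructor <;> simp [hpc', hc', this]
    | pollSwitch r l hpc hl h hpc' hc' =>
      have h0 := hs' (by simp [hpc])
      obtain ⟨-, h2, h3⟩ := hb.partnerWins hi hloc hl (h0.poll _ _ hpc) h
      refine ⟨by rw [hc']; exact h0.le, by simp [hpc'], by simp [hpc'], ?_⟩
      intro z hz
      rw [hpc', PC.switchTo.injEq] at hz
      subst hz
      rw [hc']
      refine ⟨h2, ?_, Or.inl h3⟩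
      have := h0.le
      rcases prio_lt.1 h3 with h | h <;> omega
    | pollNext r l hpc hl h hpc' hc' =>
      have h0 := hs' (by simp [hpc])
      have := h0.poll _ _ hpc
      constructor <;> simp [hpc', hc', h0.le, this]
    | switchVoid x hpc h hpc' hc' =>
      have := (hs' (by simp [hpc])).le
      constructor <;> simp [hpc', hc', this]
    | switchLeave x hpc h hc hpc' hc' hR =>
      have h0 := (hs' (by simp [hpc])).switch x hpc
      refine ⟨by rw [hc'], by simp [hpc'], by simp [hpc'], ?_⟩
      intro z hz
      rw [hpc', PC.switchTo.injEq] at hz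
      subst hz
      refine ⟨h0.1, h0.2.1, Or.inr ⟨hc', ?_⟩⟩
      rw [hR.1]
      exact hi.ctrl.reg.r_eq_one _ hc
    | switchRegister x hpc h hc hpc' hc' =>
      have h0 := (hs' (by simp [hpc])).switch x hpc
      refine ⟨by rw [hc']; exact h0.2.1, ?_, ?_, ?_⟩ <;> simp [hpc']
  · have h0 : (e.state n).Steady V i := by
      rcases hs with h | h
      · exact h
      · exact absurd h.1.symm hne
    refine ⟨?_, ?_, ?_, ?_⟩ <;>
      simp only [hst.c_other hne, hst.pc_other hne, (hst.R_other hne).1]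
    · exact h0.le
    · exact h0.poll
    · exact h0.steal
    · exact h0.switch

/-- The counter of a coordinator does not change while it tries to build its team. -/
theorem Building.N_eq (hb : e.Building V n) {z : Thread m} (hz : (e.state n).Leads z) (hz' : (e.state (n + 1)).Leads z) :
    ((e.state (n + 1)).R z).N = ((e.state n).R z).N := by
  rcases eq_or_ne z (e.sched n) with rfl | hne
  · unfold Leads at hz'
    cases hb.step <;> first
      | omega
      | exact (‹SameReg _ _ _›).2.1
  · exact ((e.step n).R_other hne).2.2

/-- A coordinator gives up only in favour of a better one. -/
theorem Building.gives_up (hb : e.Building V n) (hi : (e.state n).Inv req) {y : Thread m} (hs : (e.state n).Steady V y)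
    (hy : (e.state n).Leads y) (hy' : ¬ (e.state (n + 1)).Leads y) :
    ∃ z, (e.state (n + 1)).c y = z ∧ z ≠ y ∧ (e.state (n + 1)).Active y ∧
      prio V z < prio V y := by
  have hst := e.step n
  rcases eq_or_ne y (e.sched n) with rfl | hne
  · unfold Leads at hy hy'
    cases hb.step with
    | stealRegister l hpc =>
      have := (hi.ctrl.steal _ _ hpc).2
      omega
    | switchRegister x hpc h hc hpc' hc' hr' ha' =>
      refine ⟨x, hc', hi.ctrl.switch _ _ hpc, ha', ?_⟩
      rcases (hs.switch x hpc).2.2 with h | h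
      · rwa [hc] at h
      · omega
    | coordinate _ _ _ _ _ _ _ hr' => omega
    | _ =>
      have := (‹SameReg _ _ _›).1
      omega
  · unfold Leads at hy hy'
    rw [(hst.R_other hne).1] at hy'
    exact absurd hy hy'

end Execution

end TeamBuilding

/-! ### Stabilization of the coordinators and of all registrations -/

namespace TeamBuilding

open State Filter

variable {m : ℕ} {Task : Type*} {req : Task → ℕ} {s s' : State m Task} {i : Thread m}
  {V : Thread m → ℕ}

/-- Thread `y` follows a coordinator better than itself. -/
def State.Follows (V : Thread m → ℕ) (s : State m Task) (y : Thread m) : Prop :=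
  (s.c y ≠ y ∧ s.Active y ∧ prio V (s.c y) < prio V y) ∨
    ∃ z, s.pc y = .switchTo z ∧ s.c y = y ∧ (s.R y).r = 1 ∧ s.Leads z ∧ prio V z < prio V y

theorem State.Follows.not_leads {y : Thread m} (h : s.Follows V y) (hi : s.Inv req) :
    ¬ s.Leads y := by
  unfold Leads
  rcases h with ⟨hc, -⟩ | ⟨z, -, -, hr, -⟩
  · rw [hi.ctrl.reg.r_eq_one _ hc]
    omega
  · omega

namespace Execution

variable {e : Execution m req} {n : ℕ}

/-- An active registration at a coordinator that does not give up remains active. -/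
theorem Building.active_other (hb : e.Building V n) (hi : (e.state n).Inv req) {y : Thread m}
    (hne : y ≠ e.sched n) (hc : (e.state n).c y ≠ y) (ha : (e.state n).Active y)
    (hk : (e.state n).Leads ((e.state n).c y) → (e.state (n + 1)).Leads ((e.state n).c y)) :
    (e.state (n + 1)).Active y := by
  have hz : (e.state n).Leads ((e.state n).c y) := hi.ctrl.reg.one_lt_of_active hc ha
  unfold Active at *
  rw [(e.step n).c_other hne, (e.step n).cN_other hne, hb.N_eq hz (hk hz)]
  exact ha

/-- As the better coordinators persist, a registration with one of them stays active. Dropping out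
is excluded by `Steady.le`, so the only way out is a switch, which leads to a still better
coordinator. -/
theorem Building.follows (hb : e.Building V n) (hi : (e.state n).Inv req) {y : Thread m}
    (hs : (e.state n).Steady V y)
    (hk : ∀ z, prio V z < prio V y → (e.state n).Leads z → (e.state (n + 1)).Leads z)
    (hf : (e.state n).Follows V y) : (e.state (n + 1)).Follows V y := by
  have hst := e.step n
  rcases eq_or_ne y (e.sched n) with rfl | hne
  · rcases hf with ⟨hc, ha, hp⟩ | ⟨z, hz, hc, hr, hl, hp⟩
    · have key : SameReg (e.sched n) (e.state n) (e.state (n + 1)) →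
          (e.state (n + 1)).c (e.sched n) = (e.state n).c (e.sched n) →
          (e.state (n + 1)).Follows V (e.sched n) := by
        intro h h'
        refine Or.inl ⟨by rwa [h'], (h.active hst h').2 ha, by rwa [h']⟩
      cases hb.step with
      | switchLeave x hpc h hcc hpc' hc' hR =>
        have hlx : (e.state n).Leads x :=
          hi.ctrl.reg.one_lt_of_overlap (hi.ctrl.switch _ _ hpc).symm h
        have hpx : prio V x < prio V (e.sched n) := by
          rcases (hs.switch x hpc).2.2 with h | h
          · omega
          · exact absurd h.1 hc
        refine Or.inr ⟨x, hpc', hc', ?_, hk x hpx hlx, hpx⟩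
        rw [hR.1]
        exact hi.ctrl.reg.r_eq_one _ hc
      | stealRegister l hpc => exact absurd (hi.ctrl.steal _ _ hpc).1 hc
      | dropOut hpc _ _ hV =>
        have := hs.le
        omega
      | revoked _ _ h => exact absurd ha h
      | idle _ h => exact absurd h hc
      | coordinate _ h => exact absurd h hc
      | switchRegister _ _ _ h => exact absurd h hc
      | _ => exact key ‹_› ‹_›
    · cases hb.step with
      | switchVoid x hpc h =>
        rw [hz, PC.switchTo.injEq] at hpc
        subst hpc
        rw [hb.r_eq hl] at h
        exact absurd (hs.switch _ hz).1 h
      | switchLeave x hpc h hcc => exact absurd hc hcc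
      | switchRegister x hpc h hcc hpc' hc' hr' ha' =>
        rw [hz, PC.switchTo.injEq] at hpc
        subst hpc
        refine Or.inl ⟨?_, ha', by rwa [hc']⟩
        rw [hc']
        exact hi.ctrl.switch _ _ hz
      | _ => simp_all
  · rcases hf with ⟨hc, ha, hp⟩ | ⟨z, hz, hc, hr, hl, hp⟩
    · refine Or.inl ⟨?_, hb.active_other hi hne hc ha (hk _ hp), ?_⟩ <;> rwa [hst.c_other hne]
    · refine Or.inr ⟨z, ?_, ?_, ?_, hk z hp hl, hp⟩
      · rwa [hst.pc_other hne]
      · rwa [hst.c_other hne]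
      · rwa [(hst.R_other hne).1]

/-- The conditions that hold from some time on while teams are built. -/
structure SteadyAt (e : Execution m req) (V : Thread m → ℕ) (n : ℕ) : Prop where
  building : e.Building V n
  inv : (e.state n).Inv req
  located : ∀ j, (e.state n).Located V j
  steady : ∀ j, (e.state n).Steady V j

theorem eventually_steadyAt (hreq : ∀ τ, IsSize m (req τ)) (hq : ∀ᶠ n in atTop, e.Quiet n)
    (hb : ∀ᶠ n in atTop, e.Building V n) : ∀ᶠ n in atTop, e.SteadyAt V n := by
  have hloc : ∀ᶠ n in atTop, ∀ j, (e.state n).Located V j := by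
    rw [eventually_all]
    intro j
    apply e.eventually_of_getTask hq j
    · filter_upwards [hb] with n hn h
      exact hn.located (e.inv hreq n) h
    · filter_upwards [hb] with n hn hs hpc
      exact hn.located_getTask (e.inv hreq n) hs hpc
  have hst : ∀ᶠ n in atTop, ∀ j, (e.state n).Steady V j := by
    rw [eventually_all]
    intro j
    apply e.eventually_of_getTask hq j
    · filter_upwards [hb, hloc] with n hn hl h
      exact hn.steady (e.inv hreq n) hl (Or.inl h)
    · filter_upwards [hb, hloc] with n hn hl hs hpc
      exact hn.steady (e.inv hreq n) hl (Or.inr ⟨hs, hpc⟩)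
  filter_upwards [hb, hloc, hst] with n h1 h2 h3
  exact ⟨h1, e.inv hreq n, h2, h3⟩

/-- From some time on, no coordinator gives up. -/
theorem eventually_leads_stable (hst : ∀ᶠ n in atTop, e.SteadyAt V n) (y : Thread m) :
    ∀ᶠ n in atTop, (e.state n).Leads y → (e.state (n + 1)).Leads y := by
  induction hp : prio V y using Nat.strong_induction_on generalizing y with
  | _ p ih =>
    have hk : ∀ᶠ n in atTop, ∀ z, prio V z < prio V y →
        (e.state n).Leads z → (e.state (n + 1)).Leads z := by
      rw [eventually_all]
      intro z
      by_cases hz : prio V z < prio V y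
      · filter_upwards [ih _ (hp ▸ hz) z rfl] with n hn _
        exact hn
      · exact Eventually.of_forall fun n h => absurd h hz
    have hf : ∀ᶠ n in atTop, (e.state n).Follows V y → (e.state (n + 1)).Follows V y := by
      filter_upwards [hk, hst] with n h1 h2
      exact h2.building.follows h2.inv (h2.steady y) h1
    -- Either `y` follows forever and never leads, or it never follows again and cannot give up,
    -- since giving up makes it a follower.
    rcases eventually_or_eventually_not_of_stable hf with h | h
    · filter_upwards [h, hst] with n h1 h2 h3
      exact absurd h3 (h1.not_leads h2.inv)
    · filter_upwards [eventually_succ h, hst] with n h1 h2 h3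
      by_contra h4
      obtain ⟨z, hz, hzy, ha, hpz⟩ := h2.building.gives_up h2.inv (h2.steady y) h3 h4
      subst hz
      exact h1 (Or.inl ⟨hzy, ha, hpz⟩)

open Classical in
/-- The rank of the coordinator that thread `j` is about to work for, and `K` if there is none. -/
noncomputable def _root_.TeamBuilding.State.goal (V : Thread m → ℕ) (K : ℕ) (s : State m Task)
    (j : Thread m) : ℕ :=
  match s.pc j with
  | .switchTo z => prio V z
  | _ => if s.c j ≠ j ∧ s.Active j then prio V (s.c j) else K

theorem _root_.TeamBuilding.State.goal_switchTo {K : ℕ} {j z : Thread m}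
    (h : s.pc j = .switchTo z) : s.goal V K j = prio V z := by
  simp [goal, h]

theorem _root_.TeamBuilding.State.goal_of_active {K : ℕ} {j : Thread m}
    (h : ∀ z, s.pc j ≠ .switchTo z) (hc : s.c j ≠ j) (ha : s.Active j) :
    s.goal V K j = prio V (s.c j) := by
  unfold goal
  split
  · exact absurd ‹_› (h _)
  · rw [if_pos ⟨hc, ha⟩]

theorem _root_.TeamBuilding.State.goal_of_not_active {K : ℕ} {j : Thread m}
    (h : ∀ z, s.pc j ≠ .switchTo z) (hc : ¬ (s.c j ≠ j ∧ s.Active j)) :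
    s.goal V K j = K := by
  unfold goal
  split
  · exact absurd ‹_› (h _)
  · rw [if_neg hc]

theorem _root_.TeamBuilding.State.goal_le {K : ℕ} (hK : ∀ x, prio V x < K) (j : Thread m) :
    s.goal V K j ≤ K := by
  unfold goal
  split
  · exact (hK _).le
  · split_ifs
    · exact (hK _).le
    · exact le_rfl

/-- A switch is decided only for a better coordinator. During it the target counts as the goal, so
that deregistering does not reset the goal to `K`; `hk` and `hsw` ensure that neither a registration
nor a pending switch becomes void. -/
theorem SteadyAt.goal_le (h : e.SteadyAt V n) {K : ℕ} (hK : ∀ x, prio V x < K)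
    (hk : ∀ z, (e.state n).Leads z → (e.state (n + 1)).Leads z)
    (hsw : ∀ j z, (e.state n).pc j = .switchTo z → (e.state n).Leads z) (j : Thread m) :
    (e.state (n + 1)).goal V K j ≤ (e.state n).goal V K j := by
  have hst := e.step n
  have hb := h.building
  rcases eq_or_ne j (e.sched n) with rfl | hne
  · have keep : (∀ z, (e.state n).pc (e.sched n) ≠ .switchTo z) →
        (∀ z, (e.state (n + 1)).pc (e.sched n) ≠ .switchTo z) →
        SameReg (e.sched n) (e.state n) (e.state (n + 1)) →
        (e.state (n + 1)).c (e.sched n) = (e.state n).c (e.sched n) →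
        (e.state (n + 1)).goal V K (e.sched n) ≤ (e.state n).goal V K (e.sched n) := by
      intro h1 h2 h3 h4
      by_cases ha : (e.state n).c (e.sched n) ≠ e.sched n ∧ (e.state n).Active (e.sched n)
      · rw [goal_of_active h1 ha.1 ha.2, goal_of_active h2 (by rw [h4]; exact ha.1)
          ((h3.active hst h4).2 ha.2), h4]
      · rw [goal_of_not_active h1 ha]
        exact State.goal_le hK _
    have top : (∀ z, (e.state n).pc (e.sched n) ≠ .switchTo z) →
        ¬ ((e.state n).c (e.sched n) ≠ e.sched n ∧ (e.state n).Active (e.sched n)) →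
        (e.state (n + 1)).goal V K (e.sched n) ≤ (e.state n).goal V K (e.sched n) := by
      intro h1 h2
      rw [goal_of_not_active h1 h2]
      exact State.goal_le hK _
    cases hb.step with
    | revoked hpc hc ha => exact top (by simp [hpc]) fun h => ha h.2
    | dropOut hpc hc ha hV =>
      have := (h.steady (e.sched n)).le
      omega
    | help hpc hc ha hV hpc' hc' hR => exact keep (by simp [hpc]) (by simp [hpc']) hR hc'
    | idle hpc hc => exact top (by simp [hpc]) fun h => h.1 hc
    | coordinate hpc hc => exact top (by simp [hpc]) fun h => h.1 hc
    | stealDone l hpc hl hpc' hc' hR => exact keep (by simp [hpc]) (by simp [hpc']) hR hc'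
    | stealRegister l hpc =>
      exact top (by simp [hpc]) fun h' => h'.1 (h.inv.ctrl.steal _ _ hpc).1
    | stealNext l hpc hl _ hpc' hc' hR => exact keep (by simp [hpc]) (by simp [hpc']) hR hc'
    | pollDone r l hpc hl hpc' hc' hR => exact keep (by simp [hpc]) (by simp [hpc']) hR hc'
    | pollSwitch r l hpc hl hw hpc' hc' hR =>
      obtain ⟨-, -, h3⟩ := hb.partnerWins h.inv h.located hl ((h.steady _).poll _ _ hpc) hw
      rw [goal_switchTo hpc']
      by_cases ha : (e.state n).c (e.sched n) ≠ e.sched n ∧ (e.state n).Active (e.sched n)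
      · rw [goal_of_active (by simp [hpc]) ha.1 ha.2]
        exact h3.le
      · rw [goal_of_not_active (by simp [hpc]) ha]
        exact (hK _).le
    | pollNext r l hpc hl _ hpc' hc' hR => exact keep (by simp [hpc]) (by simp [hpc']) hR hc'
    | switchVoid x hpc ho =>
      rw [hb.r_eq (hsw _ _ hpc)] at ho
      exact absurd ((h.steady _).switch x hpc).1 ho
    | switchLeave x hpc ho hc hpc' =>
      rw [goal_switchTo hpc, goal_switchTo hpc']
    | switchRegister x hpc ho hc hpc' hc' hr' ha' =>
      rw [goal_switchTo hpc, goal_of_active (by simp [hpc'])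
        (by rw [hc']; exact h.inv.ctrl.switch _ _ hpc) ha', hc']
  · by_cases hz : ∃ z, (e.state n).pc j = .switchTo z
    · obtain ⟨z, hz⟩ := hz
      rw [goal_switchTo hz, goal_switchTo (by rw [hst.pc_other hne]; exact hz)]
    · rw [not_exists] at hz
      by_cases ha : (e.state n).c j ≠ j ∧ (e.state n).Active j
      · rw [goal_of_active hz ha.1 ha.2, goal_of_active (by rwa [hst.pc_other hne])
          (by rw [hst.c_other hne]; exact ha.1) (hb.active_other h.inv hne ha.1 ha.2 (hk _)),
          hst.c_other hne]
      · rw [goal_of_not_active hz ha]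
        exact State.goal_le hK _

/-- From some time on, no thread enters or leaves a coordinator. -/
structure Frozen (e : Execution m req) (V : Thread m → ℕ) (C : Thread m → Thread m)
    (D : Set (Thread m)) (n : ℕ) : Prop extends e.SteadyAt V n where
  quiet : e.Quiet n
  leads : ∀ y, (e.state n).Leads y ↔ y ∈ D
  leads_succ : ∀ y, (e.state (n + 1)).Leads y ↔ y ∈ D
  c_eq : (e.state n).c = C
  c_eq_succ : (e.state (n + 1)).c = C
  not_requires : ∀ l, (e.state n).pc (e.sched n) = .steal l → l < m →
    ¬ (e.state n).Requires (e.sched n) l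
  not_wins : ∀ r l, (e.state n).pc (e.sched n) = .poll r l → 2 ^ l < r →
    ¬ (e.state n).PartnerWins (e.sched n) r l

/-- With a constant set of coordinators the goals are nonincreasing, hence constant. A decision to
switch and a registration while stealing lower the goal strictly, so neither recurs. -/
theorem exists_eventually_frozen (hq : ∀ᶠ n in atTop, e.Quiet n)
    (hst : ∀ᶠ n in atTop, e.SteadyAt V n) : ∃ C D, ∀ᶠ n in atTop, e.Frozen V C D n := by
  have hD : ∀ᶠ n in atTop, ∀ y, (e.state n).Leads y ↔
      y ∈ {y | ∀ᶠ n in atTop, (e.state n).Leads y} := by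
    rw [eventually_all]
    intro y
    rcases eventually_or_eventually_not_of_stable (eventually_leads_stable hst y) with h | h
    · filter_upwards [h] with n hn
      exact ⟨fun _ => h, fun _ => hn⟩
    · filter_upwards [h] with n hn
      refine ⟨fun h' => absurd h' hn, fun h' => ?_⟩
      obtain ⟨k, hk1, hk2⟩ := (h.and h').exists
      exact absurd hk2 hk1
  generalize {y | ∀ᶠ n in atTop, (e.state n).Leads y} = D at hD
  have hD' := eventually_succ hD
  have hsw : ∀ᶠ n in atTop, ∀ j z, (e.state n).pc j = .switchTo z → z ∈ D := by
    rw [eventually_all]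
    intro j
    have key : ∀ᶠ n in atTop, e.sched n = j →
        ((∀ z, (e.state n).pc j = .switchTo z → z ∈ D) ∨ (e.state n).pc j = .getTask) →
        ∀ z, (e.state (n + 1)).pc j = .switchTo z → z ∈ D := by
      filter_upwards [hst, hD] with n hn hd hj hor z hz
      subst hj
      cases hn.building.step with
      | pollSwitch r l hpc hl hw hpc' =>
        obtain ⟨h1, -, -⟩ := hn.building.partnerWins hn.inv hn.located hl
          ((hn.steady _).poll _ _ hpc) hw
        rw [hpc', PC.switchTo.injEq] at hz
        subst hz
        exact (hd _).1 h1
      | _ => simp_all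
    apply e.eventually_of_getTask hq j
    · filter_upwards [key] with n hn h
      by_cases hs : e.sched n = j
      · exact hn hs (Or.inl h)
      · rwa [(e.step n).pc_other (Ne.symm hs)]
    · filter_upwards [key] with n hn hs hpc
      exact hn hs (Or.inr hpc)
  obtain ⟨K, hK⟩ : ∃ K, ∀ x, prio V x < K :=
    ⟨∑ x, prio V x + 1, fun x => Nat.lt_succ_of_le
      (Finset.single_le_sum (f := prio V) (fun _ _ => Nat.zero_le _) (Finset.mem_univ x))⟩
  have hgoal : ∀ᶠ n in atTop, ∀ j, (e.state (n + 1)).goal V K j = (e.state n).goal V K j := by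
    rw [eventually_all]
    intro j
    apply eventually_eq_of_eventually_le (f := fun n => (e.state n).goal V K j)
    filter_upwards [hst, hD, hD', hsw] with n h1 h2 h3 h4
    exact h1.goal_le hK (fun z hz => (h3 z).2 ((h2 z).1 hz))
      (fun j z hz => (h2 z).2 (h4 j z hz)) j
  have hwins : ∀ᶠ n in atTop, ∀ r l, (e.state n).pc (e.sched n) = .poll r l → 2 ^ l < r →
      ¬ (e.state n).PartnerWins (e.sched n) r l := by
    filter_upwards [hst, hgoal] with n hn hg r l hpc hl hw
    have hg := hg (e.sched n)
    have hpc' : (e.state (n + 1)).pc (e.sched n)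
        = .switchTo ((e.state n).c (partner (e.sched n) l)) := by
      cases hn.building.step with
      | pollDone r' l' hpc2 hl' =>
        rw [hpc, PC.poll.injEq] at hpc2
        obtain ⟨rfl, rfl⟩ := hpc2
        omega
      | _ => simp_all
    obtain ⟨-, -, h3⟩ := hn.building.partnerWins hn.inv hn.located hl
      ((hn.steady _).poll _ _ hpc) hw
    rw [goal_switchTo hpc'] at hg
    by_cases ha : (e.state n).c (e.sched n) ≠ e.sched n ∧ (e.state n).Active (e.sched n)
    · rw [goal_of_active (by simp [hpc]) ha.1 ha.2] at hg
      omega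
    · rw [goal_of_not_active (by simp [hpc]) ha] at hg
      exact absurd hg (hK _).ne
  have hreqs : ∀ᶠ n in atTop, ∀ l, (e.state n).pc (e.sched n) = .steal l → l < m →
      ¬ (e.state n).Requires (e.sched n) l := by
    filter_upwards [hst, hgoal] with n hn hg l hpc hl hr
    have hg := hg (e.sched n)
    have hne := Requires.coordinator_ne hn.inv hpc hr
    rw [goal_of_not_active (s := e.state n) (by simp [hpc])
      fun h => h.1 (hn.inv.ctrl.steal _ _ hpc).1] at hg
    cases hn.building.step with
    | stealRegister l' hpc2 _ _ hpc' hc' hr' ha' =>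
      rw [hpc, PC.steal.injEq] at hpc2
      subst hpc2
      rw [goal_of_active (by simp [hpc']) (by rwa [hc']) ha'] at hg
      exact absurd hg (hK _).ne
    | stealDone l' hpc2 hl' =>
      rw [hpc, PC.steal.injEq] at hpc2
      omega
    | _ => simp_all
  have hnosw : ∀ᶠ n in atTop, ∀ j z, (e.state n).pc j ≠ .switchTo z := by
    rw [eventually_all]
    intro j
    have key : ∀ᶠ n in atTop, e.sched n = j →
        ((∀ z, (e.state n).pc j ≠ .switchTo z) ∨ (e.state n).pc j = .getTask) →
        ∀ z, (e.state (n + 1)).pc j ≠ .switchTo z := by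
      filter_upwards [hst, hwins] with n hn hw hj hor z hz
      subst hj
      cases hn.building.step with
      | pollSwitch r l hpc hl h => exact hw r l hpc hl h
      | _ => simp_all
    apply e.eventually_of_getTask hq j
    · filter_upwards [key] with n hn h
      by_cases hs : e.sched n = j
      · exact hn hs (Or.inl h)
      · rwa [(e.step n).pc_other (Ne.symm hs)]
    · filter_upwards [key] with n hn hs hpc
      exact hn hs (Or.inr hpc)
  -- Without registrations a thread can only return to being its own coordinator, which it does at
  -- most once.
  have hcc : ∀ᶠ n in atTop, ∀ j, (e.state (n + 1)).c j = (e.state n).c j ∨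
      (e.state (n + 1)).c j = j := by
    filter_upwards [hst, hnosw, hreqs] with n hn hno hr j
    by_cases hs : j = e.sched n
    · subst hs
      cases hn.building.step with
      | stealRegister l hpc hl h => exact absurd h (hr l hpc hl)
      | switchRegister x hpc => exact absurd hpc (hno _ _)
      | revoked _ _ _ _ hc' => exact Or.inr hc'
      | dropOut _ _ _ _ _ _ hc' => exact Or.inr hc'
      | idle _ _ _ _ hc' => exact Or.inr hc'
      | coordinate _ _ _ _ _ _ hc' => exact Or.inr hc'
      | switchLeave _ _ _ _ _ hc' => exact Or.inr hc'
      | _ => exact Or.inl ‹_›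
    · exact Or.inl ((e.step n).c_other hs)
  have hc : ∀ᶠ n in atTop, ∀ j, (e.state (n + 1)).c j = (e.state n).c j := by
    rw [eventually_all]
    intro j
    have : ∀ᶠ n in atTop, (e.state n).c j = j → (e.state (n + 1)).c j = j := by
      filter_upwards [hcc] with n hn h
      rcases hn j with h' | h'
      · rw [h', h]
      · exact h'
    rcases eventually_or_eventually_not_of_stable this with h | h
    · filter_upwards [h, eventually_succ h] with n h1 h2
      rw [h1, h2]
    · filter_upwards [eventually_succ h, hcc] with n h1 h2
      rcases h2 j with h' | h'
      · exact h'
      · exact absurd h' h1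
  obtain ⟨C, hC⟩ := exists_eventually_eq (f := fun n => (e.state n).c)
    (hc.mono fun n hn => funext hn)
  refine ⟨C, D, ?_⟩
  filter_upwards [hst, hq, hD, hD', hC, eventually_succ hC, hwins, hreqs] with
    n h1 h2 h3 h4 h5 h6 h7 h8
  exact ⟨h1, h2, h3, h4, h5, h6, h8, h7⟩

end Execution

end TeamBuilding

namespace TeamBuilding

open State Filter

variable {m : ℕ} {Task : Type*} {req : Task → ℕ} {V : Thread m → ℕ} {C : Thread m → Thread m}
  {D : Set (Thread m)}

/-! ### The best coordinator completes its team -/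

namespace Execution

variable {e : Execution m req}

/-- A thread that polls its partners reaches every level below the requirement. -/
theorem exists_poll_level {N n : ℕ} (hf : ∀ n ≥ N, e.Frozen V C D n) (hn : N ≤ n) {j : Thread m}
    {r l₀ l : ℕ} (hl₀ : l₀ ≤ l) (hl : 2 ^ l < r) (hpc : (e.state n).pc j = .poll r l₀) :
    ∃ n' ≥ N, e.sched n' = j ∧ (e.state n').pc j = .poll r l := by
  induction hd : l - l₀ generalizing n l₀ with
  | zero =>
    obtain rfl : l₀ = l := by omega
    obtain ⟨n', hn', hs, hp, -⟩ := e.exists_next_pc n j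
    exact ⟨n', by omega, hs, hp.trans hpc⟩
  | succ d ih =>
    obtain ⟨n', hn', hs, hp, -⟩ := e.exists_next_pc n j
    rw [hpc] at hp
    subst hs
    have hfr := hf n' (by omega)
    have hlt : 2 ^ l₀ < r := (Nat.pow_lt_pow_right (by norm_num) (by omega)).trans hl
    have hp' : (e.state (n' + 1)).pc (e.sched n') = .poll r (l₀ + 1) := by
      have hw := hfr.not_wins r l₀ hp hlt
      cases hfr.building.step with
      | pollDone r' l' hpc' hl' =>
        rw [hp, PC.poll.injEq] at hpc'
        obtain ⟨rfl, rfl⟩ := hpc'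
        omega
      | _ => simp_all
    exact ih (by omega) (by omega) hp' (by omega)

/-- A thread that looks for tasks reaches every level. -/
theorem exists_steal_level {N n : ℕ} (hf : ∀ n ≥ N, e.Frozen V C D n) (hn : N ≤ n) {j : Thread m}
    {l₀ l : ℕ} (hl₀ : l₀ ≤ l) (hl : l < m) (hpc : (e.state n).pc j = .steal l₀) :
    ∃ n' ≥ N, e.sched n' = j ∧ (e.state n').pc j = .steal l := by
  induction hd : l - l₀ generalizing n l₀ with
  | zero =>
    obtain rfl : l₀ = l := by omega
    obtain ⟨n', hn', hs, hp, -⟩ := e.exists_next_pc n j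
    exact ⟨n', by omega, hs, hp.trans hpc⟩
  | succ d ih =>
    obtain ⟨n', hn', hs, hp, -⟩ := e.exists_next_pc n j
    rw [hpc] at hp
    subst hs
    have hfr := hf n' (by omega)
    have hp' : (e.state (n' + 1)).pc (e.sched n') = .steal (l₀ + 1) := by
      have hw := hfr.not_requires l₀ hp (by omega)
      cases hfr.building.step with
      | stealDone l' hpc' hl' =>
        rw [hp, PC.steal.injEq] at hpc'
        omega
      | _ => simp_all
    exact ih (by omega) (by omega) hp' (by omega)

theorem exists_getTask_step {N : ℕ} (hf : ∀ n ≥ N, e.Frozen V C D n) (n : ℕ) (j : Thread m) :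
    ∃ n' ≥ N, n ≤ n' ∧ e.sched n' = j ∧ (e.state n').pc j = .getTask := by
  have := e.frequently_getTask (eventually_atTop.2 ⟨N, fun n hn => (hf n hn).quiet⟩) j
  obtain ⟨k, hk, h1, h2⟩ := frequently_atTop.1 this (max n N)
  exact ⟨k, by omega, by omega, h1, h2⟩

/-- What a thread does after `getTask`. -/
theorem Frozen.getTask_cases {n : ℕ} (h : e.Frozen V C D n) {j : Thread m} (hs : e.sched n = j)
    (hpc : (e.state n).pc j = .getTask) :
    (C j = j ∧ 2 ^ m < V j ∧ (e.state (n + 1)).pc j = .steal 0) ∨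
    (C j ∈ D ∧ (e.state (n + 1)).pc j = .poll (V (C j)) 0 ∧
      (C j ≠ j → (e.state n).Active j ∧ (e.state (n + 1)).Active j)) := by
  subst hs
  have hc := h.c_eq
  have hc1 := h.c_eq_succ
  have hst := e.step n
  cases h.building.step with
  | revoked _ hne _ _ hc' =>
    rw [hc1] at hc'
    rw [hc] at hne
    exact absurd hc' hne
  | dropOut _ hne _ _ _ _ hc' =>
    rw [hc1] at hc'
    rw [hc] at hne
    exact absurd hc' hne
  | help _ hne ha hV hpc' hc' hR =>
    have hl := (h.leads _).1 (h.inv.ctrl.reg.one_lt_of_active hne ha)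
    rw [hc] at hl hpc'
    exact Or.inr ⟨hl, hpc', fun _ => ⟨ha, (hR.active hst hc').2 ha⟩⟩
  | idle _ he hV hpc' =>
    rw [hc] at he
    exact Or.inl ⟨he, hV, hpc'⟩
  | coordinate _ he hV ha h1 hpc' hc' hr' =>
    rw [hc] at he
    have hl : (e.state (n + 1)).Leads (e.sched n) := by
      unfold Leads
      omega
    have hl := (h.leads_succ _).1 hl
    exact Or.inr (by rw [he]; exact ⟨hl, hpc', fun h => absurd rfl h⟩)
  | _ => simp_all

/-- All threads required by the best coordinator `x` are registered at `x`. -/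
theorem coordinator_eq_of_overlap {N : ℕ} (hf : ∀ n ≥ N, e.Frozen V C D n) {x : Thread m}
    (hx : x ∈ D) (hmin : ∀ y ∈ D, prio V x ≤ prio V y) (k : ℕ) (hk : 2 ^ k ≤ V x) {j : Thread m}
    (hj : Overlap (2 ^ k) x j) : C j = x := by
  have hfN := hf N le_rfl
  have hlx : ∀ n ≥ N, (e.state n).Leads x := fun n hn => ((hf n hn).leads x).2 hx
  have hsize : IsSize m (V x) := hfN.building.isSize hfN.inv (hlx N le_rfl)
  induction k generalizing j with
  | zero =>
    rw [pow_zero, overlap_one] at hj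
    subst hj
    rw [← hfN.c_eq]
    exact hfN.inv.ctrl.reg.c_eq (hlx N le_rfl)
  | succ k ih =>
    have hlt : 2 ^ k < 2 ^ (k + 1) := Nat.pow_lt_pow_right (by norm_num) (by omega)
    by_cases hjk : Overlap (2 ^ k) x j
    · exact ih (by omega) hjk
    have hkm : k + 1 ≤ m := (Nat.pow_le_pow_iff_right (by norm_num)).1 (hk.trans hsize.le)
    -- Here `j` lies in the half of the block that does not contain `x`, so its partner at level `k`
    -- is covered by the induction hypothesis.
    have hp : C (partner j k) = x :=
      ih (by omega) (overlap_partner_of_not_overlap (by omega) hj hjk)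
    by_contra hne
    obtain ⟨n, hn, -, hs, hpc⟩ := exists_getTask_step hf N j
    rcases (hf n hn).getTask_cases hs hpc with ⟨h1, h2, h3⟩ | ⟨h1, h2, -⟩
    · obtain ⟨n', hn', hs', hpc'⟩ :=
        exists_steal_level hf (by omega) (Nat.zero_le k) (by omega) h3
      have hfr := hf n' hn'
      subst hs'
      apply hfr.not_requires k hpc' (by omega)
      unfold Requires
      rw [hfr.c_eq, hp, hfr.building.r_eq (hlx n' hn')]
      exact ⟨hk, hj.mono_size (isSize_two_pow hkm) hsize hk⟩
    -- Since `x` is best, the requirement `V (C j)` is at least `V x`; polling therefore gets as far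
    -- as level `k` and meets a coordinator that wins.
    · have hlt' : prio V x < prio V (C j) := by
        refine lt_of_le_of_ne (hmin _ h1) fun e => hne (prio_injective e).symm
      have hV := prio_lt.1 hlt'
      have hr : 2 ^ k < V (C j) := by omega
      obtain ⟨n', hn', hs', hpc'⟩ :=
        exists_poll_level hf (by omega) (Nat.zero_le k) hr h2
      have hfr := hf n' hn'
      subst hs'
      apply hfr.not_wins _ k hpc' hr
      unfold PartnerWins
      rw [hfr.c_eq, hp]
      dsimp only
      rw [hfr.building.r_eq (hlx n' hn')]
      exact ⟨fun e => hne e.symm, by tauto⟩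

/-- The whole block of `x` is registered at `x`, and actively so, because an inactive registration
would be dropped and change the frozen `C`. The count then forces a launch, which the frozen phase
excludes. -/
theorem not_frozen_of_mem {N : ℕ} (hf : ∀ n ≥ N, e.Frozen V C D n) {x : Thread m}
    (hx : x ∈ D) (hmin : ∀ y ∈ D, prio V x ≤ prio V y) : False := by
  have hfN := hf N le_rfl
  have hlx : ∀ n ≥ N, (e.state n).Leads x := fun n hn => ((hf n hn).leads x).2 hx
  have hsize : IsSize m (V x) := hfN.building.isSize hfN.inv (hlx N le_rfl)
  have hC : ∀ j, Overlap (V x) x j → C j = x := by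
    obtain ⟨k, -, hk⟩ := hsize
    intro j hj
    exact coordinator_eq_of_overlap hf hx hmin k hk.ge (hk ▸ hj)
  have hact : ∀ᶠ n in atTop, ∀ j, Overlap (V x) x j ∧ j ≠ x → (e.state n).Active j := by
    rw [eventually_all]
    intro j
    by_cases hj : Overlap (V x) x j ∧ j ≠ x
    swap
    · exact Eventually.of_forall fun n h => absurd h hj
    have hcj : C j ≠ j := by
      rw [hC j hj.1]
      exact hj.2.symm
    have hq : ∀ᶠ n in atTop, e.Quiet n := eventually_atTop.2 ⟨N, fun n hn => (hf n hn).quiet⟩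
    suffices h : ∀ᶠ n in atTop, (e.state n).Active j from h.mono fun n hn _ => hn
    apply e.eventually_of_getTask hq j
    · refine eventually_atTop.2 ⟨N, fun n hn ha => ?_⟩
      have hfr := hf n hn
      have hce := hfr.c_eq
      have hce' := hfr.c_eq_succ
      by_cases hs : j = e.sched n
      · subst hs
        cases hfr.building.step with
        | coordinate _ h =>
          rw [hce] at h
          exact absurd h hcj
        | stealRegister => assumption
        | switchRegister => assumption
        | _ => exact ((‹SameReg _ _ _›).active (e.step n) (by rw [hce, hce'])).2 ha
      · refine hfr.building.active_other hfr.inv hs (by rwa [hce]) ha fun h => ?_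
        exact (hfr.leads_succ _).2 ((hfr.leads _).1 h)
    · refine eventually_atTop.2 ⟨N, fun n hn hs hpc => ?_⟩
      rcases (hf n hn).getTask_cases hs hpc with ⟨h, -⟩ | ⟨-, -, h⟩
      · exact absurd h hcj
      · exact (h hcj).2
  obtain ⟨M, hM⟩ := eventually_atTop.1 hact
  obtain ⟨n, hn, hnM, hs, hpc⟩ := exists_getTask_step hf M x
  have hfr := hf n hn
  have hcx : (e.state n).c x = x := hfr.inv.ctrl.reg.c_eq (hlx n hn)
  have ha : ((e.state n).R x).a = V x := by
    rw [hfr.inv.ctrl.reg.acquired, hfr.building.t_eq]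
    have he : helpers (e.state n).c (e.state n).R (e.state n).cN x
        = (block (V x) x).erase x := by
      ext j
      simp only [mem_helpers, hfr.building.t_eq, overlap_one, Finset.mem_erase, mem_block]
      constructor
      · rintro ⟨h1, h2, h3⟩
        have := hfr.inv.ctrl.reg.active x j h1 (Ne.symm h2) h3
        rw [hfr.building.r_eq (hlx n hn)] at this
        exact ⟨Ne.symm h2, this⟩
      · rintro ⟨h1, h2⟩
        have h3 : (e.state n).c j = x := by rw [hfr.c_eq]; exact hC j h2
        have h4 := hM n hnM j ⟨h2, h1⟩
        unfold Active at h4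
        rw [h3] at h4
        exact ⟨h3, Ne.symm h1, h4⟩
    rw [he, Finset.card_erase_of_mem (by simp [Overlap.refl]), card_block hsize]
    have := hsize.pos
    omega
  subst hs
  -- At `getTask`, a thread that coordinates itself can only be idle, contrary to its having a task,
  -- or lack threads, contrary to `ha`.
  cases hfr.building.step with
  | coordinate _ _ _ h => exact h (hfr.building.r_eq (hlx n hn)) ha.symm
  | idle _ _ h =>
    have := hsize.le
    omega
  | _ => simp_all

/-- In a finite computation, all queues are empty at some time. -/
theorem eventually_queues_empty (hreq : ∀ τ, IsSize m (req τ)) (hfin : e.FiniteComputation) :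
    ∀ᶠ n in atTop, ∀ i j, (e.state n).Q i j = [] := by
  have hq := e.eventually_quiet hreq hfin
  obtain ⟨V, hb⟩ := e.exists_eventually_building hreq hq
  obtain ⟨C, D, hfr⟩ := exists_eventually_frozen hq (eventually_steadyAt hreq hq hb)
  obtain ⟨N, hf⟩ := eventually_atTop.1 hfr
  have hV : ∀ x, 2 ^ m < V x := by
    intro x
    by_contra hx
    -- A thread with a task either coordinates it or is actively registered at some coordinator.
    have hne : ∃ y, y ∈ D := by
      obtain ⟨n, hn, -, hs, hpc⟩ := exists_getTask_step hf N x
      rcases (hf n hn).getTask_cases hs hpc with ⟨-, h, -⟩ | ⟨h, -⟩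
      · exact absurd h hx
      · exact ⟨_, h⟩
    obtain ⟨y, hy, hmin⟩ := Set.exists_min_image D (prio V) (Set.toFinite D) hne
    exact not_frozen_of_mem hf hy hmin
  filter_upwards [hb] with n hn i j
  have hlev : m < (e.state n).lev i := by
    have := hV i
    rw [hn.lev] at this
    exact (Nat.pow_lt_pow_iff_right (by norm_num)).1 this
  by_contra hQ
  by_cases hj : j ≤ m
  · have := lev_le_of_ne_nil hj hQ
    omega
  -- Levels above `m` are not seen by `lev`, but no task has such a size.
  · obtain ⟨τ, hτ⟩ := List.exists_mem_of_ne_nil _ hQ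
    have h1 := (e.inv hreq n).queue.size _ _ _ hτ
    have h2 := (hreq τ).le
    rw [h1] at h2
    exact hj ((Nat.pow_le_pow_iff_right (by norm_num)).1 h2)

/-- In a finite computation, every task in a queue will be launched. -/
theorem exists_launches (hreq : ∀ τ, IsSize m (req τ)) (hfin : e.FiniteComputation) {n : ℕ}
    {i : Thread m} {q : ℕ} {τ : Task} (hτ : τ ∈ (e.state n).Q i q) :
    ∃ n₀ ≥ n, Launches (e.sched n₀) τ (e.state n₀) (e.state (n₀ + 1)) := by
  by_contra hno
  push Not at hno
  have hstay : ∀ k ≥ n, ∃ i, τ ∈ (e.state k).Q i q := by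
    intro k hk
    induction k, hk using Nat.le_induction with
    | base => exact ⟨i, hτ⟩
    | succ k hk ih =>
      obtain ⟨i, hi⟩ := ih
      exact ((e.step k).mem_or_launches hi).resolve_right (hno k hk)
  obtain ⟨N, hN⟩ := eventually_atTop.1 (eventually_queues_empty hreq hfin)
  obtain ⟨i, hi⟩ := hstay (max n N) (le_max_left _ _)
  rw [hN _ (le_max_right _ _)] at hi
  simp at hi

end Execution

end TeamBuilding

/-! ### The lemma -/

theorem lemma1 {m : ℕ} {Task : Type*} (req : Task → ℕ)
    (hreq : ∀ τ, ∃ j ≤ m, req τ = 2 ^ j)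
    (e : TeamBuilding.Execution m req) (hfin : e.FiniteComputation)
    (n : ℕ) (i : TeamBuilding.Thread m) (q : ℕ) (τ : Task) (hτ : τ ∈ (e.state n).Q i q) :
    ∃ k < 2 ^ m / req τ,
      e.ExecutedByTeam n τ {j | k * req τ ≤ j.val ∧ j.val ≤ (k + 1) * req τ - 1} := by
  have hsize : ∀ τ, TeamBuilding.IsSize m (req τ) := hreq
  obtain ⟨n₀, hn₀, h⟩ := TeamBuilding.Execution.exists_launches hsize hfin hτ
  -- The index of the block that contains the launching coordinator.
  refine ⟨(e.sched n₀).val / req τ, ?_, ?_⟩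
  · exact Nat.div_lt_div_of_lt_of_dvd (hsize τ).dvd (e.sched n₀).2
  · have := e.executedByTeam_of_launches hsize hfin hn₀ h rfl
    simpa only [TeamBuilding.overlap_iff_mem_Icc (hsize τ).pos] using this
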